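/- All graphs are finite, simple and undirected. For independent sets $I_s, I_t$ of size $k$ of a graph $G$, a transformation from $I_s$ to $I_t$ is a finite sequence of independent sets of $G$ from $I_s$ to $I_t$ in which each set is obtained from the previous one by sliding one token along an edge, i.e. by replacing a vertex $u$ of the set by a vertex $v$ outside it with $uv\in E(G)$. Let $X\subseteq V(G)$. The $X$-trace of a set $S$ of vertices is the set of vertices of $X$ with a neighbour in $S$. An $\ell$-type is a sequence $I\,Y_1W_1\cdots Y_\ell W_\ell Y_{\ell+1}F$ where $I,F$ are nonempty subsets of $X$, each $W_i$ is a subset of $X$, and each $Y_i$ is a subset of $X$ or the symbol $\perp$. A vertex $v$ of a component $H$ of $G-X$ simulates the type if there is a walk $v\,P_1w_1\cdots P_\ell w_\ell P_{\ell+1}z$ in $H$ such that $v,w_i,z$ have $X$-traces $I,W_i,F$, and $Y_i$ is the $X$-trace of $P_i$ if $P_i$ is nonempty and $Y_i=\perp$ if $P_i$ is empty; when $P_i$ is empty, the two marked vertices around it may be the same vertex (in particular, a single vertex is a walk with $v=z$). The $\ell$-signature of $H$ is the set of all $m$-types with $m\le \ell$ that are simulated by some vertex of $H$. A collection $\mathcal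 H$ of components of $G-X$ is $\ell$-safe if, for every $H\in\mathcal H$, each type in the $\ell$-signature of $H$ belongs to the $\ell$-signatures of more than $\ell$ components of $\mathcal H$. A set $U\subseteq V(G)\setminus(I_s\cup I_t)$ is removable if there is a transformation from $I_s$ to $I_t$ in $G$ if and only if there is one in $G-U$. Let $I_s,I_t$ be independent sets of size $k$ of $G$ and let $X\subseteq V(G)$. Put $B(x,k)=5xk\,(2^{x}+1)^{2(5xk+2)}+4k+2$. 1. Every $(5|X|k)$-safe collection of at least $4k+2$ components of $G-X$ has a member $C$ such that $V(C)$ is removable. 2. There is a set of components of $G-X$ whose union $U$ is removable and such that $(G-U)-X$ has at most $B(|X|,k)$ components. Moreover $B(x,k)=2^{O(x^2k)}$ for $x,k\ge 1$. 3. There is an algorithm (a random access machine with addition and subtraction, at unit cost), a computable function $f$ and a constant $c$ such that, given $G$ on $n$ vertices (by its adjacency matrix), $X$, $I_s$, $I_t$ and $k$, where $G-X$ has more than $B(|X|,k)$ components, the algorithm outputs after at most $f(k,|X|)\cdot n^{c}$ steps the vertex set of a component $C$ of $G-X$ such that $V(C)$ is removable. -/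

import Mathlib

namespace TokenSliding

section Reconfiguration

variable {V : Type*}

/-- `J` arises from `I` by sliding one token along an edge of `G`. -/
def Slide (G : SimpleGraph V) (I J : Set V) : Prop :=
  ∃ u ∈ I, ∃ v, v ∉ I ∧ G.Adj u v ∧ J = insert v (I \ {u})

/-- There is a transformation from `I` to `J` in `G`: a finite sequence of independent sets of `G`
from `I` to `J` in which every set arises from the previous one by one token slide. -/
def Reconf (G : SimpleGraph V) (I J : Set V) : Prop :=
  Relation.ReflTransGen
    (fun A B => G.IsIndepSet A ∧ G.IsIndepSet B ∧ Slide G A B) I J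

/-- The connected components of `G - X`. -/
abbrev Comp (G : SimpleGraph V) (X : Set V) : Type _ :=
  (G.induce (Xᶜ)).ConnectedComponent

/-- The vertex set (in `G`) of a component of `G - X`. -/
def Comp.verts {G : SimpleGraph V} {X : Set V} (C : Comp G X) : Set V :=
  Subtype.val '' (SimpleGraph.ConnectedComponent.supp C)

/-- Deleting the vertex set `U` is legitimate and does not change whether `Is` can be transformed
into `It`: no token of `Is` or `It` is on `U`, and there is a transformation from `Is` to `It` in
`G` if and only if there is one in the induced subgraph `G - U`. -/
def Removable (G : SimpleGraph V) (Is It U : Set V) : Prop :=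
  Disjoint U (Is ∪ It) ∧
    (Reconf G Is It ↔
      Reconf (G.induce (Uᶜ)) (Subtype.val ⁻¹' Is : Set ↥(Uᶜ)) (Subtype.val ⁻¹' It))

end Reconfiguration

section Types

variable {V : Type*}

/-- The `X`-trace of `S`: the set of vertices of `X` with a neighbour in `S`. -/
def trace (G : SimpleGraph V) (X : Set V) (S : Set V) : Set X :=
  {x | ∃ v ∈ S, G.Adj v x}

/-- An `l`-type `I Y₁ W₁ Y₂ W₂ … Y_l W_l Y_{l+1} F`. Here `initial = I` and `final = F` are
nonempty subsets of `X`, `wait` lists the `W_i`, and `trans` lists the `Y_i`, where `none` is the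
special value `⊥`. -/
structure XType (X : Set V) (l : ℕ) where
  initial : Set X
  final : Set X
  wait : Fin l → Set X
  trans : Fin (l + 1) → Option (Set X)
  initial_nonempty : initial.Nonempty
  final_nonempty : final.Nonempty

/-- `Link G a P b`: the vertex `a`, the list of vertices `P` and the vertex `b` form, in this order,
a walk in `G`. If `P` is empty, `a` and `b` may be the same vertex (a token may
wait on the vertex on which its walk starts or ends, and the walk may be a single vertex). -/
def Link (G : SimpleGraph V) (a : V) (P : List V) (b : V) : Prop :=
  List.IsChain G.Adj (a :: (P ++ [b])) ∨ (P = [] ∧ a = b)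

/-- The vertex `v` simulates the type `T` inside the vertex set `H`: there is a walk
`v P₁ w₁ P₂ w₂ … P_l w_l P_{l+1} z` in `H` compatible with `T`. The vertices `v, w₁, …, w_l, z` are
`c 0, …, c (l + 1)`, and `P i` is the (possibly empty) walk between `c i` and `c (i + 1)`. -/
def Simulates (G : SimpleGraph V) (X H : Set V) {l : ℕ} (T : XType X l) (v : V) : Prop :=
  ∃ (c : Fin (l + 2) → V) (P : Fin (l + 1) → List V),
    (∀ i, c i ∈ H) ∧ (∀ i, ∀ u ∈ P i, u ∈ H) ∧
    (∀ i : Fin (l + 1), Link G (c i.castSucc) (P i) (c i.succ)) ∧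
    c 0 = v ∧
    trace G X {c 0} = T.initial ∧
    trace G X {c (Fin.last (l + 1))} = T.final ∧
    (∀ i : Fin l, trace G X {c i.succ.castSucc} = T.wait i) ∧
    (∀ i : Fin (l + 1), P i = [] → T.trans i = none) ∧
    (∀ i : Fin (l + 1), P i ≠ [] → T.trans i = some (trace G X {u | u ∈ P i}))

/-- The `l`-signature of a vertex `v` of `H`: all `m`-types with `m ≤ l` that `v` simulates in
`H`. -/
def vertexSignature (G : SimpleGraph V) (X H : Set V) (l : ℕ) (v : V) :
    Set (Σ m : ℕ, XType X m) :=
  {T | T.1 ≤ l ∧ Simulates G X H T.2 v}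

/-- The `l`-signature of a component of `G - X`: the union of those of its vertices. -/
def signature {G : SimpleGraph V} {X : Set V} (l : ℕ) (C : Comp G X) :
    Set (Σ m : ℕ, XType X m) :=
  ⋃ v ∈ C.verts, vertexSignature G X C.verts l v

/-- The component `C` is `l`-dangerous for the collection `𝓗` of components: some type in its
`l`-signature appears in the `l`-signatures of at most `l` components of `𝓗`. -/
def Dangerous {G : SimpleGraph V} {X : Set V} (l : ℕ) (𝓗 : Set (Comp G X)) (C : Comp G X) : Prop :=
  ∃ T ∈ signature l C, {C' ∈ 𝓗 | T ∈ signature l C'}.ncard ≤ l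

/-- A collection of components is `l`-safe if none of its members is `l`-dangerous for it. -/
def Safe {G : SimpleGraph V} {X : Set V} (l : ℕ) (𝓗 : Set (Comp G X)) : Prop :=
  ∀ C ∈ 𝓗, ¬ Dangerous l 𝓗 C

/-- The bound on the number of components, as a function of `x = |X|` and `k`. -/
def compBound (x k : ℕ) : ℕ :=
  5 * x * k * (2 ^ x + 1) ^ (2 * (5 * x * k + 2)) + 4 * k + 2

end Types

section Machine

/-- Memory of a random access machine: array number `a` holds the natural number `σ a i` in its
cell `i`. A program uses finitely many arrays. -/
abbrev Store : Type := ℕ → ℕ → ℕ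

/-- Expressions: constants, array access, addition, truncated subtraction. -/
inductive Expr : Type where
  | lit (c : ℕ)
  | get (a : ℕ) (i : Expr)
  | add (e₁ e₂ : Expr)
  | sub (e₁ e₂ : Expr)

def Expr.eval (σ : Store) : Expr → ℕ
  | .lit c => c
  | .get a i => σ a (i.eval σ)
  | .add e₁ e₂ => e₁.eval σ + e₂.eval σ
  | .sub e₁ e₂ => e₁.eval σ - e₂.eval σ

/-- Number of elementary operations in the evaluation of an expression. -/
def Expr.cost : Expr → ℕ
  | .lit _ => 1
  | .get _ i => i.cost + 1
  | .add e₁ e₂ => e₁.cost + e₂.cost + 1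
  | .sub e₁ e₂ => e₁.cost + e₂.cost + 1

/-- Programs. The command `assign a i e` writes the value of `e` to cell `i` of array `a`; tests
succeed when the expression is nonzero. -/
inductive Prog : Type where
  | skip
  | assign (a : ℕ) (i e : Expr)
  | seq (p q : Prog)
  | ite (e : Expr) (p q : Prog)
  | loop (e : Expr) (p : Prog)

/-- The store `σ` after writing `x` to cell `i` of array `a`. -/
def Store.write (σ : Store) (a i x : ℕ) : Store :=
  fun b j => if b = a ∧ j = i then x else σ b j

/-- `Exec p σ τ t`: started in the store `σ`, the program `p` halts in the store `τ` after exactly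
`t` elementary steps (unit cost). `loop e p` is "while `e ≠ 0` do `p`". -/
inductive Exec : Prog → Store → Store → ℕ → Prop
  | skip (σ : Store) : Exec .skip σ σ 1
  | assign (σ : Store) (a : ℕ) (i e : Expr) :
      Exec (.assign a i e) σ (σ.write a (i.eval σ) (e.eval σ)) (i.cost + e.cost + 1)
  | seq {p q : Prog} {σ τ ρ : Store} {s t : ℕ} :
      Exec p σ τ s → Exec q τ ρ t → Exec (.seq p q) σ ρ (s + t)
  | ite_true {e : Expr} {p q : Prog} {σ τ : Store} {t : ℕ} :
      e.eval σ ≠ 0 → Exec p σ τ t → Exec (.ite e p q) σ τ (e.cost + t + 1)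
  | ite_false {e : Expr} {p q : Prog} {σ τ : Store} {t : ℕ} :
      e.eval σ = 0 → Exec q σ τ t → Exec (.ite e p q) σ τ (e.cost + t + 1)
  | loop_done {e : Expr} {p : Prog} {σ : Store} :
      e.eval σ = 0 → Exec (.loop e p) σ σ (e.cost + 1)
  | loop_step {e : Expr} {p : Prog} {σ τ ρ : Store} {s t : ℕ} :
      e.eval σ ≠ 0 → Exec p σ τ s → Exec (.loop e p) τ ρ t →
        Exec (.loop e p) σ ρ (e.cost + s + t + 1)

open Classical in
/-- The input store for an instance on the vertex set `{0, …, n - 1}`: array `0` holds `n` and `k`,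
array `1` the adjacency matrix (row by row), arrays `2`, `3`, `4` the characteristic vectors of
`X`, `Is`, `It`; everything else is `0`. -/
noncomputable def inputStore {n : ℕ} (G : SimpleGraph (Fin n)) (X Is It : Set (Fin n)) (k : ℕ) :
    Store
  | 0, i => if i = 0 then n else if i = 1 then k else 0
  | 1, i => if ∃ u v : Fin n, i = (u : ℕ) * n + v ∧ G.Adj u v then 1 else 0
  | 2, i => if ∃ v ∈ X, (v : ℕ) = i then 1 else 0
  | 3, i => if ∃ v ∈ Is, (v : ℕ) = i then 1 else 0
  | 4, i => if ∃ v ∈ It, (v : ℕ) = i then 1 else 0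
  | _, _ => 0

/-- A store encodes the output set `U`: array `5` holds the characteristic vector of `U`. -/
def Outputs {n : ℕ} (σ : Store) (U : Set (Fin n)) : Prop :=
  ∀ v : Fin n, (v ∈ U → σ 5 v = 1) ∧ (v ∉ U → σ 5 v = 0)

end Machine

end TokenSliding

/-! Write x for |X|. Call a collection of components rich if every kind of visit possible in one
member (enter from a vertex of X, walk under prescribed restrictions on traces, leave to a vertex of
X) is possible in more than `5xk` members. Let M be the union of the members of a rich collection
that carry no token of `Is` or `It`, and let C be one of these members. The core of the proof turns
a transformation in G into one that never uses C.

Relax the rules: tokens are labelled, and tokens inside M ignore one another. Among the relaxed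
sequences between the two placements take one with the fewest slides touching X. Cut each visit of a
token a to M into phases, a phase ending when another token b enters a vertex y of X next to a
vertex that a has visited in that phase. If the same pair (y, b) ended three phases of one visit,
then b could step from y into M after its first entry, follow a, and return to y at the third entry.
This spends two slides touching X where b spent at least three (`exists_cheaper_of_three_entries`).
By minimality and pigeonhole a visit has at most 2xk cuts (`breakpoints_le`).

Within a phase all neighbours in X of the vertices visited so far are free. So the token may wait on
its first vertex and do all its walking just before the phase ends. The visit is therefore described
by alternating traces of waiting vertices and of walks, at most 4xk + 2 sets, and any walk obeying
these restrictions, in any component, can replace it (`exists_profile`). Richness offers more than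
5xk components for that walk. At most 3k are ruled out: 2k for the tokens of `Is` and `It`, one for
C, and k - 1 for those sheltering other tokens. Hence every visit moves to a private component other
than C, and since private components do not interact, the relaxed sequence becomes a genuine one
(`reroute`, `Rich.reconfAvoiding`).

Safe collections are rich because a visit in `l + 1` pieces yields an `l`-type (`Safe.rich`). For
the kernel, visits are coded by finitely many numbered tests, and components passing a test that at
most 5xk survivors pass are discarded. Every test is used at most once, so more than `compBound`
components leave a rich rest (`exists_subset_of_tests`, `exists_rich_subset`), and components can be
removed one at a time (`exists_few_remaining`). The algorithm performs the same elimination: a test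
is decided by closure computations in the graph, `n` rounds over all tests reach a stable collection
(`ends_rounds`), and a surviving token-free component is the output (`ends_find`). -/

namespace TokenSliding

/-! ### Labelled tokens, the relaxed rules inside M, and the cost of a sequence -/

section Labelled

variable {V : Type*} {ι : Type*} [DecidableEq ι]

/-- A placement `c` of labelled tokens that avoids `U` and in which any two tokens are on distinct
non-adjacent vertices, unless both are in `M`. For `M = ∅` this describes an independent set. -/
def Admissible (G : SimpleGraph V) (M U : Set V) (c : ι → V) : Prop :=
  (∀ i, c i ∉ U) ∧
    ∀ i j, i ≠ j → (c i ∈ M ∧ c j ∈ M) ∨ (c i ≠ c j ∧ ¬ G.Adj (c i) (c j))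

/-- One labelled token slides along an edge. -/
def Move (G : SimpleGraph V) (M U : Set V) (c c' : ι → V) : Prop :=
  Admissible G M U c ∧ Admissible G M U c' ∧
    ∃ i v, G.Adj (c i) v ∧ c' = Function.update c i v

open Classical in
/-- `1` for a slide that starts or ends in `X`, and `0` otherwise. -/
noncomputable def slideCost (X : Set V) (u v : V) : ℕ :=
  if u ≠ v ∧ (u ∈ X ∨ v ∈ X) then 1 else 0

/-- The number of tokens that perform a slide touching `X` between two placements. -/
noncomputable def moveCost [Fintype ι] (X : Set V) (c c' : ι → V) : ℕ :=
  ∑ i, slideCost X (c i) (c' i)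

/-- Reachability by moves of total cost `n`. -/
inductive CostReach [Fintype ι] (G : SimpleGraph V) (X M U : Set V) :
    ℕ → (ι → V) → (ι → V) → Prop
  | refl (c : ι → V) : CostReach G X M U 0 c c
  | step {n : ℕ} {c c' c'' : ι → V} : CostReach G X M U n c c' → Move G M U c' c'' →
      CostReach G X M U (n + moveCost X c' c'') c c''

theorem slideCost_self (X : Set V) (u : V) : slideCost X u u = 0 := by
  simp [slideCost]

theorem slideCost_of_notMem {X : Set V} {u v : V} (hu : u ∉ X) (hv : v ∉ X) :
    slideCost X u v = 0 := by
  simp [slideCost, hu, hv]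

variable {G : SimpleGraph V} {X M U : Set V}

/-- Neighbours of `u` lie in `M` or `X`, and tokens in `M` are ignored by a token in `M`; only
tokens in `X` can be in conflict with `u`. -/
theorem Admissible.update {c : ι → V} (hc : Admissible G M U c) {b : ι} {u : V}
    (hM : ∀ u ∈ M, ∀ v, G.Adj u v → v ∈ M ∨ v ∈ X) (hMU : Disjoint M U)
    (hu : u ∈ M) (hx : ∀ i, i ≠ b → c i ∈ X → ¬ G.Adj u (c i)) :
    Admissible G M U (Function.update c b u) := by
  have key : ∀ j, j ≠ b → (u ∈ M ∧ c j ∈ M) ∨ (u ≠ c j ∧ ¬ G.Adj u (c j)) := by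
    intro j hj
    by_cases h : c j ∈ M
    · exact Or.inl ⟨hu, h⟩
    · refine Or.inr ⟨fun h' => h (h' ▸ hu), fun h' => ?_⟩
      exact (hM u hu _ h').elim h fun h'' => hx j hj h'' h'
  refine ⟨fun i => ?_, fun i j hij => ?_⟩
  · by_cases h : i = b
    · subst h; simpa using hMU.notMem_of_mem_left hu
    · simpa [h] using hc.1 i
  · by_cases hi : i = b
    · subst hi
      simpa [Function.update_of_ne hij.symm] using key j hij.symm
    · by_cases hj : j = b
      · subst hj
        rcases key i hij with h | h
        · left; simpa [Function.update_of_ne hij] using h.symm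
        · right; simpa [Function.update_of_ne hij, eq_comm, G.adj_comm] using h
      · simpa [hi, hj] using hc.2 i j hij

variable [Fintype ι]

theorem moveCost_update (X : Set V) (c : ι → V) (i : ι) (v : V) :
    moveCost X c (Function.update c i v) = slideCost X (c i) v := by
  unfold moveCost
  rw [Finset.sum_eq_single i]
  · simp
  · intro j _ hj
    simp [Function.update_of_ne hj, slideCost_self]
  · simp

theorem CostReach.trans {m n : ℕ} {c c' c'' : ι → V} (h : CostReach G X M U m c c')
    (h' : CostReach G X M U n c' c'') : CostReach G X M U (m + n) c c'' := by
  induction h' with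
  | refl => exact h
  | step _ hm ih => rw [← add_assoc]; exact CostReach.step (ih h) hm

theorem CostReach.update {c : ι → V} {b : ι} {u : V} (hc : Admissible G M U c)
    (hu : Admissible G M U (Function.update c b u)) (h : G.Adj (c b) u) :
    CostReach G X M U (slideCost X (c b) u) c (Function.update c b u) := by
  have := CostReach.step (CostReach.refl (G := G) (X := X) (M := M) (U := U) c)
    ⟨hc, hu, b, u, h, rfl⟩
  simpa [moveCost_update] using this

theorem CostReach.of_seq {f : ℕ → ι → V} {cost : ℕ → ℕ} {p q : ℕ} (hpq : p ≤ q)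
    (h : ∀ t, p ≤ t → t < q → CostReach G X M U (cost t) (f t) (f (t + 1))) :
    CostReach G X M U (∑ t ∈ Finset.Ico p q, cost t) (f p) (f q) := by
  induction q, hpq using Nat.le_induction with
  | base => simpa using CostReach.refl (f p)
  | succ q hpq ih =>
    rw [Finset.sum_Ico_succ_top hpq]
    exact (ih fun t h1 h2 => h t h1 (by omega)).trans (h q hpq (by omega))

/-- Visits are cut at points in time, so the placements are needed as a function of time. Past `N`
the function stays at the final placement, which keeps it admissible everywhere. -/
theorem CostReach.exists_seq {n : ℕ} {c c' : ι → V} (h : CostReach G X M U n c c')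
    (hc : Admissible G M U c) :
    ∃ (f : ℕ → ι → V) (N : ℕ), f 0 = c ∧ f N = c' ∧ (∀ t, Admissible G M U (f t)) ∧
      (∀ t < N, Move G M U (f t) (f (t + 1))) ∧
      n = ∑ t ∈ Finset.range N, moveCost X (f t) (f (t + 1)) := by
  induction h with
  | refl c => exact ⟨fun _ => c, 0, rfl, rfl, fun _ => hc, by simp, by simp⟩
  | @step n c c' c'' h hm ih =>
    obtain ⟨f, N, h0, hN, hA, hM, hn⟩ := ih hc
    refine ⟨fun t => if t ≤ N then f t else c'', N + 1, by simp [h0], by simp, ?_, ?_, ?_⟩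
    · intro t
      by_cases ht : t ≤ N
      · simpa [ht] using hA t
      · simpa [ht] using hm.2.1
    · intro t ht
      rcases Nat.lt_succ_iff_lt_or_eq.1 ht with h1 | rfl
      · simpa [h1.le, Nat.succ_le_of_lt h1] using hM t h1
      · simpa [hN] using hm
    · rw [Finset.sum_range_succ, hn]
      congr 1
      · refine Finset.sum_congr rfl fun t ht => ?_
        have h1 := Finset.mem_range.1 ht
        simp [h1.le, Nat.succ_le_of_lt h1]
      · simp [hN]

theorem Move.costReach {c c' : ι → V} (h : Move G M U c c') :
    CostReach G X M U (moveCost X c c') c c' := by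
  simpa using CostReach.step (CostReach.refl c) h

/-- The token `b` can carry out the walk `y` in `M` instead of its own moves. -/
theorem CostReach.replace {f : ℕ → ι → V} {b : ι} {y : ℕ → V} {t : ℕ}
    (hM : ∀ u ∈ M, ∀ v, G.Adj u v → v ∈ M ∨ v ∈ X) (hMX : Disjoint M X) (hMU : Disjoint M U)
    (hf : Admissible G M U (f t)) (hf' : Admissible G M U (f (t + 1)))
    (hmove : Move G M U (f t) (f (t + 1)))
    (hy : y t ∈ M) (hy' : y (t + 1) ∈ M)
    (h1 : ∀ i, i ≠ b → f t i ∈ X → ¬ G.Adj (y t) (f t i))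
    (h2 : ∀ i, i ≠ b → f (t + 1) i ∈ X → ¬ G.Adj (y t) (f (t + 1) i))
    (h3 : ∀ i, i ≠ b → f (t + 1) i ∈ X → ¬ G.Adj (y (t + 1)) (f (t + 1) i))
    (hadj : y t = y (t + 1) ∨ G.Adj (y t) (y (t + 1))) :
    ∃ n, n + slideCost X (f t b) (f (t + 1) b) = moveCost X (f t) (f (t + 1)) ∧
      CostReach G X M U n (Function.update (f t) b (y t))
        (Function.update (f (t + 1)) b (y (t + 1))) := by
  have a1 := hf.update hM hMU hy h1
  have a2 := hf'.update hM hMU hy h2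
  have a3 := hf'.update hM hMU hy' h3
  -- The step of `f` is made first, with `b` still on `y t`; then `b` advances inside `M`, which is
  -- free of charge.
  have part2 : CostReach G X M U 0 (Function.update (f (t + 1)) b (y t))
      (Function.update (f (t + 1)) b (y (t + 1))) := by
    rcases hadj with h | h
    · rw [h]; exact .refl _
    · have hu := CostReach.update (X := X) a2 (b := b) (u := y (t + 1)) (by simpa using a3)
        (by simpa using h)
      simpa [slideCost_of_notMem (hMX.notMem_of_mem_left hy) (hMX.notMem_of_mem_left hy')] using hu
  obtain ⟨-, -, i, v, hadj', hupd⟩ := hmove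
  -- A step of `b` itself is dropped, saving its cost; a step of another token is copied at its old
  -- cost.
  by_cases hib : i = b
  · subst hib
    refine ⟨0, ?_, ?_⟩
    · rw [hupd, moveCost_update]; simp
    · have : Function.update (f t) i (y t) = Function.update (f (t + 1)) i (y t) := by
        rw [hupd]; simp
      rw [this]; exact part2
  · refine ⟨slideCost X (f t i) v + 0, ?_, CostReach.trans ?_ part2⟩
    · rw [hupd, moveCost_update, Function.update_of_ne (Ne.symm hib), slideCost_self]; rfl
    · have e : Function.update (f (t + 1)) b (y t)
          = Function.update (Function.update (f t) b (y t)) i v := by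
        rw [hupd, Function.update_comm hib]
      rw [e]
      have := CostReach.update (X := X) a1 (b := i) (u := v) (by rw [← e]; exact a2)
        (by simpa [hib] using hadj')
      simpa [Function.update_of_ne hib] using this

end Labelled

/-! ### Saving slides by following another token -/

section Mimic

variable {V : Type*} {ι : Type*} [DecidableEq ι] {G : SimpleGraph V} {X M U : Set V}

theorem Move.eq_or_adj {c c' : ι → V} (h : Move G M U c c') (i : ι) :
    c i = c' i ∨ G.Adj (c i) (c' i) := by
  obtain ⟨-, -, j, v, hv, rfl⟩ := h
  by_cases hij : i = j
  · subst hij; right; simpa using hv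
  · left; simp [hij]

theorem Move.eq_of_ne {c c' : ι → V} (h : Move G M U c c') {i j : ι} (hij : i ≠ j)
    (hi : c i ≠ c' i) : c j = c' j := by
  obtain ⟨-, -, l, v, hv, rfl⟩ := h
  by_cases hil : i = l
  · subst hil; simp [hij.symm]
  · exact absurd (by simp [hil]) hi

variable [Fintype ι]

/-- If `b` enters `x` three times while `a` stays in `M`, and `a` is next to `x` shortly before the
first and the third time, then `b` can save moves by following `a` in between. -/
theorem exists_cheaper_of_three_entries {f : ℕ → ι → V} {N : ℕ}
    (hM : ∀ u ∈ M, ∀ v, G.Adj u v → v ∈ M ∨ v ∈ X) (hMX : Disjoint M X) (hMU : Disjoint M U)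
    (hA : ∀ t, Admissible G M U (f t)) (hmv : ∀ t < N, Move G M U (f t) (f (t + 1)))
    {a b : ι} (hab : a ≠ b) {t₁ t₂ t₃ r₁ r₃ : ℕ} {x : V}
    (hr₁ : r₁ ≤ t₁) (h12 : t₁ < t₂) (h23 : t₂ < t₃) (hr₃ : t₁ < r₃) (hr₃' : r₃ ≤ t₃) (h3N : t₃ < N)
    (haM : ∀ t, r₁ ≤ t → t ≤ t₃ → f t a ∈ M) (hx : x ∈ X)
    (e₁ : f t₁ b ≠ x) (e₁' : f (t₁ + 1) b = x) (e₂ : f t₂ b ≠ x) (e₂' : f (t₂ + 1) b = x)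
    (e₃ : f t₃ b ≠ x) (e₃' : f (t₃ + 1) b = x)
    (g₁ : G.Adj (f r₁ a) x) (g₃ : G.Adj (f r₃ a) x)
    (w₁ : ∀ r, r₁ ≤ r → r ≤ t₁ → ∀ i, f t₁ i ∈ X → ¬ G.Adj (f r a) (f t₁ i))
    (w₃ : ∀ t, r₃ ≤ t → t ≤ t₃ → ∀ i, f t i ∈ X → ¬ G.Adj (f r₃ a) (f t i)) :
    ∃ n, CostReach G X M U n (f 0) (f N) ∧
      n < ∑ t ∈ Finset.range N, moveCost X (f t) (f (t + 1)) := by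
  have hstay : ∀ t < N, ∀ i, i ≠ b → f t b ≠ f (t + 1) b → f (t + 1) i = f t i := fun t ht i hi h =>
    ((hmv t ht).eq_of_ne (Ne.symm hi) h).symm
  have hself : ∀ t, r₁ ≤ t → t ≤ t₃ → ∀ i, f t i ∈ X → ¬ G.Adj (f t a) (f t i) := by
    intro t h1 h2 i hi
    by_cases hia : i = a
    · exact absurd hi (hia ▸ hMX.notMem_of_mem_left (haM t h1 h2))
    · rcases (hA t).2 a i (Ne.symm hia) with h | h
      · exact absurd hi (hMX.notMem_of_mem_left h.2)
      · exact h.2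
  have ha1 : f (t₁ + 1) a = f t₁ a := hstay t₁ (by omega) a hab (by rw [e₁']; exact e₁)
  -- the detour of `b` from `x` to the current position of `a`
  have detour : CostReach G X M U 1 (f (t₁ + 1))
      (Function.update (f (t₁ + 1)) b (f (t₁ + 1) a)) := by
    -- Only `b` moves in step `t₁`, so the other tokens in `X` are where `w₁` sees them: away from
    -- everything `a` has visited since `r₁`.
    have adm : ∀ r, r₁ ≤ r → r ≤ t₁ →
        Admissible G M U (Function.update (f (t₁ + 1)) b (f r a)) := by
      intro r h1 h2
      refine (hA _).update hM hMU (haM r h1 (by omega)) fun i hi hiX => ?_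
      have := hstay t₁ (by omega) i hi (by rw [e₁']; exact e₁)
      rw [this] at hiX ⊢
      exact w₁ r h1 h2 i hiX
    have walk : ∀ r, r₁ ≤ r → r ≤ t₁ →
        CostReach G X M U 1 (f (t₁ + 1)) (Function.update (f (t₁ + 1)) b (f r a)) := by
      intro r h1
      induction r, h1 using Nat.le_induction with
      | base =>
        intro _
        have := CostReach.update (X := X) (hA (t₁ + 1)) (adm r₁ le_rfl hr₁)
          (by rw [e₁']; exact g₁.symm)
        have hc : slideCost X (f (t₁ + 1) b) (f r₁ a) = 1 := by
          rw [e₁']; simp [slideCost, hx, g₁.ne.symm]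
        rwa [hc] at this
      | succ r h1 ih =>
        intro h2
        have h3 := ih (by omega)
        rcases (hmv r (by omega)).eq_or_adj a with h | h
        · rwa [← h]
        · have := CostReach.update (X := X) (adm r h1 (by omega)) (b := b) (u := f (r + 1) a)
            (by simpa using adm (r + 1) (by omega) h2) (by simpa using h)
          have hc : slideCost X (f r a) (f (r + 1) a) = 0 := slideCost_of_notMem
            (hMX.notMem_of_mem_left (haM _ h1 (by omega)))
            (hMX.notMem_of_mem_left (haM _ (by omega) (by omega)))
          simpa [hc] using h3.trans this
    rw [ha1]
    exact walk t₁ hr₁ le_rfl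
  -- `b` follows `a` until it is next to `x`
  set y : ℕ → V := fun t => f (min t r₃) a with hy
  have follow : ∀ t, t₁ + 1 ≤ t → t < t₃ →
      ∃ n, n + slideCost X (f t b) (f (t + 1) b) = moveCost X (f t) (f (t + 1)) ∧
        CostReach G X M U n (Function.update (f t) b (y t))
          (Function.update (f (t + 1)) b (y (t + 1))) := by
    intro t h1 h2
    have hm := hmv t (by omega)
    rcases lt_or_ge t r₃ with h | h
    · have y1 : y t = f t a := by simp [hy, h.le]
      have y2 : y (t + 1) = f (t + 1) a := by simp [hy, Nat.succ_le_of_lt h]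
      have h3 := hself (t + 1) (by omega) (by omega)
      refine CostReach.replace hM hMX hMU (hA t) (hA _) hm ?_ ?_ ?_ ?_ ?_ ?_
      · rw [y1]; exact haM _ (by omega) (by omega)
      · rw [y2]; exact haM _ (by omega) (by omega)
      · intro i _; rw [y1]; exact hself t (by omega) (by omega) i
      -- If `a` moves in this step then no other token does, so the old position of `a` is still
      -- compatible with the tokens in `X`.
      · intro i hi hiX
        rw [y1]
        rcases eq_or_ne (f t a) (f (t + 1) a) with e | e
        · rw [e]; exact h3 i hiX
        · by_cases hia : i = a
          · exact absurd (hia ▸ hiX) (hMX.notMem_of_mem_left (haM _ (by omega) (by omega)))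
          · have := hm.eq_of_ne (Ne.symm hia) e
            rw [← this] at hiX ⊢
            exact hself t (by omega) (by omega) i hiX
      · intro i _; rw [y2]; exact h3 i
      · rw [y1, y2]; exact hm.eq_or_adj a
    -- From `r₃` on, `b` waits next to `x` on a vertex that `w₃` keeps clear until `t₃`.
    · have y1 : y t = f r₃ a := by simp [hy, h]
      have y2 : y (t + 1) = f r₃ a := by simp [hy, h.trans (Nat.le_succ t)]
      refine CostReach.replace hM hMX hMU (hA t) (hA _) hm ?_ ?_ ?_ ?_ ?_ ?_
      · rw [y1]; exact haM _ (by omega) (by omega)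
      · rw [y2]; exact haM _ (by omega) (by omega)
      · intro i _; rw [y1]; exact w₃ t (by omega) (by omega) i
      · intro i _; rw [y1]; exact w₃ (t + 1) (by omega) (by omega) i
      · intro i _; rw [y2]; exact w₃ (t + 1) (by omega) (by omega) i
      · rw [y1, y2]; exact Or.inl rfl
  have follow' : ∀ t, ∃ n, t₁ + 1 ≤ t → t < t₃ →
      n + slideCost X (f t b) (f (t + 1) b) = moveCost X (f t) (f (t + 1)) ∧
        CostReach G X M U n (Function.update (f t) b (y t))
          (Function.update (f (t + 1)) b (y (t + 1))) := by
    intro t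
    by_cases h : t₁ + 1 ≤ t ∧ t < t₃
    · obtain ⟨n, hn⟩ := follow t h.1 h.2
      exact ⟨n, fun _ _ => hn⟩
    · exact ⟨0, fun h1 h2 => absurd ⟨h1, h2⟩ h⟩
  choose cost hcost using follow'
  have s1 : CostReach G X M U (∑ t ∈ Finset.Ico 0 (t₁ + 1), moveCost X (f t) (f (t + 1)))
      (f 0) (f (t₁ + 1)) :=
    CostReach.of_seq (Nat.zero_le _) fun t _ h => (hmv t (by omega)).costReach
  have s3 : CostReach G X M U (∑ t ∈ Finset.Ico (t₁ + 1) t₃, cost t) _ _ :=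
    CostReach.of_seq (f := fun t => Function.update (f t) b (y t)) (by omega)
      fun t h1 h2 => (hcost t h1 h2).2
  have s5 : CostReach G X M U (∑ t ∈ Finset.Ico (t₃ + 1) N, moveCost X (f t) (f (t + 1)))
      (f (t₃ + 1)) (f N) :=
    CostReach.of_seq (by omega) fun t _ h => (hmv t (by omega)).costReach
  have y1 : y (t₁ + 1) = f (t₁ + 1) a := by simp [hy, Nat.succ_le_of_lt hr₃]
  have y3 : y t₃ = f r₃ a := by simp [hy, hr₃']
  have hne3 : f t₃ b ≠ f (t₃ + 1) b := by rw [e₃']; exact e₃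
  have last : f (t₃ + 1) = Function.update (f t₃) b x := by
    funext i
    by_cases hi : i = b
    · subst hi; simpa using e₃'
    · simpa [hi] using hstay t₃ h3N i hi hne3
  have s4 : CostReach G X M U 1 (Function.update (f t₃) b (y t₃)) (f (t₃ + 1)) := by
    rw [y3]
    have adm : Admissible G M U (Function.update (f t₃) b (f r₃ a)) :=
      (hA t₃).update hM hMU (haM _ (by omega) hr₃') fun i _ => w₃ t₃ hr₃' le_rfl i
    have := CostReach.update (X := X) adm (b := b) (u := x)
      (by simpa [last] using hA (t₃ + 1)) (by simpa using g₃)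
    have hc : slideCost X (f r₃ a) x = 1 := by simp [slideCost, hx, g₃.ne]
    simpa [hc, last] using this
  rw [y1] at s3
  refine ⟨_, (((s1.trans detour).trans s3).trans s4).trans s5, ?_⟩
  have split : ∑ t ∈ Finset.range N, moveCost X (f t) (f (t + 1))
      = ∑ t ∈ Finset.Ico 0 (t₁ + 1), moveCost X (f t) (f (t + 1))
        + ∑ t ∈ Finset.Ico (t₁ + 1) t₃, moveCost X (f t) (f (t + 1))
        + moveCost X (f t₃) (f (t₃ + 1))
        + ∑ t ∈ Finset.Ico (t₃ + 1) N, moveCost X (f t) (f (t + 1)) := by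
    rw [Finset.range_eq_Ico, ← Finset.sum_Ico_consecutive _ (Nat.zero_le (t₁ + 1)) (by omega),
      ← Finset.sum_Ico_consecutive _ (show t₁ + 1 ≤ t₃ + 1 by omega) (by omega),
      Finset.sum_Ico_succ_top (show t₁ + 1 ≤ t₃ by omega)]
    ring
  have c3 : moveCost X (f t₃) (f (t₃ + 1)) = 1 := by
    rw [last, moveCost_update]; simp [slideCost, hx, e₃]
  have c2 : ∑ t ∈ Finset.Ico (t₁ + 1) t₃, moveCost X (f t) (f (t + 1))
      = ∑ t ∈ Finset.Ico (t₁ + 1) t₃, cost t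
        + ∑ t ∈ Finset.Ico (t₁ + 1) t₃, slideCost X (f t b) (f (t + 1) b) := by
    rw [← Finset.sum_add_distrib]
    refine Finset.sum_congr rfl fun t ht => ?_
    rw [Finset.mem_Ico] at ht
    exact (hcost t ht.1 ht.2).1.symm
  -- `b` leaves `x` before it enters `x` for the second time
  obtain ⟨l, hl1, hl2, hlx, hlx'⟩ : ∃ l, t₁ + 1 ≤ l ∧ l < t₂ ∧ f l b = x ∧ f (l + 1) b ≠ x := by
    by_contra! hcon
    have : ∀ t, t₁ + 1 ≤ t → t ≤ t₂ → f t b = x := by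
      intro t ht
      induction t, ht using Nat.le_induction with
      | base => exact fun _ => e₁'
      | succ t ht ih => exact fun h => hcon t ht (by omega) (ih (by omega))
    exact e₂ (this t₂ (by omega) le_rfl)
  -- The old sequence pays for leaving `x` at `l`, for entering at `t₂` and, by `c3`, for entering
  -- at `t₃`. The new one pays once for the detour and once for the last entry.
  have two : 2 ≤ ∑ t ∈ Finset.Ico (t₁ + 1) t₃, slideCost X (f t b) (f (t + 1) b) := by
    have hsub : ({l, t₂} : Finset ℕ) ⊆ Finset.Ico (t₁ + 1) t₃ := by
      intro t ht
      simp only [Finset.mem_insert, Finset.mem_singleton] at ht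
      rw [Finset.mem_Ico]
      omega
    refine le_trans ?_ (Finset.sum_le_sum_of_subset hsub)
    rw [Finset.sum_pair (by omega)]
    have k1 : slideCost X (f l b) (f (l + 1) b) = 1 := by
      rw [hlx]; simp [slideCost, hx, Ne.symm hlx']
    have k2 : slideCost X (f t₂ b) (f (t₂ + 1) b) = 1 := by
      rw [e₂']; simp [slideCost, hx, e₂]
    omega
  omega

end Mimic

/-! ### Walks with restricted traces -/

section Runs

variable {V : Type*} {G : SimpleGraph V} {X : Set V}

/-- The vertices outside `X` all of whose neighbours in `X` belong to `B`. -/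
def allowed (G : SimpleGraph V) (X B : Set V) : Set V :=
  {w | w ∉ X ∧ ∀ x ∈ X, G.Adj w x → x ∈ B}

/-- `v` is reachable from `u` by a walk in `allowed G X B`. -/
def Step (G : SimpleGraph V) (X B : Set V) (u v : V) : Prop :=
  u ∈ allowed G X B ∧
    Relation.ReflTransGen (fun w w' => G.Adj w w' ∧ w' ∈ allowed G X B) u v

/-- `v` is reachable from `u` by a walk whose consecutive pieces obey the given restrictions. -/
def Run (G : SimpleGraph V) (X : Set V) : List (Set V) → V → V → Prop
  | [], u, v => u = v
  | B :: Bs, u, v => ∃ w, Step G X B u w ∧ Run G X Bs w v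

theorem allowed_mono {B B' : Set V} (h : ∀ x ∈ X, x ∈ B → x ∈ B') :
    allowed G X B ⊆ allowed G X B' :=
  fun _ hw => ⟨hw.1, fun x hx hxw => h x hx (hw.2 x hx hxw)⟩

theorem Step.mono {B B' : Set V} (h : ∀ x ∈ X, x ∈ B → x ∈ B') {u v : V} (hs : Step G X B u v) :
    Step G X B' u v :=
  ⟨allowed_mono h hs.1, Relation.ReflTransGen.mono (fun _ _ hw => ⟨hw.1, allowed_mono h hw.2⟩) _ _ hs.2⟩

theorem Step.refl {B : Set V} {u : V} (h : u ∈ allowed G X B) : Step G X B u u :=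
  ⟨h, .refl⟩

theorem Step.trans {B : Set V} {u v w : V} (h : Step G X B u v) (h' : Step G X B v w) :
    Step G X B u w :=
  ⟨h.1, h.2.trans h'.2⟩

theorem Step.right_mem {B : Set V} {u v : V} (h : Step G X B u v) : v ∈ allowed G X B := by
  obtain ⟨h1, h2⟩ := h
  cases h2 with
  | refl => exact h1
  | tail _ h => exact h.2

theorem Step.tail {B : Set V} {u v w : V} (h : Step G X B u v) (hvw : v = w ∨ G.Adj v w)
    (hw : w ∈ allowed G X B) : Step G X B u w := by
  rcases hvw with rfl | hvw
  · exact h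
  · exact ⟨h.1, h.2.tail ⟨hvw, hw⟩⟩

/-- Repetitions of a restriction collapse, so a profile may be padded to a prescribed length. -/
theorem run_replicate {B : Set V} {u v : V} {n : ℕ} (h : Run G X (List.replicate (n + 1) B) u v) :
    Step G X B u v := by
  induction n generalizing u with
  | zero => obtain ⟨w, h1, rfl⟩ := h; exact h1
  | succ n ih => obtain ⟨w, h1, h2⟩ := h; exact h1.trans (ih h2)

theorem Step.run_replicate {B : Set V} {u v : V} (n : ℕ) (h : Step G X B u v) :
    Run G X (List.replicate (n + 1) B) u v := by
  induction n generalizing u with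
  | zero => exact ⟨v, h, rfl⟩
  | succ n ih => exact ⟨v, h, ih (Step.refl h.right_mem)⟩

theorem run_append_singleton {Bs : List (Set V)} {B : Set V} {u v : V} :
    Run G X (Bs ++ [B]) u v ↔ ∃ w, Run G X Bs u w ∧ Step G X B w v := by
  induction Bs generalizing u with
  | nil => simp [Run]
  | cons C Bs ih =>
    simp only [List.cons_append, Run, ih]
    exact ⟨fun ⟨w, h, w', h', h''⟩ => ⟨w', ⟨w, h, h'⟩, h''⟩,
      fun ⟨w', ⟨w, h, h'⟩, h''⟩ => ⟨w, h, w', h', h''⟩⟩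

end Runs

/-! ### Cutting a visit into phases and extracting its profile -/

section Visits

variable {V : Type*} {ι : Type*} {G : SimpleGraph V} {X M U : Set V}

/-- The vertices of `X` that carry a token. -/
def occupied (X : Set V) (c : ι → V) : Set V :=
  {x | x ∈ X ∧ ∃ i, c i = x}

/-- A token on `v` at time `t` can move outside `X`, compatibly with the tokens that `f` has in `X`,
so as to leave for `X` in the same way as token `a`. -/
inductive Shadow (G : SimpleGraph V) (X M : Set V) (f : ℕ → ι → V) (a : ι) : ℕ → V → Prop
  | exit {t : ℕ} {v v' : V} : f (t + 1) a ∈ X → Step G X (occupied X (f t))ᶜ v v' →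
      G.Adj v' (f (t + 1) a) → Shadow G X M f a t v
  | wait {t : ℕ} {v v' : V} : f (t + 1) a ∈ M → Step G X (occupied X (f t))ᶜ v v' →
      Shadow G X M f a (t + 1) v' → Shadow G X M f a t v

/-- In the time interval `[p, q)`, no token in `X` is next to a vertex visited earlier in the
interval by `a`. -/
def Clear (G : SimpleGraph V) (X : Set V) (f : ℕ → ι → V) (a : ι) (p q : ℕ) : Prop :=
  ∀ t, p ≤ t → t < q → ∀ r, p ≤ r → r ≤ t → ∀ i, f t i ∈ X → ¬ G.Adj (f r a) (f t i)

/-- At time `q`, another token enters a neighbour in `X` of a vertex visited by `a` in `[p, q)`. -/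
def Forced (G : SimpleGraph V) (X : Set V) (f : ℕ → ι → V) (a : ι) (p q : ℕ) (x : V) (b : ι) :
    Prop :=
  x ∈ X ∧ a ≠ b ∧ ∃ r, p ≤ r ∧ r < q ∧ G.Adj (f r a) x ∧ f (q - 1) b ≠ x ∧ f q b = x

theorem Admissible.not_adj {c : ι → V} (h : Admissible G M U c) (hMX : Disjoint M X) {a i : ι}
    (ha : c a ∈ M) (hi : c i ∈ X) : ¬ G.Adj (c a) (c i) := by
  by_cases hia : a = i
  · exact absurd (hia ▸ hi) (hMX.notMem_of_mem_left ha)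
  · rcases h.2 a i hia with h | h
    · exact absurd hi (hMX.notMem_of_mem_left h.2)
    · exact h.2

/-- Waiting on a vertex whose neighbours in `X` stay free. -/
theorem Shadow.of_wait {f : ℕ → ι → V} {a : ι} {p q : ℕ} {v : V} (hpq : p ≤ q)
    (haM : ∀ t, p ≤ t → t ≤ q → f t a ∈ M)
    (hv : ∀ t, p ≤ t → t ≤ q → v ∈ allowed G X (occupied X (f t))ᶜ)
    (h : Shadow G X M f a q v) : Shadow G X M f a p v := by
  induction q, hpq using Nat.le_induction with
  | base => exact h
  | succ q hpq ih =>
    exact ih (fun t h1 h2 => haM t h1 (by omega)) (fun t h1 h2 => hv t h1 (by omega))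
      (Shadow.wait (haM _ (by omega) le_rfl) (Step.refl (hv q hpq (by omega))) h)

/-- Greedy cutting: the current phase is extended while it stays clear, and the first time that
violates clearness starts the next phase. -/
theorem exists_breakpoints {f : ℕ → ι → V} (hMX : Disjoint M X)
    (hA : ∀ t, Admissible G M U (f t)) {a : ι} {s e : ℕ} (hse : s ≤ e) (haM : ∀ t, s ≤ t → t ≤ e → f t a ∈ M) :
    ∃ (m : ℕ) (τ : ℕ → ℕ), τ 0 = s ∧ (∀ i < m, τ i < τ (i + 1) ∧ Clear G X f a (τ i) (τ (i + 1)) ∧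
      ∃ x b, Forced G X f a (τ i) (τ (i + 1)) x b) ∧ τ m ≤ e ∧
      Clear G X f a (τ m) (e + 1) := by
  induction e, hse using Nat.le_induction with
  | base =>
    refine ⟨0, fun _ => s, rfl, by simp, le_rfl, ?_⟩
    intro t h1 h2 r h3 h4 i hi
    beta_reduce at h1 h3
    obtain rfl : t = s := by omega
    obtain rfl : r = t := by omega
    exact (hA _).not_adj hMX (haM _ le_rfl le_rfl) hi
  | succ e hse ih =>
    obtain ⟨m, τ, h0, hτ, hm, hC⟩ := ih fun t h1 h2 => haM t h1 (by omega)
    by_cases hC' : Clear G X f a (τ m) (e + 1 + 1)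
    · exact ⟨m, τ, h0, hτ, by omega, hC'⟩
    · have key : ∃ x b, Forced G X f a (τ m) (e + 1) x b := by
        unfold Clear at hC'
        push Not at hC'
        obtain ⟨t, h1, h2, r, h3, h4, b, hb, hadj⟩ := hC'
        have ht : t = e + 1 := by
          by_contra hne
          exact hC t h1 (by omega) r h3 h4 b hb hadj
        subst ht
        have hr : r ≠ e + 1 := by
          rintro rfl
          exact (hA _).not_adj hMX (haM _ (by omega) le_rfl) hb hadj
        refine ⟨f (e + 1) b, b, hb, ?_, r, h3, by omega, hadj, ?_, rfl⟩
        · rintro rfl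
          exact hMX.notMem_of_mem_left (haM _ (by omega) le_rfl) hb
        -- Had `b` been on that vertex at time `e` already, the phase would have failed to be clear
        -- then.
        · intro heq
          simp only [Nat.add_sub_cancel] at heq
          exact hC e (by omega) (by omega) r h3 (by omega) b (heq ▸ hb) (heq ▸ hadj)
      refine ⟨m + 1, Function.update τ (m + 1) (e + 1), by simp [h0], ?_, by simp, ?_⟩
      · intro i hi
        rcases Nat.lt_succ_iff_lt_or_eq.1 hi with h | rfl
        · rw [Function.update_of_ne (by omega), Function.update_of_ne (by omega)]
          exact hτ i h
        · rw [Function.update_of_ne (by omega), Function.update_self]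
          exact ⟨by omega, hC, key⟩
      · rw [Function.update_self]
        intro t h1 h2 r h3 h4 i hi
        obtain rfl : t = e + 1 := by omega
        obtain rfl : r = e + 1 := by omega
        exact (hA _).not_adj hMX (haM _ (by omega) le_rfl) hi

variable [DecidableEq ι]

/-- Every cut is caused by a pair of a vertex of `X` and a token. In a cheapest sequence no pair can
cause three cuts of one visit. -/
theorem breakpoints_le [Fintype ι] [Finite V] {f : ℕ → ι → V} {N : ℕ}
    (hM : ∀ u ∈ M, ∀ v, G.Adj u v → v ∈ M ∨ v ∈ X) (hMX : Disjoint M X) (hMU : Disjoint M U)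
    (hA : ∀ t, Admissible G M U (f t)) (hmv : ∀ t < N, Move G M U (f t) (f (t + 1)))
    (hmin : ∀ n, CostReach G X M U n (f 0) (f N) →
      ∑ t ∈ Finset.range N, moveCost X (f t) (f (t + 1)) ≤ n)
    {a : ι} {e m : ℕ} {τ : ℕ → ℕ} (heN : e < N) (haM : ∀ t, τ 0 ≤ t → t ≤ e → f t a ∈ M)
    (hτ : ∀ i < m, τ i < τ (i + 1) ∧ Clear G X f a (τ i) (τ (i + 1)) ∧
      ∃ x b, Forced G X f a (τ i) (τ (i + 1)) x b) (hm : τ m ≤ e) :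
    m ≤ 2 * (X.ncard * Fintype.card ι) := by
  classical
  have hmono : ∀ i j, i ≤ j → j ≤ m → τ i ≤ τ j := by
    intro i j hij
    induction j, hij using Nat.le_induction with
    | base => exact fun _ => le_rfl
    | succ j _ ih => exact fun h => (ih (by omega)).trans (hτ j (by omega)).1.le
  by_contra! hlt
  have hex : ∀ i : Fin m, ∃ p : X × ι, Forced G X f a (τ i) (τ (i + 1)) p.1 p.2 := fun i => by
    obtain ⟨x, b, h⟩ := (hτ i i.2).2.2
    exact ⟨(⟨x, h.1⟩, b), h⟩
  choose g hg using hex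
  have : Fintype X := Fintype.ofFinite X
  -- Pigeonhole: more than twice as many cuts as pairs force a pair with three cuts.
  obtain ⟨y, -, hy⟩ := Finset.exists_lt_card_fiber_of_mul_lt_card_of_maps_to
    (s := Finset.univ) (t := Finset.univ) (f := g) (n := 2) (fun _ _ => Finset.mem_univ _) (by
      rw [Finset.card_univ, Finset.card_univ, Fintype.card_prod, Fintype.card_fin,
        ← Nat.card_eq_fintype_card (α := X), Nat.card_coe_set_eq]
      linarith)
  set F := Finset.univ.filter fun i => g i = y
  obtain ⟨F', hF', hF3⟩ := Finset.exists_subset_card_eq (show 3 ≤ F.card from hy)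
  have hmem : ∀ j, Forced G X f a (τ (F'.orderEmbOfFin hF3 j : Fin m))
      (τ ((F'.orderEmbOfFin hF3 j : Fin m) + 1)) y.1 y.2 := by
    intro j
    have h1 := hF' (F'.orderEmbOfFin_mem hF3 j)
    have h2 := hg (F'.orderEmbOfFin hF3 j)
    rwa [(Finset.mem_filter.1 h1).2] at h2
  have h01 : ((F'.orderEmbOfFin hF3 0 : Fin m) : ℕ) < (F'.orderEmbOfFin hF3 1 : Fin m) :=
    (F'.orderEmbOfFin hF3).strictMono (by decide)
  have h12 : ((F'.orderEmbOfFin hF3 1 : Fin m) : ℕ) < (F'.orderEmbOfFin hF3 2 : Fin m) :=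
    (F'.orderEmbOfFin hF3).strictMono (by decide)
  have h2m : ((F'.orderEmbOfFin hF3 2 : Fin m) : ℕ) < m := Fin.is_lt _
  obtain ⟨hx, hab, r₁, hp₁, hq₁, hadj₁, hn₁, hb₁⟩ := hmem 0
  obtain ⟨-, -, r₂, hp₂, hq₂, hadj₂, hn₂, hb₂⟩ := hmem 1
  obtain ⟨-, -, r₃, hp₃, hq₃, hadj₃, hn₃, hb₃⟩ := hmem 2
  generalize ((F'.orderEmbOfFin hF3 0 : Fin m) : ℕ) = i₁ at *
  generalize ((F'.orderEmbOfFin hF3 1 : Fin m) : ℕ) = i₂ at *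
  generalize ((F'.orderEmbOfFin hF3 2 : Fin m) : ℕ) = i₃ at *
  have m1 := hmono (i₁ + 1) i₂ (by omega) (by omega)
  have m2 := hmono (i₂ + 1) i₃ (by omega) (by omega)
  have m3 := hmono (i₃ + 1) m (by omega) le_rfl
  have m0 := hmono 0 i₁ (by omega) (by omega)
  have l1 := (hτ i₁ (by omega)).1
  have l2 := (hτ i₂ (by omega)).1
  have l3 := (hτ i₃ (by omega)).1
  -- The token completes its entry at the cut `τ (i + 1)`, so the entering slide is the step that
  -- starts one time unit earlier.
  obtain ⟨n, hn, hlt⟩ := exists_cheaper_of_three_entries (N := N) (t₁ := τ (i₁ + 1) - 1)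
    (t₂ := τ (i₂ + 1) - 1) (t₃ := τ (i₃ + 1) - 1) (r₁ := r₁) (r₃ := r₃) hM hMX hMU hA hmv hab
    (by omega) (by omega) (by omega) (by omega) (by omega) (by omega)
    (fun t h1 h2 => haM t (by omega) (by omega)) hx hn₁
    (by rwa [Nat.sub_add_cancel (by omega)]) hn₂ (by rwa [Nat.sub_add_cancel (by omega)]) hn₃
    (by rwa [Nat.sub_add_cancel (by omega)]) hadj₁ hadj₃
    (fun r h1 h2 => (hτ i₁ (by omega)).2.1 _ (by omega) (by omega) r (by omega) h2)
    (fun t h1 h2 => (hτ i₃ (by omega)).2.1 t (by omega) (by omega) r₃ (by omega) h1)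
  exact absurd (hmin n hn) (by omega)

/-- Each phase contributes the trace of its first vertex, on which a substitute can wait, and the
trace of its walk, carried out in one go at the end. The induction runs backwards over the last `j`
cuts; `d` counts the padding entries. -/
theorem exists_profile_of_breakpoints {f : ℕ → ι → V} {N : ℕ} (hMX : Disjoint M X)
    (hmv : ∀ t < N, Move G M U (f t) (f (t + 1)))
    {a : ι} {e m : ℕ} {τ : ℕ → ℕ} (heN : e < N) (haM : ∀ t, τ 0 ≤ t → t ≤ e → f t a ∈ M)
    (hexit : f (e + 1) a ∈ X)
    (hτ : ∀ i < m, τ i < τ (i + 1) ∧ Clear G X f a (τ i) (τ (i + 1)) ∧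
      ∃ x b, Forced G X f a (τ i) (τ (i + 1)) x b) (h0m : ∀ i ≤ m, τ 0 ≤ τ i) (hm : τ m ≤ e)
    (hC : Clear G X f a (τ m) (e + 1)) (d j : ℕ) (hj : j ≤ m) :
    ∃ Bs : List (Set V), Bs.length = 2 * j + 2 + d ∧ Run G X Bs (f (τ (m - j)) a) (f e a) ∧
      ∀ v v', Run G X Bs v v' → G.Adj v' (f (e + 1) a) → Shadow G X M f a (τ (m - j)) v := by
  set W : ℕ → Set V := fun p => {x | G.Adj (f p a) x} with hW
  set Y : ℕ → ℕ → Set V := fun p q => {x | ∃ r, p ≤ r ∧ r < q ∧ G.Adj (f r a) x} with hY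
  have hmono : ∀ i j, i ≤ j → j ≤ m → τ i ≤ τ j := by
    intro i j hij
    induction j, hij using Nat.le_induction with
    | base => exact fun _ => le_rfl
    | succ j _ ih => exact fun h => (ih (by omega)).trans (hτ j (by omega)).1.le
  have own : ∀ p q, τ 0 ≤ p → p < q → q ≤ e + 1 → ∀ r, p ≤ r → r < q →
      Step G X (Y p q) (f p a) (f r a) := by
    intro p q h0 hpq hq r hr
    have hal : ∀ r, p ≤ r → r < q → f r a ∈ allowed G X (Y p q) := fun r h1 h2 =>
      ⟨hMX.notMem_of_mem_left (haM r (by omega) (by omega)), fun x _ hx => ⟨r, h1, h2, hx⟩⟩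
    induction r, hr using Nat.le_induction with
    | base => exact fun h => Step.refl (hal p le_rfl h)
    | succ r hr ih =>
      exact fun h => (ih (by omega)).tail ((hmv r (by omega)).eq_or_adj a) (hal _ (by omega) h)
  have ownW : ∀ p, τ 0 ≤ p → p ≤ e → Step G X (W p) (f p a) (f p a) := fun p h0 hp =>
    Step.refl ⟨hMX.notMem_of_mem_left (haM p h0 hp), fun x _ hx => hx⟩
  have freeW : ∀ p q, Clear G X f a p q → ∀ t, p ≤ t → t < q → ∀ x ∈ X,
      x ∈ W p → x ∈ (occupied X (f t))ᶜ := by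
    rintro p q hc t h1 h2 x hx hxW ⟨-, i, rfl⟩
    exact hc t h1 h2 p le_rfl h1 i hx hxW
  -- The trace of the whole walk is free at time `q - 1`, but need not be at earlier times of the
  -- phase; hence all walking is postponed until then.
  have freeY : ∀ p q, p < q → Clear G X f a p q → ∀ x ∈ X,
      x ∈ Y p q → x ∈ (occupied X (f (q - 1)))ᶜ := by
    rintro p q hpq hc x hx ⟨r, hr1, hr2, hxW⟩ ⟨-, i, rfl⟩
    exact hc (q - 1) (by omega) (by omega) r hr1 (by omega) i hx hxW
  induction j with
  -- The last phase ends with the exit into `X`; its walking restriction is repeated `d` more times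
  -- as padding.
  | zero =>
    refine ⟨W (τ m) :: List.replicate (d + 1) (Y (τ m) (e + 1)), by simp; omega, ?_, ?_⟩
    · have := h0m m le_rfl
      exact ⟨_, ownW _ (by simpa using this) (by simpa using hm),
        Step.run_replicate d (own _ _ this (by omega) le_rfl e (by simpa using hm) (by omega))⟩
    · rintro v v' ⟨w, h1, h2⟩ hadj
      have h3 := run_replicate h2
      have k0 := h0m m le_rfl
      simp only [Nat.sub_zero]
      refine Shadow.of_wait (q := e) hm (fun t h1 h2 => haM t (by omega) h2)
        (fun t g1 g2 => ?_) ?_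
      · exact allowed_mono (freeW _ _ hC t g1 (by omega)) h1.1
      · refine Shadow.exit hexit (Step.trans (h1.mono (freeW _ _ hC e hm (by omega))) ?_) hadj
        exact h3.mono (freeY _ _ (by omega) hC)
  | succ j ih =>
    obtain ⟨Bs, hlen, hrun, hsh⟩ := ih (by omega)
    obtain ⟨hlt, hCl, x, b, hF⟩ := hτ (m - (j + 1)) (by omega)
    have hsucc : m - (j + 1) + 1 = m - j := by omega
    rw [hsucc] at hlt hCl hF
    have k0 := h0m (m - (j + 1)) (by omega)
    have k1 := hmono (m - j) m (by omega) le_rfl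
    generalize τ (m - (j + 1)) = p at *
    generalize τ (m - j) = q at *
    obtain ⟨-, hab, r, -, -, -, hb1, hb2⟩ := hF
    -- The slide into time `q` belongs to `b`, so `a` rests. Therefore the walk of this phase, which
    -- ends at time `q - 1`, ends on the first vertex of the next phase.
    have hstay : f (q - 1) a = f q a := by
      have hmq := hmv (q - 1) (by omega)
      rw [Nat.sub_add_cancel (by omega)] at hmq
      exact hmq.eq_of_ne hab.symm (by rw [hb2]; exact hb1)
    refine ⟨W p :: Y p q :: Bs, by simp; omega, ?_, ?_⟩
    · refine ⟨_, ownW p k0 (by omega), _, own p q k0 hlt (by omega) (q - 1) (by omega) (by omega),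
        ?_⟩
      rw [hstay]; exact hrun
    · rintro v v' ⟨w, h1, w', h2, h3⟩ hadj
      have h4 := hsh w' v' h3 hadj
      refine Shadow.of_wait (q := q - 1) (by omega) (fun t h1 h2 => haM t (by omega) (by omega))
        (fun t g1 g2 => ?_) ?_
      · exact allowed_mono (freeW _ _ hCl t g1 (by omega)) h1.1
      · refine Shadow.wait (v' := w') ?_ ?_ ?_
        · rw [Nat.sub_add_cancel (by omega)]; exact haM q (by omega) (by omega)
        · exact (h1.mono (freeW _ _ hCl (q - 1) (by omega) (by omega))).trans
            (h2.mono (freeY _ _ hlt hCl))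
        · rw [Nat.sub_add_cancel (by omega)]; exact h4

/-- In a cheapest sequence, a visit to `M` is described by a bounded number of restrictions on the
trace, and every other walk that obeys these restrictions can replace the visit. -/
theorem exists_profile [Fintype ι] [Finite V] {f : ℕ → ι → V} {N : ℕ}
    (hM : ∀ u ∈ M, ∀ v, G.Adj u v → v ∈ M ∨ v ∈ X) (hMX : Disjoint M X) (hMU : Disjoint M U)
    (hA : ∀ t, Admissible G M U (f t)) (hmv : ∀ t < N, Move G M U (f t) (f (t + 1)))
    (hmin : ∀ n, CostReach G X M U n (f 0) (f N) →
      ∑ t ∈ Finset.range N, moveCost X (f t) (f (t + 1)) ≤ n)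
    {a : ι} {s L : ℕ} (hsN : s ≤ N) (hs : f s a ∈ M) (hN : f N a ∉ M)
    (hL : 4 * (X.ncard * Fintype.card ι) + 2 ≤ L) :
    ∃ (Bs : List (Set V)) (z : V), Bs.length = L ∧ z ∈ X ∧
      (∃ v', Run G X Bs (f s a) v' ∧ G.Adj v' z) ∧
      ∀ v v', Run G X Bs v v' → G.Adj v' z → Shadow G X M f a s v := by
  classical
  have hex : ∃ q, s ≤ q ∧ f q a ∉ M := ⟨N, hsN, hN⟩
  obtain ⟨e, he⟩ : ∃ e, Nat.find hex = e + 1 := by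
    refine Nat.exists_eq_succ_of_ne_zero fun h => ?_
    have := Nat.find_spec hex
    rw [h] at this
    exact this.2 (Nat.le_zero.1 this.1 ▸ hs)
  obtain ⟨h1, h2⟩ := Nat.find_spec hex
  have heN : e < N := by
    have := Nat.find_min' hex ⟨hsN, hN⟩
    omega
  have haM : ∀ t, s ≤ t → t ≤ e → f t a ∈ M := by
    intro t h3 h4
    by_contra h5
    exact Nat.find_min hex (m := t) (by omega) ⟨h3, h5⟩
  rw [he] at h1 h2
  have hse : s ≤ e := by
    rcases Nat.lt_or_ge e s with h | h
    · obtain rfl : s = e + 1 := by omega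
      exact absurd hs h2
    · exact h
  have hadj : G.Adj (f e a) (f (e + 1) a) := by
    rcases (hmv e heN).eq_or_adj a with h | h
    · exact absurd (h ▸ haM e hse le_rfl) h2
    · exact h
  have hexit : f (e + 1) a ∈ X := (hM _ (haM e hse le_rfl) _ hadj).resolve_left h2
  obtain ⟨m, τ, h0, hτ, hm, hC⟩ := exists_breakpoints hMX hA hse haM
  subst h0
  have hbound := breakpoints_le hM hMX hMU hA hmv hmin heN haM hτ hm
  have h0m : ∀ i ≤ m, τ 0 ≤ τ i := by
    intro i
    induction i with
    | zero => exact fun _ => le_rfl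
    | succ i ih => exact fun h => (ih (by omega)).trans (hτ i (by omega)).1.le
  -- With `m` cuts the profile has `2 * m + 2` entries, at most `L` by the bound on `m`; the
  -- difference is padded.
  obtain ⟨Bs, hlen, hrun, hsh⟩ := exists_profile_of_breakpoints hMX hmv heN haM hexit hτ h0m hm hC
    (L - (2 * m + 2)) m le_rfl
  rw [Nat.sub_self] at hrun hsh
  exact ⟨Bs, _, by rw [hlen]; omega, hexit, ⟨_, hrun, hadj⟩, hsh⟩

end Visits

/-! ### Components of G - X as vertex sets of G -/

section Components

variable {V : Type*} {G : SimpleGraph V} {X : Set V}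

theorem Comp.notMem_of_mem_verts {C : Comp G X} {v : V} (h : v ∈ C.verts) : v ∉ X := by
  obtain ⟨w, -, rfl⟩ := h
  exact w.2

theorem Comp.mem_verts_iff {C : Comp G X} {v : V} (hv : v ∉ X) :
    v ∈ C.verts ↔ (G.induce Xᶜ).connectedComponentMk ⟨v, hv⟩ = C := by
  constructor
  · rintro ⟨w, hw, rfl⟩
    exact hw
  · intro h
    exact ⟨⟨v, hv⟩, h, rfl⟩

theorem Comp.eq_of_mem {C D : Comp G X} {v : V} (hC : v ∈ C.verts) (hD : v ∈ D.verts) : C = D := by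
  have hv := Comp.notMem_of_mem_verts hC
  rw [Comp.mem_verts_iff hv] at hC hD
  exact hC.symm.trans hD

theorem Comp.mem_of_adj {C : Comp G X} {u v : V} (hu : u ∈ C.verts) (h : G.Adj u v) (hv : v ∉ X) :
    v ∈ C.verts := by
  have hu' := Comp.notMem_of_mem_verts hu
  rw [Comp.mem_verts_iff hu'] at hu
  rw [Comp.mem_verts_iff hv, ← hu]
  refine SimpleGraph.ConnectedComponent.sound (SimpleGraph.Adj.reachable ?_)
  simpa using h.symm

theorem Comp.verts_nonempty (C : Comp G X) : C.verts.Nonempty := by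
  obtain ⟨v, hv⟩ := C.exists_rep
  exact ⟨v, v, hv, rfl⟩

theorem Comp.mem_of_reflTransGen {C : Comp G X} {B : Set V} {u v : V} (hu : u ∈ C.verts)
    (h : Relation.ReflTransGen (fun w w' => G.Adj w w' ∧ w' ∈ allowed G X B) u v) :
    v ∈ C.verts := by
  induction h with
  | refl => exact hu
  | tail _ h ih => exact Comp.mem_of_adj ih h.1 h.2.1

theorem Comp.mem_of_step {C : Comp G X} {B : Set V} {u v : V} (hu : u ∈ C.verts)
    (h : Step G X B u v) : v ∈ C.verts :=
  Comp.mem_of_reflTransGen hu h.2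

end Components

/-! ### Moving every visit into a private component other than C -/

section Rerouting

variable {V : Type*} {ι : Type*} {G : SimpleGraph V} {X U : Set V}

/-- The union of the vertex sets of a collection of components. -/
def unionVerts (𝓕 : Set (Comp G X)) : Set V :=
  {v | ∃ C ∈ 𝓕, v ∈ C.verts}

theorem unionVerts_adj (𝓕 : Set (Comp G X)) :
    ∀ u ∈ unionVerts 𝓕, ∀ v, G.Adj u v → v ∈ unionVerts 𝓕 ∨ v ∈ X := by
  rintro u ⟨C, hC, hu⟩ v h
  by_cases hv : v ∈ X
  · exact Or.inr hv
  · exact Or.inl ⟨C, hC, Comp.mem_of_adj hu h hv⟩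

theorem disjoint_unionVerts (𝓕 : Set (Comp G X)) : Disjoint (unionVerts 𝓕) X :=
  Set.disjoint_left.2 fun _ ⟨_, _, h⟩ => Comp.notMem_of_mem_verts h

/-- `c` agrees with `g` outside the components in `𝓕`, and its other tokens are in private
components from `𝓕` other than `C`. -/
structure Rerouted (𝓕 : Set (Comp G X)) (C : Comp G X) (g c : ι → V) (δ : ι → Comp G X) :
    Prop where
  eq_of_notMem : ∀ i, g i ∉ unionVerts 𝓕 → c i = g i
  mem : ∀ i, g i ∈ unionVerts 𝓕 → δ i ∈ 𝓕
  ne : ∀ i, g i ∈ unionVerts 𝓕 → δ i ≠ C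
  mem_verts : ∀ i, g i ∈ unionVerts 𝓕 → c i ∈ (δ i).verts
  allowed : ∀ i, g i ∈ unionVerts 𝓕 → c i ∈ allowed G X (occupied X g)ᶜ
  injOn : ∀ i j, i ≠ j → g i ∈ unionVerts 𝓕 → g j ∈ unionVerts 𝓕 → δ i ≠ δ j

variable {𝓕 : Set (Comp G X)} {C : Comp G X}

/-- Tokens in different components are neither equal nor adjacent. A sheltered token could only
touch an outside token on a vertex of `X`, but its neighbours in `X` are unoccupied. So the strict
rules hold although `g` obeys only the relaxed ones. -/
theorem Rerouted.admissible {g c : ι → V} {δ : ι → Comp G X} (h : Rerouted 𝓕 C g c δ) (hC : C ∈ 𝓕)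
    (hU : Disjoint (unionVerts 𝓕) U) (hg : Admissible G (unionVerts 𝓕) U g) :
    Admissible G ∅ (U ∪ C.verts) c := by
  have hmem : ∀ i, g i ∈ unionVerts 𝓕 → c i ∈ unionVerts 𝓕 := fun i hi =>
    ⟨δ i, h.mem i hi, h.mem_verts i hi⟩
  have mixed : ∀ i j, g i ∈ unionVerts 𝓕 → g j ∉ unionVerts 𝓕 → c i ≠ c j ∧ ¬ G.Adj (c i) (c j) := by
    intro i j hi hj
    rw [h.eq_of_notMem j hj]
    refine ⟨fun he => hj (he ▸ hmem i hi), fun ha => ?_⟩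
    have hX := (unionVerts_adj 𝓕 _ (hmem i hi) _ ha).resolve_left hj
    exact (h.allowed i hi).2 _ hX ha ⟨hX, j, rfl⟩
  refine ⟨fun i => ?_, fun i j hij => Or.inr ?_⟩
  · by_cases hi : g i ∈ unionVerts 𝓕
    · rintro (hu | hu)
      · exact hU.notMem_of_mem_left (hmem i hi) hu
      · exact h.ne i hi (Comp.eq_of_mem (h.mem_verts i hi) hu)
    · rw [h.eq_of_notMem i hi]
      rintro (hu | hu)
      · exact hg.1 i hu
      · exact hi ⟨C, hC, hu⟩
  · by_cases hi : g i ∈ unionVerts 𝓕 <;> by_cases hj : g j ∈ unionVerts 𝓕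
    · have hne := h.injOn i j hij hi hj
      have ci := h.mem_verts i hi
      have cj := h.mem_verts j hj
      refine ⟨fun he => hne (Comp.eq_of_mem ci (he ▸ cj)), fun ha => hne ?_⟩
      exact Comp.eq_of_mem (Comp.mem_of_adj ci ha (Comp.notMem_of_mem_verts cj)) cj
    · exact mixed i j hi hj
    · have := mixed j i hj hi
      exact ⟨this.1.symm, fun ha => this.2 ha.symm⟩
    · rw [h.eq_of_notMem i hi, h.eq_of_notMem j hj]
      rcases hg.2 i j hij with h' | h'
      · exact absurd h'.1 hi
      · exact h'

variable [DecidableEq ι]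

theorem Rerouted.update {g c : ι → V} {δ : ι → Comp G X} (h : Rerouted 𝓕 C g c δ) {i : ι} {v : V}
    (hi : g i ∈ unionVerts 𝓕) (hv : v ∈ (δ i).verts)
    (hv' : v ∈ TokenSliding.allowed G X (occupied X g)ᶜ) :
    Rerouted 𝓕 C g (Function.update c i v) δ where
  eq_of_notMem j hj := by
    have : j ≠ i := fun e => hj (e ▸ hi)
    rw [Function.update_of_ne this]; exact h.eq_of_notMem j hj
  mem := h.mem
  ne := h.ne
  mem_verts j hj := by
    rcases eq_or_ne j i with rfl | hji
    · simpa using hv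
    · rw [Function.update_of_ne hji]; exact h.mem_verts j hj
  allowed j hj := by
    rcases eq_or_ne j i with rfl | hji
    · simpa using hv'
    · rw [Function.update_of_ne hji]; exact h.allowed j hj
  injOn := h.injOn

theorem Rerouted.reach_update {g c : ι → V} {δ : ι → Comp G X} (h : Rerouted 𝓕 C g c δ)
    (hC : C ∈ 𝓕) (hU : Disjoint (unionVerts 𝓕) U) (hg : Admissible G (unionVerts 𝓕) U g) {i : ι}
    {v : V} (hi : g i ∈ unionVerts 𝓕) (hv : Step G X (occupied X g)ᶜ (c i) v) :
    Rerouted 𝓕 C g (Function.update c i v) δ ∧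
      Relation.ReflTransGen (Move G ∅ (U ∪ C.verts)) c (Function.update c i v) := by
  obtain ⟨h0, h1⟩ := hv
  induction h1 with
  | refl => simpa using ⟨h, Relation.ReflTransGen.refl⟩
  | @tail w w' hw hww ih =>
    have hmem := Comp.mem_of_adj (Comp.mem_of_reflTransGen (h.mem_verts i hi) hw) hww.1 hww.2.1
    have hR := h.update hi hmem hww.2
    refine ⟨hR, ih.2.tail ⟨ih.1.admissible hC hU hg, hR.admissible hC hU hg, i, w', ?_, ?_⟩⟩
    · simpa using hww.1
    · simp

variable [Fintype ι]

/-- Private components make the sheltered tokens independent of each other, so they can be moved to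
their targets one after the other. -/
theorem Rerouted.reach {g c c' : ι → V} {δ : ι → Comp G X} (h : Rerouted 𝓕 C g c δ)
    (hC : C ∈ 𝓕) (hU : Disjoint (unionVerts 𝓕) U) (hg : Admissible G (unionVerts 𝓕) U g)
    (h1 : ∀ i, g i ∈ unionVerts 𝓕 → Step G X (occupied X g)ᶜ (c i) (c' i))
    (h2 : ∀ i, g i ∉ unionVerts 𝓕 → c' i = c i) :
    Rerouted 𝓕 C g c' δ ∧ Relation.ReflTransGen (Move G ∅ (U ∪ C.verts)) c c' := by
  have key : ∀ S : Finset ι, Rerouted 𝓕 C g (fun i => if i ∈ S then c' i else c i) δ ∧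
      Relation.ReflTransGen (Move G ∅ (U ∪ C.verts)) c (fun i => if i ∈ S then c' i else c i) := by
    intro S
    induction S using Finset.induction_on with
    | empty => simpa using ⟨h, Relation.ReflTransGen.refl⟩
    | insert i S hiS ih =>
      have e : (fun j => if j ∈ insert i S then c' j else c j)
          = Function.update (fun j => if j ∈ S then c' j else c j) i (c' i) := by
        funext j
        rcases eq_or_ne j i with rfl | hji
        · simp
        · simp [hji]
      rw [e]
      by_cases hi : g i ∈ unionVerts 𝓕
      · have := ih.1.reach_update hC hU hg hi (v := c' i) (by simpa [hiS] using h1 i hi)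
        exact ⟨this.1, ih.2.trans this.2⟩
      · have e' : Function.update (fun j => if j ∈ S then c' j else c j) i (c' i)
            = fun j => if j ∈ S then c' j else c j := by
          simp [hiS, h2 i hi]
        rwa [e']
  simpa using key Finset.univ

/-- If every visit to the components in `𝓕` can be shadowed in many of them, then the component `C`
can be avoided. -/
theorem reroute {f : ℕ → ι → V} {N : ℕ} (hC : C ∈ 𝓕) (hU : Disjoint (unionVerts 𝓕) U)
    (hA : ∀ t, Admissible G (unionVerts 𝓕) U (f t))
    (hmv : ∀ t < N, Move G (unionVerts 𝓕) U (f t) (f (t + 1)))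
    (h0 : ∀ i, f 0 i ∉ unionVerts 𝓕) (hN : ∀ i, f N i ∉ unionVerts 𝓕)
    (henter : ∀ t < N, ∀ a, f t a ∈ X → f (t + 1) a ∈ unionVerts 𝓕 →
      ∀ δ : ι → Comp G X, ∃ D ∈ 𝓕, D ≠ C ∧ (∀ i, i ≠ a → D ≠ δ i) ∧
        ∃ v ∈ D.verts, G.Adj (f t a) v ∧ Shadow G X (unionVerts 𝓕) f a (t + 1) v) :
    Relation.ReflTransGen (Move G ∅ (U ∪ C.verts)) (f 0) (f N) := by
  have hMX := disjoint_unionVerts 𝓕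
  have main : ∀ t ≤ N, ∃ c δ, Rerouted 𝓕 C (f t) c δ ∧
      (∀ i, f t i ∈ unionVerts 𝓕 → Shadow G X (unionVerts 𝓕) f i t (c i)) ∧
      Relation.ReflTransGen (Move G ∅ (U ∪ C.verts)) (f 0) c := by
    intro t
    induction t with
    | zero =>
      intro _
      exact ⟨f 0, fun _ => C, ⟨fun _ _ => rfl, fun i h => absurd h (h0 i), fun i h => absurd h (h0 i),
        fun i h => absurd h (h0 i), fun i h => absurd h (h0 i), fun i _ _ h => absurd h (h0 i)⟩,
        fun i h => absurd h (h0 i), .refl⟩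
    | succ t ih =>
      intro ht
      obtain ⟨c, δ, hR, hS, hreach⟩ := ih (by omega)
      -- Before the step of `f` is imitated, each sheltered token makes the walk that its shadow
      -- prescribes at time `t`, ending next to its exit or ready for time `t + 1`.
      have hnext : ∀ i, ∃ v, (f t i ∈ unionVerts 𝓕 → Step G X (occupied X (f t))ᶜ (c i) v ∧
          ((f (t + 1) i ∈ X ∧ G.Adj v (f (t + 1) i)) ∨
            (f (t + 1) i ∈ unionVerts 𝓕 ∧ Shadow G X (unionVerts 𝓕) f i (t + 1) v))) ∧
          (f t i ∉ unionVerts 𝓕 → v = c i) := by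
        intro i
        by_cases hi : f t i ∈ unionVerts 𝓕
        · rcases hS i hi with ⟨h1, h2, h3⟩ | ⟨h1, h2, h3⟩
          · exact ⟨_, fun _ => ⟨h2, Or.inl ⟨h1, h3⟩⟩, fun h => absurd hi h⟩
          · exact ⟨_, fun _ => ⟨h2, Or.inr ⟨h1, h3⟩⟩, fun h => absurd hi h⟩
        · exact ⟨c i, fun h => absurd h hi, fun _ => rfl⟩
      choose c' hc1 hc2 using hnext
      obtain ⟨hR', hreach'⟩ := hR.reach hC hU (hA t) (fun i hi => (hc1 i hi).1) hc2
      have hshadow : ∀ i, f t i ∈ unionVerts 𝓕 → f (t + 1) i ∈ unionVerts 𝓕 →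
          Shadow G X (unionVerts 𝓕) f i (t + 1) (c' i) := by
        intro i hi hi'
        rcases (hc1 i hi).2 with h | h
        · exact absurd h.1 (hMX.notMem_of_mem_left hi')
        · exact h.2
      have hallowed : ∀ i v, Shadow G X (unionVerts 𝓕) f i (t + 1) v →
          v ∈ allowed G X (occupied X (f (t + 1)))ᶜ := by
        intro i v h
        rcases h with ⟨-, h, -⟩ | ⟨-, h, -⟩ <;> exact h.1
      obtain ⟨-, -, j, w, hadj, hupd⟩ := hmv t (by omega)
      have hj : f (t + 1) j = w := by rw [hupd]; simp
      have hne : ∀ i, i ≠ j → f (t + 1) i = f t i := fun i hi => by rw [hupd]; simp [hi]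
      -- A step inside `M` needs no counterpart, a step into `M` becomes a step into a fresh private
      -- component, and every other step leads to the same vertex as in `f`.
      suffices ∃ c'' δ'', Rerouted 𝓕 C (f (t + 1)) c'' δ'' ∧
          (∀ i, f (t + 1) i ∈ unionVerts 𝓕 → Shadow G X (unionVerts 𝓕) f i (t + 1) (c'' i)) ∧
          (c'' = c' ∨ ∃ v, G.Adj (c' j) v ∧ c'' = Function.update c' j v) by
        obtain ⟨c'', δ'', hR'', hS'', hc''⟩ := this
        refine ⟨c'', δ'', hR'', hS'', (hreach.trans hreach').trans ?_⟩
        rcases hc'' with rfl | ⟨v, hv, hc''⟩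
        · exact .refl
        · exact .single ⟨hR'.admissible hC hU (hA t), hR''.admissible hC hU (hA _), j, v, hv, hc''⟩
      by_cases hw : w ∈ unionVerts 𝓕
      · by_cases hjM : f t j ∈ unionVerts 𝓕
        · have hiff : ∀ i, f (t + 1) i ∈ unionVerts 𝓕 ↔ f t i ∈ unionVerts 𝓕 := by
            intro i
            rcases eq_or_ne i j with rfl | hij
            · simp [hj, hw, hjM]
            · rw [hne i hij]
          have hS'' : ∀ i, f (t + 1) i ∈ unionVerts 𝓕 →
              Shadow G X (unionVerts 𝓕) f i (t + 1) (c' i) :=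
            fun i hi => hshadow i ((hiff i).1 hi) hi
          refine ⟨c', δ, ⟨fun i hi => ?_, fun i hi => hR'.mem i ((hiff i).1 hi),
            fun i hi => hR'.ne i ((hiff i).1 hi), fun i hi => hR'.mem_verts i ((hiff i).1 hi),
            fun i hi => hallowed i _ (hS'' i hi),
            fun i l hil hi hl => hR'.injOn i l hil ((hiff i).1 hi) ((hiff l).1 hl)⟩, hS'', Or.inl rfl⟩
          have hij : i ≠ j := by
            rintro rfl
            exact hi (hj ▸ hw)
          rw [hne i hij]
          exact hR'.eq_of_notMem i fun h => hi ((hiff i).2 h)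
        · have hjX : f t j ∈ X := (unionVerts_adj 𝓕 w hw _ hadj.symm).resolve_left hjM
          obtain ⟨D, hD, hDC, hDδ, v, hvD, hv, hvS⟩ :=
            henter t (by omega) j hjX (by rw [hj]; exact hw) δ
          have hS'' : ∀ i, f (t + 1) i ∈ unionVerts 𝓕 →
              Shadow G X (unionVerts 𝓕) f i (t + 1) (Function.update c' j v i) := by
            intro i hi
            rcases eq_or_ne i j with rfl | hij
            · simpa using hvS
            · rw [Function.update_of_ne hij]
              exact hshadow i (hne i hij ▸ hi) hi
          refine ⟨Function.update c' j v, Function.update δ j D,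
            ⟨fun i hi => ?_, fun i hi => ?_, fun i hi => ?_, fun i hi => ?_,
              fun i hi => hallowed i _ (hS'' i hi), fun i l hil hi hl => ?_⟩, hS'',
            Or.inr ⟨v, by rw [hc2 j hjM, hR.eq_of_notMem j hjM]; exact hv, rfl⟩⟩
          · have hij : i ≠ j := by
              rintro rfl
              exact hi (hj ▸ hw)
            rw [Function.update_of_ne hij, hne i hij]
            exact hR'.eq_of_notMem i (hne i hij ▸ hi)
          · rcases eq_or_ne i j with rfl | hij
            · simpa using hD
            · rw [Function.update_of_ne hij]; exact hR'.mem i (hne i hij ▸ hi)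
          · rcases eq_or_ne i j with rfl | hij
            · simpa using hDC
            · rw [Function.update_of_ne hij]; exact hR'.ne i (hne i hij ▸ hi)
          · rcases eq_or_ne i j with rfl | hij
            · simpa using hvD
            · rw [Function.update_of_ne hij, Function.update_of_ne hij]
              exact hR'.mem_verts i (hne i hij ▸ hi)
          · rcases eq_or_ne i j with rfl | hij
            · rw [Function.update_self, Function.update_of_ne hil.symm]
              exact hDδ l hil.symm
            · rcases eq_or_ne l j with rfl | hlj
              · rw [Function.update_self, Function.update_of_ne hij]
                exact (hDδ i hij).symm
              · rw [Function.update_of_ne hij, Function.update_of_ne hlj]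
                exact hR'.injOn i l hil (hne i hij ▸ hi) (hne l hlj ▸ hl)
      · have hij : ∀ i, f (t + 1) i ∈ unionVerts 𝓕 → i ≠ j := by
          rintro i hi rfl
          exact hw (hj ▸ hi)
        have hmem : ∀ i, f (t + 1) i ∈ unionVerts 𝓕 → f t i ∈ unionVerts 𝓕 := fun i hi =>
          hne i (hij i hi) ▸ hi
        have hS'' : ∀ i, f (t + 1) i ∈ unionVerts 𝓕 →
            Shadow G X (unionVerts 𝓕) f i (t + 1) (Function.update c' j w i) := by
          intro i hi
          rw [Function.update_of_ne (hij i hi)]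
          exact hshadow i (hmem i hi) hi
        refine ⟨Function.update c' j w, δ, ⟨fun i hi => ?_, fun i hi => hR'.mem i (hmem i hi),
          fun i hi => hR'.ne i (hmem i hi), fun i hi => ?_, fun i hi => hallowed i _ (hS'' i hi),
          fun i l hil hi hl => hR'.injOn i l hil (hmem i hi) (hmem l hl)⟩, hS'',
          Or.inr ⟨w, ?_, rfl⟩⟩
        · rcases eq_or_ne i j with rfl | hij'
          · simpa using hj.symm
          · rw [Function.update_of_ne hij', hne i hij']
            exact hR'.eq_of_notMem i (hne i hij' ▸ hi)
        · rw [Function.update_of_ne (hij i hi)]; exact hR'.mem_verts i (hmem i hi)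
        · by_cases hjM : f t j ∈ unionVerts 𝓕
          · rcases (hc1 j hjM).2 with h | h
            · rw [← hj]; exact h.2
            · exact absurd (hj ▸ h.1) hw
          · rw [hc2 j hjM, hR.eq_of_notMem j hjM]; exact hadj
  obtain ⟨c, δ, hR, -, hreach⟩ := main N le_rfl
  have : c = f N := funext fun i => hR.eq_of_notMem i (hN i)
  rwa [this] at hreach

end Rerouting

/-! ### Deleted vertices as forbidden vertices, and the passage to labelled tokens -/

section Avoiding

variable {V : Type*} {G : SimpleGraph V} {X U : Set V}

/-- There is a transformation from `I` to `J` in `G` during which no token is ever on `U`. -/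
def ReconfAvoiding (G : SimpleGraph V) (U I J : Set V) : Prop :=
  Relation.ReflTransGen (fun A B => (G.IsIndepSet A ∧ Disjoint A U) ∧
    (G.IsIndepSet B ∧ Disjoint B U) ∧ Slide G A B) I J

theorem ReconfAvoiding.mono {U' I J : Set V} (h : U' ⊆ U) (hr : ReconfAvoiding G U I J) :
    ReconfAvoiding G U' I J :=
  Relation.ReflTransGen.mono (fun _ _ ⟨hA, hB, hs⟩ =>
    ⟨⟨hA.1, hA.2.mono_right h⟩, ⟨hB.1, hB.2.mono_right h⟩, hs⟩) _ _ hr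

theorem reconfAvoiding_empty {I J : Set V} : ReconfAvoiding G ∅ I J ↔ Reconf G I J := by
  unfold ReconfAvoiding Reconf
  simp

/-- Forbidding `U` in a fixed graph replaces deleting it, so components of `G - X` need not be
transported while `U` grows. -/
theorem reconf_induce_iff {I J : Set V} (hI : Disjoint I U) (hJ : Disjoint J U) :
    Reconf (G.induce Uᶜ) (Subtype.val ⁻¹' I : Set ↥(Uᶜ)) (Subtype.val ⁻¹' J) ↔
      ReconfAvoiding G U I J := by
  constructor
  · intro h
    have himg : ∀ K : Set V, Disjoint K U →
        Subtype.val '' (Subtype.val ⁻¹' K : Set ↥(Uᶜ)) = K := fun K hK => by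
      rw [Subtype.image_preimage_coe, Set.inter_eq_right]
      exact Set.subset_compl_iff_disjoint_right.2 hK
    rw [← himg I hI, ← himg J hJ]
    refine Relation.ReflTransGen.lift (Set.image Subtype.val) ?_ _ _ h
    rintro A B ⟨hA, hB, u, hu, v, hv, huv, rfl⟩
    have hind : ∀ S : Set ↥(Uᶜ), (G.induce Uᶜ).IsIndepSet S →
        G.IsIndepSet (Subtype.val '' S) ∧ Disjoint (Subtype.val '' S) U := by
      intro S hS
      refine ⟨?_, Set.disjoint_left.2 ?_⟩
      · rintro _ ⟨a, ha, rfl⟩ _ ⟨b, hb, rfl⟩ hab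
        exact hS ha hb fun h => hab (congrArg _ h)
      · rintro _ ⟨a, -, rfl⟩
        exact a.2
    refine ⟨hind A hA, hind _ hB, u, ⟨u, hu, rfl⟩, v, ?_, huv, ?_⟩
    · rintro ⟨w, hw, hwv⟩
      exact hv (Subtype.ext hwv ▸ hw)
    · rw [Set.image_insert_eq, Set.image_sdiff Subtype.val_injective, Set.image_singleton]
  · intro h
    refine Relation.ReflTransGen.lift (fun K => (Subtype.val ⁻¹' K : Set ↥(Uᶜ))) ?_ _ _ h
    rintro A B ⟨⟨hA, hAU⟩, ⟨hB, hBU⟩, u, hu, v, hv, huv, rfl⟩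
    have hind : ∀ S : Set V, G.IsIndepSet S →
        (G.induce Uᶜ).IsIndepSet (Subtype.val ⁻¹' S : Set ↥(Uᶜ)) := by
      intro S hS a ha b hb hab
      exact hS ha hb fun h => hab (Subtype.ext h)
    have hvU : v ∉ U := hBU.notMem_of_mem_left (Set.mem_insert _ _)
    refine ⟨hind A hA, hind _ hB, ⟨u, hAU.notMem_of_mem_left hu⟩, hu, ⟨v, hvU⟩, hv, huv, ?_⟩
    ext w
    simp [Subtype.ext_iff]

variable {ι : Type*}

theorem Admissible.injective {c : ι → V} (h : Admissible G ∅ U c) : Function.Injective c := by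
  intro i j hij
  by_contra hne
  rcases h.2 i j hne with h | h
  · exact h.1
  · exact h.1 hij

theorem admissible_iff {c : ι → V} (hc : Function.Injective c) :
    Admissible G ∅ U c ↔ G.IsIndepSet (Set.range c) ∧ Disjoint (Set.range c) U := by
  constructor
  · intro h
    refine ⟨?_, Set.disjoint_left.2 ?_⟩
    · rintro _ ⟨i, rfl⟩ _ ⟨j, rfl⟩ hij
      rcases h.2 i j fun h => hij (h ▸ rfl) with h | h
      · exact absurd h.1 (Set.notMem_empty _)
      · exact h.2
    · rintro _ ⟨i, rfl⟩
      exact h.1 i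
  · rintro ⟨h1, h2⟩
    refine ⟨fun i => h2.notMem_of_mem_left ⟨i, rfl⟩, fun i j hij => Or.inr ?_⟩
    exact ⟨hc.ne hij, h1 ⟨i, rfl⟩ ⟨j, rfl⟩ (hc.ne hij)⟩

theorem Admissible.weaken {M : Set V} {c : ι → V} (h : Admissible G ∅ U c) :
    Admissible G M U c :=
  ⟨h.1, fun i j hij => (h.2 i j hij).elim (fun h => h.1.elim) Or.inr⟩

variable [DecidableEq ι]

theorem range_update {c : ι → V} (hc : Function.Injective c) (i : ι) (v : V) :
    Set.range (Function.update c i v) = insert v (Set.range c \ {c i}) := by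
  ext w
  constructor
  · rintro ⟨j, rfl⟩
    rcases eq_or_ne j i with rfl | hij
    · simp
    · right
      rw [Function.update_of_ne hij]
      exact ⟨⟨j, rfl⟩, hc.ne hij⟩
  · rintro (rfl | ⟨⟨j, rfl⟩, hj⟩)
    · exact ⟨i, by simp⟩
    · have : j ≠ i := fun h => hj (h ▸ rfl)
      exact ⟨j, by simp [this]⟩

theorem ReconfAvoiding.of_moves {c c' : ι → V}
    (h : Relation.ReflTransGen (Move G ∅ U) c c') :
    ReconfAvoiding G U (Set.range c) (Set.range c') := by
  refine Relation.ReflTransGen.lift Set.range ?_ _ _ h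
  rintro a b ⟨ha, hb, i, v, hadj, rfl⟩
  have hai := ha.injective
  refine ⟨(admissible_iff hai).1 ha, (admissible_iff hb.injective).1 hb, a i, ⟨i, rfl⟩, v, ?_,
    hadj, range_update hai i v⟩
  rintro ⟨j, rfl⟩
  rcases eq_or_ne j i with rfl | hij
  · exact G.loopless.irrefl _ hadj
  · exact hij (hb.injective (by simp [hij]))

theorem ReconfAvoiding.exists_moves {c : ι → V} {J : Set V} (hc : Admissible G ∅ U c)
    (h : ReconfAvoiding G U (Set.range c) J) :
    ∃ c', Set.range c' = J ∧ Admissible G ∅ U c' ∧ Relation.ReflTransGen (Move G ∅ U) c c' := by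
  induction h with
  | refl => exact ⟨c, rfl, hc, .refl⟩
  | tail _ hs ih =>
    obtain ⟨c', rfl, hc', hr⟩ := ih
    obtain ⟨-, hB, u, ⟨i, rfl⟩, v, hv, hadj, rfl⟩ := hs
    have hinj := hc'.injective
    have hinj' : Function.Injective (Function.update c' i v) := by
      intro a b hab
      by_cases ha : a = i <;> by_cases hb : b = i
      · rw [ha, hb]
      · rw [ha, Function.update_self, Function.update_of_ne hb] at hab
        exact absurd ⟨b, hab.symm⟩ hv
      · rw [hb, Function.update_self, Function.update_of_ne ha] at hab
        exact absurd ⟨a, hab⟩ hv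
      · rw [Function.update_of_ne ha, Function.update_of_ne hb] at hab
        exact hinj hab
    rw [← range_update hinj i v] at hB
    have hadm := (admissible_iff hinj').2 hB
    exact ⟨_, range_update hinj i v, hadm, hr.tail ⟨hc', hadm, i, v, hadj, rfl⟩⟩

theorem exists_costReach [Fintype ι] {M : Set V} {c c' : ι → V}
    (h : Relation.ReflTransGen (Move G ∅ U) c c') : ∃ n, CostReach G X M U n c c' := by
  induction h with
  | refl => exact ⟨0, .refl c⟩
  | tail _ hs ih =>
    obtain ⟨n, hn⟩ := ih
    exact ⟨_, hn.step ⟨hs.1.weaken, hs.2.1.weaken, hs.2.2⟩⟩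

end Avoiding

/-! ### A token-free member of a rich collection is removable -/

section RichCollections

variable {V : Type*} {G : SimpleGraph V} {X U : Set V}

/-- There is a walk in the component `D` from a neighbour of `z` to a neighbour of `z'` that obeys
the restrictions `Bs`. -/
def Passes (G : SimpleGraph V) (X : Set V) (z : V) (Bs : List (Set V)) (z' : V) (D : Comp G X) :
    Prop :=
  ∃ u ∈ D.verts, ∃ v, G.Adj u z ∧ Run G X Bs u v ∧ G.Adj v z'

/-- Every kind of visit of length `L` that is possible in one member of `𝓗` is possible in more than
`q` members. -/
def Rich (L q : ℕ) (𝓗 : Set (Comp G X)) : Prop :=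
  ∀ H ∈ 𝓗, ∀ z ∈ X, ∀ z' ∈ X, ∀ Bs : List (Set V), Bs.length = L → Passes G X z Bs z' H →
    q < {D ∈ 𝓗 | Passes G X z Bs z' D}.ncard

instance [Finite V] : Finite (Comp G X) :=
  Finite.of_surjective _ Quot.mk_surjective

/-- A vertex meets at most one component, so the components meeting `S` lie in the image of `S`. -/
theorem ncard_not_disjoint_le [Finite V] (S : Set V) :
    {D : Comp G X | ¬ Disjoint D.verts S}.ncard ≤ S.ncard := by
  classical
  rcases isEmpty_or_nonempty (Comp G X) with h | ⟨⟨D₀⟩⟩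
  · simp [Set.eq_empty_of_isEmpty]
  -- The value `D₀` on vertices of `X` is irrelevant.
  · let g : V → Comp G X := fun v =>
      if h : v ∉ X then (G.induce Xᶜ).connectedComponentMk ⟨v, h⟩ else D₀
    refine le_trans (Set.ncard_le_ncard (t := g '' S) ?_ (Set.toFinite _))
      (Set.ncard_image_le (Set.toFinite _))
    intro D hD
    obtain ⟨v, hvD, hvS⟩ := Set.not_disjoint_iff.1 hD
    have hvX := Comp.notMem_of_mem_verts hvD
    refine ⟨v, hvS, ?_⟩
    rw [Comp.mem_verts_iff hvX] at hvD
    simp only [g, dif_pos hvX]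
    exact hvD

theorem exists_free [Finite V] {Is It : Set V} {k : ℕ} (hk : Is.ncard = k) (hk' : It.ncard = k)
    {𝓗 : Set (Comp G X)} (h : 2 * k < 𝓗.ncard) :
    ∃ C ∈ 𝓗, Disjoint C.verts (Is ∪ It) := by
  have h1 := ncard_not_disjoint_le (G := G) (X := X) (Is ∪ It)
  have h2 := Set.ncard_union_le Is It
  obtain ⟨C, hC, hC'⟩ := Set.exists_mem_notMem_of_ncard_lt_ncard
    (s := {D : Comp G X | ¬ Disjoint D.verts (Is ∪ It)}) (t := 𝓗) (by omega) (Set.toFinite _)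
  exact ⟨C, hC, by simpa using hC'⟩

/-- Any token-free member of a rich collection can be avoided. -/
theorem Rich.reconfAvoiding [Finite V] {Is It : Set V} {k : ℕ} (hIs : G.IsIndepSet Is)
    (hk : Is.ncard = k) (hk' : It.ncard = k) (hIsU : Disjoint Is U) {𝓗 : Set (Comp G X)}
    (hU : ∀ D ∈ 𝓗, Disjoint D.verts U) (hrich : Rich (5 * X.ncard * k + 1) (5 * X.ncard * k) 𝓗)
    {C : Comp G X} (hC : C ∈ 𝓗) (hfree : Disjoint C.verts (Is ∪ It))
    (h : ReconfAvoiding G U Is It) : ReconfAvoiding G (U ∪ C.verts) Is It := by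
  classical
  have : Fintype Is := Fintype.ofFinite _
  have hcard : Fintype.card Is = k := by
    rw [← Nat.card_eq_fintype_card, Nat.card_coe_set_eq, hk]
  -- Members with tokens of `Is` or `It` are left out, so that both end placements lie outside `M`
  -- and every visit has an entry and an exit.
  set 𝓕 : Set (Comp G X) := {D ∈ 𝓗 | Disjoint D.verts (Is ∪ It)} with h𝓕
  have hCF : C ∈ 𝓕 := ⟨hC, hfree⟩
  have hMX := disjoint_unionVerts 𝓕
  have hMU : Disjoint (unionVerts 𝓕) U := Set.disjoint_left.2 fun v ⟨D, hD, hv⟩ =>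
    (hU D hD.1).notMem_of_mem_left hv
  have hMI : ∀ v ∈ Is ∪ It, v ∉ unionVerts 𝓕 := fun v hv ⟨D, hD, hv'⟩ =>
    hD.2.notMem_of_mem_left hv' hv
  have hc0 : Admissible G ∅ U (Subtype.val : Is → V) :=
    (admissible_iff Subtype.val_injective).2 (by simpa using ⟨hIs, hIsU⟩)
  obtain ⟨c₁, hrange, -, hmoves⟩ := ReconfAvoiding.exists_moves hc0 (J := It) (by simpa using h)
  -- A strict transformation is also a relaxed one; the least cost of a relaxed sequence is taken
  -- below.
  have hex := exists_costReach (X := X) (M := unionVerts 𝓕) hmoves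
  obtain ⟨f, N, hf0, hfN, hA, hmv, hcost⟩ := (Nat.find_spec hex).exists_seq hc0.weaken
  have hmin : ∀ n, CostReach G X (unionVerts 𝓕) U n (f 0) (f N) →
      ∑ t ∈ Finset.range N, moveCost X (f t) (f (t + 1)) ≤ n := by
    intro n hn
    rw [hf0, hfN] at hn
    rw [← hcost]
    exact Nat.find_min' hex hn
  have h0 : ∀ i, f 0 i ∉ unionVerts 𝓕 := fun i => by
    rw [hf0]; exact hMI _ (Or.inl i.2)
  have hN : ∀ i, f N i ∉ unionVerts 𝓕 := fun i => by
    rw [hfN]; exact hMI _ (Or.inr (hrange ▸ ⟨i, rfl⟩))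
  have key := reroute hCF hMU hA hmv h0 hN ?_
  · rw [hf0, hfN] at key
    have := ReconfAvoiding.of_moves key
    rwa [hrange, Subtype.range_val] at this
  intro t ht a haX haM δ
  have hx : 1 ≤ X.ncard := Nat.one_le_iff_ne_zero.2 (Set.ncard_ne_zero_of_mem haX)
  have hk1 : 1 ≤ k := hcard ▸ Fintype.card_pos_iff.2 ⟨a⟩
  -- An entry from `X` needs a vertex of `X` and a token. This positivity gives `4xk + 2 ≤ 5xk + 1`,
  -- so profiles fit the length of the richness assumption.
  have hxk : 1 ≤ X.ncard * k := Nat.mul_pos hx hk1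
  have hkx : k ≤ X.ncard * k := Nat.le_mul_of_pos_left k hx
  obtain ⟨Bs, z, hlen, hz, ⟨v', hrun, hv'⟩, hsh⟩ := exists_profile (L := 5 * X.ncard * k + 1)
    (unionVerts_adj 𝓕) hMX hMU hA hmv hmin (a := a) (s := t + 1) ht haM (hN a)
    (by rw [hcard, mul_assoc]; omega)
  obtain ⟨H, hH, haH⟩ := id haM
  have hadj : G.Adj (f (t + 1) a) (f t a) := by
    rcases (hmv t ht).eq_or_adj a with h | h
    · exact absurd (h ▸ haX) (hMX.notMem_of_mem_left haM)
    · exact h.symm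
  have hmany := hrich H hH.1 _ haX z hz Bs hlen ⟨_, haH, v', hadj, hrun, hv'⟩
  -- At most `2k` components meet `Is ∪ It`, one is `C`, and `k - 1` shelter the other tokens.
  have hbad : ({D : Comp G X | ¬ Disjoint D.verts (Is ∪ It)} ∪ {C} ∪ δ '' {i | i ≠ a}).ncard
      ≤ 3 * k := by
    have b1 := ncard_not_disjoint_le (G := G) (X := X) (Is ∪ It)
    have b2 := Set.ncard_union_le Is It
    have b3 : (δ '' {i | i ≠ a}).ncard ≤ k - 1 := by
      refine (Set.ncard_image_le (Set.toFinite _)).trans ?_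
      have : {i : Is | i ≠ a} = {a}ᶜ := rfl
      rw [this, Set.ncard_compl, Set.ncard_singleton, Nat.card_eq_fintype_card, hcard]
    have b4 := Set.ncard_union_le {D : Comp G X | ¬ Disjoint D.verts (Is ∪ It)} {C}
    have b5 := Set.ncard_union_le ({D : Comp G X | ¬ Disjoint D.verts (Is ∪ It)} ∪ {C})
      (δ '' {i | i ≠ a})
    rw [Set.ncard_singleton] at b4
    omega
  obtain ⟨D, hD, hDbad⟩ := Set.exists_mem_notMem_of_ncard_lt_ncard
    (hbad.trans_lt (lt_of_le_of_lt (by rw [mul_assoc]; omega) hmany)) (Set.toFinite _)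
  simp only [Set.mem_union, Set.mem_ofPred_eq, not_or, not_not, Set.mem_singleton_iff,
    Set.mem_image, not_exists, not_and] at hDbad
  obtain ⟨u, huD, w, huz, hrun', hwz⟩ := hD.2
  exact ⟨D, ⟨hD.1, hDbad.1.1⟩, hDbad.1.2, fun i hi he => hDbad.2 i hi he.symm, u, huD, huz.symm,
    hsh u w hrun' hwz⟩

theorem removable_iff {Is It : Set V} (h : Disjoint U (Is ∪ It)) :
    Removable G Is It U ↔ (ReconfAvoiding G ∅ Is It ↔ ReconfAvoiding G U Is It) := by
  have h1 : Disjoint Is U := (h.mono_right Set.subset_union_left).symm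
  have h2 : Disjoint It U := (h.mono_right Set.subset_union_right).symm
  unfold Removable
  rw [reconf_induce_iff h1 h2, reconfAvoiding_empty]
  simp [h]

theorem Rich.removable [Finite V] {Is It : Set V} {k : ℕ} (hIs : G.IsIndepSet Is)
    (hk : Is.ncard = k) (hk' : It.ncard = k) {𝓗 : Set (Comp G X)}
    (hrich : Rich (5 * X.ncard * k + 1) (5 * X.ncard * k) 𝓗)
    {C : Comp G X} (hC : C ∈ 𝓗) (hfree : Disjoint C.verts (Is ∪ It)) :
    Removable G Is It C.verts := by
  rw [removable_iff hfree]
  refine ⟨fun h => ?_, fun h => h.mono (Set.empty_subset _)⟩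
  have := Rich.reconfAvoiding hIs hk hk' (Set.disjoint_empty _) (fun _ _ => Set.disjoint_empty _)
    hrich hC hfree h
  rwa [Set.empty_union] at this

end RichCollections

/-! ### From types to restricted walks: safe collections are rich -/

section SafeIsRich

variable {V : Type*} {G : SimpleGraph V} {X : Set V}

theorem Run.exists_seq {Bs : List (Set V)} {u v : V} (h : Run G X Bs u v) :
    ∃ c : ℕ → V, c 0 = u ∧ c Bs.length = v ∧
      ∀ i (hi : i < Bs.length), Step G X Bs[i] (c i) (c (i + 1)) := by
  induction Bs generalizing u with
  | nil => exact ⟨fun _ => u, rfl, h, fun i hi => absurd hi (by simp)⟩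
  | cons B Bs ih =>
    obtain ⟨w, hw, hr⟩ := h
    obtain ⟨c, h0, hl, hs⟩ := ih hr
    refine ⟨fun i => Nat.casesOn i u c, rfl, by simpa using hl, fun i hi => ?_⟩
    cases i with
    | zero => simpa [h0] using hw
    | succ i => exact hs i (by simpa using hi)

theorem run_of_seq {Bs : List (Set V)} {c : ℕ → V}
    (h : ∀ i (hi : i < Bs.length), Step G X Bs[i] (c i) (c (i + 1))) :
    Run G X Bs (c 0) (c Bs.length) := by
  induction Bs generalizing c with
  | nil => rfl
  | cons B Bs ih =>
    refine ⟨c 1, h 0 (by simp), ?_⟩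
    exact ih (c := fun i => c (i + 1)) fun i hi => h (i + 1) (by simpa using hi)

/-- `P` lists the inner vertices; a walk that does not move is the case in which `Link` identifies
its ends. -/
theorem Step.exists_link {B : Set V} {u v : V} (h : Step G X B u v) :
    ∃ P, Link G u P v ∧ ∀ w ∈ P, Step G X B u w := by
  obtain ⟨h0, h1⟩ := h
  induction h1 with
  | refl => exact ⟨[], Or.inr ⟨rfl, rfl⟩, by simp⟩
  | @tail b c hb hc ih =>
    obtain ⟨P, hP | ⟨rfl, rfl⟩, hPs⟩ := ih
    · refine ⟨P ++ [b], Or.inl ?_, ?_⟩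
      · rw [← List.cons_append, List.isChain_append]
        refine ⟨by simpa using hP, by simp, ?_⟩
        simpa [List.getLast?_cons] using hc.1
      · intro w hw
        rcases List.mem_append.1 hw with hw | hw
        · exact hPs w hw
        · rw [List.mem_singleton.1 hw]; exact ⟨h0, hb⟩
    · exact ⟨[], Or.inl (by simpa using hc.1), by simp⟩

theorem step_of_isChain {B : Set V} {u v : V} {P : List V}
    (h : List.IsChain G.Adj (u :: (P ++ [v]))) (hu : u ∈ allowed G X B)
    (hv : v ∈ allowed G X B) (hP : ∀ w ∈ P, w ∈ allowed G X B) : Step G X B u v := by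
  induction P generalizing u with
  | nil => exact (Step.refl hu).tail (Or.inr (by simpa using h)) hv
  | cons w P ih =>
    rw [List.cons_append, List.isChain_cons_cons] at h
    have hw := hP w (by simp)
    exact ((Step.refl hu).tail (Or.inr h.1) hw).trans
      (ih h.2 hw fun y hy => hP y (by simp [hy]))

theorem step_of_link {B : Set V} {u v : V} {P : List V} (h : Link G u P v)
    (hu : u ∈ allowed G X B) (hv : v ∈ allowed G X B) (hP : ∀ w ∈ P, w ∈ allowed G X B) :
    Step G X B u v := by
  rcases h with h | ⟨-, rfl⟩
  · exact step_of_isChain h hu hv hP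
  · exact Step.refl hu

/-- Recording the exact traces of a restricted walk gives a type of its component. Safety supplies
more than `l` components simulating that type, and their walks have the same traces, hence obey the
same restrictions. -/
theorem Safe.rich [Finite V] {l : ℕ} {𝓗 : Set (Comp G X)} (h : Safe l 𝓗) : Rich (l + 1) l 𝓗 := by
  classical
  intro H hH z hz z' hz' Bs hlen ⟨u, huH, v, huz, hrun, hvz⟩
  obtain ⟨c, hc0, hcl, hstep⟩ := hrun.exists_seq
  rw [hlen] at hcl
  have hcH : ∀ i ≤ l + 1, c i ∈ H.verts := by
    intro i
    induction i with
    | zero => exact fun _ => hc0 ▸ huH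
    | succ i ih => exact fun hi => Comp.mem_of_step (ih (by omega)) (hstep i (by omega))
  have hlink : ∀ i : Fin (l + 1), ∃ P, Link G (c i) P (c (i + 1)) ∧
      ∀ w ∈ P, Step G X (Bs[(i : ℕ)]'(by omega)) (c i) w := fun i => (hstep i (by omega)).exists_link
  choose P hP hPs using hlink
  -- The `l + 1` pieces have `l` inner junctions, which become the waiting vertices. The vertices
  -- `z` and `z'` witness that the outer traces are nonempty.
  let T : XType X l :=
    { initial := trace G X {c 0}
      final := trace G X {c (l + 1)}
      wait := fun i => trace G X {c (i + 1)}
      trans := fun i => if P i = [] then none else some (trace G X {w | w ∈ P i})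
      initial_nonempty := ⟨⟨z, hz⟩, c 0, rfl, hc0 ▸ huz⟩
      final_nonempty := ⟨⟨z', hz'⟩, c (l + 1), rfl, hcl ▸ hvz⟩ }
  have hT : (⟨l, T⟩ : Σ m : ℕ, XType X m) ∈ signature l H := by
    refine Set.mem_iUnion₂.2 ⟨c 0, hcH 0 (by omega), le_rfl, fun i => c i, P, fun i => hcH i (Nat.le_of_lt_succ i.2),
      fun i w hw => Comp.mem_of_step (hcH i (Nat.le_of_lt i.2)) (hPs i w hw), hP, rfl, rfl, rfl,
      fun i => rfl, fun i hi => ?_, fun i hi => ?_⟩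
    · simp [T, hi]
    · simp [T, hi]
  have hmany : l < {C' ∈ 𝓗 | (⟨l, T⟩ : Σ m : ℕ, XType X m) ∈ signature l C'}.ncard := by
    by_contra hle
    exact h H hH ⟨_, hT, not_lt.1 hle⟩
  refine hmany.trans_le (Set.ncard_le_ncard ?_ (Set.toFinite _))
  rintro D ⟨hD, hTD⟩
  refine ⟨hD, ?_⟩
  obtain ⟨_, -, -, c', P', hc'D, hP'D, hlink', rfl, hinit, hfin, hwait, hnil, hcons⟩ :=
    Set.mem_iUnion₂.1 hTD
  have htr : ∀ j : Fin (l + 2), trace G X {c' j} = trace G X {c j} := by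
    intro j
    refine Fin.lastCases ?_ (fun j => ?_) j
    · exact hfin
    · refine Fin.cases ?_ (fun j => ?_) j
      · exact hinit
      · exact hwait j
  have hadj : ∀ (j : Fin (l + 2)) (x : V), x ∈ X → (G.Adj (c' j) x ↔ G.Adj (c j) x) := by
    intro j x hx
    have : (⟨x, hx⟩ : X) ∈ trace G X {c' j} ↔ (⟨x, hx⟩ : X) ∈ trace G X {c j} := by rw [htr]
    simpa [trace] using this
  -- The ends of a piece have the traces of the old junctions. Its inner vertices see only what the
  -- old inner vertices saw; if there were none, the entry `none` forces the new piece to have none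
  -- either.
  have hstep' : ∀ i : Fin (l + 1),
      Step G X (Bs[(i : ℕ)]'(by omega)) (c' i.castSucc) (c' i.succ) := by
    intro i
    have hs := hstep i (by omega)
    refine step_of_link (hlink' i) ⟨Comp.notMem_of_mem_verts (hc'D _), fun x hx hxw => ?_⟩
      ⟨Comp.notMem_of_mem_verts (hc'D _), fun x hx hxw => ?_⟩
      fun w hw => ⟨Comp.notMem_of_mem_verts (hP'D i w hw), fun x hx hxw => ?_⟩
    · exact hs.1.2 x hx ((hadj _ x hx).1 hxw)
    · exact hs.right_mem.2 x hx ((hadj _ x hx).1 hxw)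
    · have h1 := hcons i (List.ne_nil_of_mem hw)
      by_cases hPi : P i = []
      · simp [T, hPi] at h1
      · simp only [T, if_neg hPi, Option.some.injEq] at h1
        have h2 : (⟨x, hx⟩ : X) ∈ trace G X {w | w ∈ P i} := by
          rw [h1]; exact ⟨w, hw, hxw⟩
        obtain ⟨w', hw', hxw'⟩ := h2
        exact (hPs i w' hw').right_mem.2 x hx hxw'
  refine ⟨c' 0, hc'D 0, c' (Fin.last (l + 1)), ?_, ?_, ?_⟩
  · rw [hadj _ z hz]
    simpa [hc0] using huz
  -- The value `c 0` beyond index `l + 1` is never reached.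
  · have := run_of_seq (G := G) (X := X) (Bs := Bs)
      (c := fun i => if hi : i < l + 2 then c' ⟨i, hi⟩ else c 0) fun i hi => by
        have := hstep' ⟨i, by omega⟩
        simpa [show i < l + 2 by omega, show i < l + 1 by omega] using this
    simpa [hlen, Fin.last] using this
  · rw [hadj _ z' hz']
    simpa [hcl] using hvz

end SafeIsRich

/-! ### Coding visits by numbered tests and eliminating rare ones -/

section Filtering

/-- Deleting all elements that satisfy some test satisfied by only a few elements. -/
theorem exists_subset_of_tests {α : Type*} [Finite α] (Sat : ℕ → Set α) (q : ℕ) (S : Finset ℕ)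
    (R : Set α) (hR : ∀ T ∉ S, ∀ a ∈ R, a ∉ Sat T) :
    ∃ H ⊆ R, (∀ T, ∀ a ∈ H, a ∈ Sat T → q < {b ∈ H | b ∈ Sat T}.ncard) ∧
      R.ncard ≤ H.ncard + q * S.card := by
  induction hn : S.card generalizing S R with
  | zero =>
    rw [Finset.card_eq_zero] at hn
    subst hn
    exact ⟨R, subset_rfl, fun T a ha h => absurd h (hR T (by simp) a ha), by omega⟩
  | succ n ih =>
    by_cases hgood : ∀ T, ∀ a ∈ R, a ∈ Sat T → q < {b ∈ R | b ∈ Sat T}.ncard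
    · exact ⟨R, subset_rfl, hgood, by omega⟩
    · push Not at hgood
      obtain ⟨T, a, ha, haT, hle⟩ := hgood
      have hTS : T ∈ S := by
        by_contra h
        exact hR T h a ha haT
      -- After deleting all elements that satisfy `T`, no remaining element does, so `T` is used up;
      -- it has cost at most `q` elements.
      obtain ⟨H, hH, hH1, hH2⟩ := ih (S.erase T) (R \ Sat T) (fun T' hT' b hb => by
        by_cases h : T' = T
        · subst h; exact hb.2
        · exact hR T' (fun h' => hT' (Finset.mem_erase.2 ⟨h, h'⟩)) b hb.1) (by
          rw [Finset.card_erase_of_mem hTS]; omega)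
      refine ⟨H, hH.trans Set.sdiff_subset, hH1, ?_⟩
      have h1 : R ⊆ (R \ Sat T) ∪ {b ∈ R | b ∈ Sat T} := fun b hb => by
        by_cases h : b ∈ Sat T
        · exact Or.inr ⟨hb, h⟩
        · exact Or.inl ⟨hb, h⟩
      have h2 := (Set.ncard_le_ncard h1 (Set.toFinite _)).trans (Set.ncard_union_le _ _)
      rw [Nat.mul_add, Nat.mul_one]
      omega

variable {V : Type*} {G : SimpleGraph V} {X U : Set V}

/-- The set of those `xs j` with `j < x` for which bit `i * x + j` of `T` is set. -/
def bitSet (xs : ℕ → V) (x T i : ℕ) : Set V :=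
  {y | ∃ j < x, xs j = y ∧ T.testBit (i * x + j)}

/-- The test number `T`: its bits describe the entry trace, `L` restrictions, and the exit trace. -/
def PassesBits (G : SimpleGraph V) (X : Set V) (xs : ℕ → V) (x L T : ℕ) (D : Comp G X) : Prop :=
  ∃ u ∈ D.verts, ∃ v, (∀ y ∈ bitSet xs x T 0, G.Adj u y) ∧
    Run G X ((List.range L).map fun i => bitSet xs x T (i + 1)) u v ∧
      ∀ y ∈ bitSet xs x T (L + 1), G.Adj v y

theorem exists_testBit (b : ℕ → Prop) (n : ℕ) : ∃ T < 2 ^ n, ∀ i < n, (T.testBit i = true ↔ b i) := by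
  induction n with
  | zero => exact ⟨0, by simp, by simp⟩
  | succ n ih =>
    obtain ⟨T, hT, hb⟩ := ih
    by_cases hn : b n
    · refine ⟨2 ^ n + T, by rw [pow_succ]; omega, fun i hi => ?_⟩
      rcases Nat.lt_succ_iff_lt_or_eq.1 hi with h | rfl
      · rw [Nat.testBit_two_pow_add_gt h]; exact hb i h
      · rw [Nat.testBit_two_pow_add_eq, Nat.testBit_lt_two_pow hT]; simpa using hn
    · refine ⟨T, by rw [pow_succ]; omega, fun i hi => ?_⟩
      rcases Nat.lt_succ_iff_lt_or_eq.1 hi with h | rfl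
      · exact hb i h
      · rw [Nat.testBit_lt_two_pow hT]; simpa using hn

/-- The characteristic vectors of `n` subsets of `X`, written one after the other, form a binary
number with `n * x` digits. -/
theorem exists_bitSet {xs : ℕ → V} {x : ℕ} (hxs : ∀ i < x, ∀ j < x, xs i = xs j → i = j)
    (hX : ∀ y, y ∈ X ↔ ∃ j < x, xs j = y) (S : ℕ → Set V) (n : ℕ) :
    ∃ T < 2 ^ (n * x), ∀ i < n, bitSet xs x T i = S i ∩ X := by
  -- Recovering block and position by division needs a positive block length.
  rcases Nat.eq_zero_or_pos x with rfl | hx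
  · refine ⟨0, by simp, fun i _ => ?_⟩
    ext y
    simp [bitSet, hX]
  · obtain ⟨T, hT, hb⟩ := exists_testBit (fun m => xs (m % x) ∈ S (m / x)) (n * x)
    refine ⟨T, hT, fun i hi => ?_⟩
    have key : ∀ j < x, (T.testBit (i * x + j) = true ↔ xs j ∈ S i) := by
      intro j hj
      rw [hb _ (by nlinarith)]
      have h1 : (i * x + j) % x = j := by
        rw [Nat.mul_add_mod', Nat.mod_eq_of_lt hj]
      have h2 : (i * x + j) / x = i := by
        rw [mul_comm, Nat.mul_add_div hx, Nat.div_eq_of_lt hj, add_zero]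
      rw [h1, h2]
    ext y
    constructor
    · rintro ⟨j, hj, rfl, hbit⟩
      exact ⟨(key j hj).1 hbit, (hX _).2 ⟨j, hj, rfl⟩⟩
    · rintro ⟨hS, hy⟩
      obtain ⟨j, hj, rfl⟩ := (hX _).1 hy
      exact ⟨j, hj, rfl, (key j hj).2 hS⟩

theorem allowed_congr {B B' : Set V} (h : B ∩ X = B' ∩ X) : allowed G X B = allowed G X B' := by
  have : ∀ x ∈ X, (x ∈ B ↔ x ∈ B') := fun x hx => by
    have : x ∈ B ∩ X ↔ x ∈ B' ∩ X := by rw [h]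
    simpa [hx] using this
  exact (allowed_mono fun x hx => (this x hx).1).antisymm (allowed_mono fun x hx => (this x hx).2)

theorem run_congr {Bs Bs' : List (Set V)} (h : Bs.map (· ∩ X) = Bs'.map (· ∩ X)) {u v : V} :
    Run G X Bs u v ↔ Run G X Bs' u v := by
  induction Bs generalizing Bs' u with
  | nil =>
    cases Bs' with
    | nil => rfl
    | cons _ _ => simp at h
  | cons B Bs ih =>
    cases Bs' with
    | nil => simp at h
    | cons B' Bs' =>
      simp only [List.map_cons, List.cons.injEq] at h
      unfold Run Step
      rw [allowed_congr h.1]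
      simp only [ih h.2]

/-- A restriction matters only through its intersection with `X`, so each kind of visit is
equivalent to one of finitely many numbered tests. -/
theorem rich_of_bits {xs : ℕ → V} {x L q : ℕ} (hxs : ∀ i < x, ∀ j < x, xs i = xs j → i = j)
    (hX : ∀ y, y ∈ X ↔ ∃ j < x, xs j = y) {𝓗 : Set (Comp G X)}
    (h : ∀ T < 2 ^ ((L + 2) * x), ∀ D ∈ 𝓗, PassesBits G X xs x L T D →
      q < {D ∈ 𝓗 | PassesBits G X xs x L T D}.ncard) : Rich L q 𝓗 := by
  intro H hH z hz z' hz' Bs hlen hpass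
  -- Block `0` holds the entry vertex, blocks `1` to `L` the restrictions, block `L + 1` the exit
  -- vertex.
  obtain ⟨T, hT, hTb⟩ := exists_bitSet hxs hX
    (fun i => if i = 0 then {z} else if i = L + 1 then {z'} else Bs.getD (i - 1) ∅) (L + 2)
  have b0 : bitSet xs x T 0 = {z} := by
    rw [hTb 0 (by omega)]; simpa using hz
  have b1 : bitSet xs x T (L + 1) = {z'} := by
    rw [hTb _ (by omega)]; simpa using hz'
  have hmap : ((List.range L).map fun i => bitSet xs x T (i + 1)).map (· ∩ X)
      = Bs.map (· ∩ X) := by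
    apply List.ext_getElem
    · simp [hlen]
    · intro i h1 h2
      have hi : i < L := by simpa using h1
      have hi' : i < Bs.length := by omega
      simp only [List.map_map, List.getElem_map, List.getElem_range, Function.comp]
      rw [hTb _ (by omega)]
      simp [hi.ne, hi']
  have hiff : ∀ D : Comp G X, PassesBits G X xs x L T D ↔ Passes G X z Bs z' D := by
    intro D
    unfold PassesBits Passes
    rw [b0, b1]
    simp only [Set.mem_singleton_iff, forall_eq, run_congr hmap]
  have := h T hT H hH ((hiff H).2 hpass)
  simpa only [hiff] using this

theorem exists_enumeration [Finite V] [Nonempty V] (X : Set V) : ∃ xs : ℕ → V,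
    (∀ i < X.ncard, ∀ j < X.ncard, xs i = xs j → i = j) ∧
      ∀ y, y ∈ X ↔ ∃ j < X.ncard, xs j = y := by
  have x₀ : V := Classical.arbitrary V
  have e := Finite.equivFin X
  rw [Nat.card_coe_set_eq] at e
  refine ⟨fun i => if h : i < X.ncard then e.symm ⟨i, h⟩ else x₀, ?_, fun y => ⟨fun hy => ?_, ?_⟩⟩
  · intro i hi j hj hij
    simpa [hi, hj, Subtype.val_inj] using hij
  · exact ⟨e ⟨y, hy⟩, (e ⟨y, hy⟩).2, by simp⟩
  · rintro ⟨j, hj, rfl⟩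
    simp [hj]

end Filtering

/-! ### Deleting components down to the bound -/

section Kernel

variable {V : Type*} {G : SimpleGraph V} {X : Set V}

/-- Elimination may lose `q = 5xk` components for each of the `2 ^ ((L + 2) * x)` tests, where `L =
5xk + 1`. The stated bound has room for this because `5xk + 3 ≤ 2 * (5xk + 2)`. -/
theorem tests_le_compBound (x k : ℕ) :
    5 * x * k * 2 ^ ((5 * x * k + 1 + 2) * x) + 4 * k + 2 ≤ compBound x k := by
  unfold compBound
  have h1 : 2 ^ ((5 * x * k + 1 + 2) * x) ≤ (2 ^ x + 1) ^ (2 * (5 * x * k + 2)) := by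
    rw [mul_comm, pow_mul]
    calc (2 ^ x) ^ (5 * x * k + 1 + 2) ≤ (2 ^ x + 1) ^ (5 * x * k + 1 + 2) :=
          Nat.pow_le_pow_left (Nat.le_succ _) _
      _ ≤ _ := Nat.pow_le_pow_right (Nat.succ_pos _) (by omega)
  have := Nat.mul_le_mul_left (5 * x * k) h1
  omega

theorem exists_rich_subset [Finite V] {k : ℕ} {R : Set (Comp G X)}
    (hR : compBound X.ncard k < R.ncard) :
    ∃ 𝓗 ⊆ R, Rich (5 * X.ncard * k + 1) (5 * X.ncard * k) 𝓗 ∧ 4 * k + 2 < 𝓗.ncard := by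
  have hne : R.Nonempty := Set.nonempty_of_ncard_ne_zero (by omega)
  obtain ⟨C, -⟩ := hne
  have : Nonempty V := C.verts_nonempty.to_type
  obtain ⟨xs, hxs, hX⟩ := exists_enumeration X
  set L := 5 * X.ncard * k + 1 with hL
  obtain ⟨𝓗, hsub, hgood, hcard⟩ := exists_subset_of_tests
    (fun T => {D : Comp G X | T < 2 ^ ((L + 2) * X.ncard) ∧ PassesBits G X xs X.ncard L T D})
    (5 * X.ncard * k) (Finset.range (2 ^ ((L + 2) * X.ncard))) R
    (fun T hT a _ ha => hT (Finset.mem_range.2 ha.1))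
  refine ⟨𝓗, hsub, rich_of_bits hxs hX fun T hT D hD hpass => ?_, ?_⟩
  · simpa [hT] using hgood T D hD ⟨hT, hpass⟩
  · have := tests_le_compBound X.ncard k
    rw [Finset.card_range, hL] at hcard
    omega

theorem exists_removable_of_safe [Finite V] {Is It : Set V} {k : ℕ} (hIs : G.IsIndepSet Is)
    (hk : Is.ncard = k) (hk' : It.ncard = k) {𝓗 : Set (Comp G X)}
    (hsafe : Safe (5 * X.ncard * k) 𝓗) (hcard : 4 * k + 2 ≤ 𝓗.ncard) :
    ∃ C ∈ 𝓗, Removable G Is It C.verts := by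
  obtain ⟨C, hC, hfree⟩ := exists_free hk hk' (𝓗 := 𝓗) (by omega)
  exact ⟨C, hC, hsafe.rich.removable hIs hk hk' hC hfree⟩

theorem unionVerts_insert (𝓓 : Set (Comp G X)) (C : Comp G X) :
    unionVerts (insert C 𝓓) = unionVerts 𝓓 ∪ C.verts := by
  ext v
  simp [unionVerts, or_comm]

/-- While too many components remain, they contain a rich subcollection, and one of its token-free
members is added to the forbidden set. The induction is on the number of remaining components `R`.
-/
theorem exists_few_remaining [Finite V] {Is It : Set V} {k : ℕ} (hIs : G.IsIndepSet Is)
    (hk : Is.ncard = k) (hk' : It.ncard = k) (R : Set (Comp G X))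
    (hfree : Disjoint (unionVerts Rᶜ) (Is ∪ It))
    (hR : ReconfAvoiding G ∅ Is It → ReconfAvoiding G (unionVerts Rᶜ) Is It) :
    ∃ R' : Set (Comp G X), R'.ncard ≤ compBound X.ncard k ∧
      Disjoint (unionVerts R'ᶜ) (Is ∪ It) ∧
      (ReconfAvoiding G ∅ Is It → ReconfAvoiding G (unionVerts R'ᶜ) Is It) := by
  induction hn : R.ncard using Nat.strong_induction_on generalizing R with
  | _ n ih =>
    by_cases hle : R.ncard ≤ compBound X.ncard k
    · exact ⟨R, hle, hfree, hR⟩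
    · obtain ⟨𝓗, hsub, hrich, hcard⟩ := exists_rich_subset (not_le.1 hle)
      obtain ⟨C, hC, hCfree⟩ := exists_free hk hk' (𝓗 := 𝓗) (by omega)
      have hcompl : (R \ {C})ᶜ = insert C Rᶜ := by
        ext D
        by_cases hD : D = C <;> simp [hD]
      refine ih (R \ {C}).ncard ?_ (R \ {C}) ?_ ?_ rfl
      · rw [← hn]
        exact Set.ncard_sdiff_singleton_lt_of_mem (hsub hC) (Set.toFinite _)
      · rw [hcompl, unionVerts_insert]
        exact Set.disjoint_union_left.2 ⟨hfree, hCfree⟩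
      · rw [hcompl, unionVerts_insert]
        intro h
        -- The rich subcollection consists of remaining components, hence avoids everything
        -- forbidden so far.
        refine Rich.reconfAvoiding hIs hk hk' (hfree.mono_right Set.subset_union_left).symm ?_ hrich
          hC hCfree (hR h)
        intro D hD
        refine Set.disjoint_left.2 fun v hv => ?_
        rintro ⟨D', hD', hv'⟩
        exact hD' (Comp.eq_of_mem hv hv' ▸ hsub hD)

/-- Whole components are deleted, so each component of what is left is one of the undeleted
components; inclusion gives an injection into `R`. -/
theorem card_comp_induce_le [Finite V] (R : Set (Comp G X)) :
    Nat.card (Comp (G.induce (unionVerts Rᶜ)ᶜ)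
      (Subtype.val ⁻¹' X : Set ↥((unionVerts Rᶜ)ᶜ))) ≤ R.ncard := by
  set U := unionVerts Rᶜ with hU
  let φ : (G.induce Uᶜ).induce (Subtype.val ⁻¹' X : Set ↥(Uᶜ))ᶜ →g G.induce Xᶜ :=
    { toFun := fun v => ⟨v.1.1, v.2⟩, map_rel' := fun h => h }
  have hmem : ∀ D : Comp (G.induce Uᶜ) (Subtype.val ⁻¹' X : Set ↥(Uᶜ)), D.map φ ∈ R := by
    intro D
    obtain ⟨v, rfl⟩ := D.exists_rep
    by_contra h
    exact v.1.2 ⟨_, h, ⟨φ v, rfl, rfl⟩⟩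
  rw [← Nat.card_coe_set_eq]
  refine Nat.card_le_card_of_injective (fun D => (⟨D.map φ, hmem D⟩ : R)) ?_
  intro D E hDE
  simp only [Subtype.mk.injEq] at hDE
  obtain ⟨v, rfl⟩ := D.exists_rep
  obtain ⟨w, rfl⟩ := E.exists_rep
  have hvR := hmem ((G.induce Uᶜ).induce _ |>.connectedComponentMk v)
  have hreach : (G.induce Xᶜ).Reachable (φ v) (φ w) := SimpleGraph.ConnectedComponent.exact hDE
  refine SimpleGraph.ConnectedComponent.sound ?_
  rw [SimpleGraph.reachable_iff_reflTransGen] at hreach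
  -- A walk in `G - X` from a remaining vertex stays in its component and thus never meets the
  -- deleted set.
  have key : ∀ y : ↥(Xᶜ), Relation.ReflTransGen (G.induce Xᶜ).Adj (φ v) y →
      ∃ hy : y.1 ∉ U, ((G.induce Uᶜ).induce (Subtype.val ⁻¹' X : Set ↥(Uᶜ))ᶜ).Reachable v
        ⟨⟨y.1, hy⟩, y.2⟩ := by
    intro y hy
    induction hy with
    | refl => exact ⟨v.1.2, SimpleGraph.Reachable.refl _⟩
    | @tail b c hb hbc ih =>
      obtain ⟨hbU, hvb⟩ := ih
      have hc : c.1 ∉ U := by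
        rintro ⟨C, hC, hcC⟩
        rw [Comp.mem_verts_iff c.2] at hcC
        refine hC ?_
        rw [← hcC]
        have : (G.induce Xᶜ).connectedComponentMk c = (G.induce Xᶜ).connectedComponentMk (φ v) :=
          (SimpleGraph.ConnectedComponent.sound
            ((SimpleGraph.reachable_iff_reflTransGen _ _).2 (hb.tail hbc))).symm
        exact this ▸ hvR
      refine ⟨hc, hvb.trans (SimpleGraph.Adj.reachable ?_)⟩
      exact hbc
  obtain ⟨_, hvw⟩ := key _ hreach
  exact hvw

theorem exists_kernel [Finite V] {Is It : Set V} {k : ℕ} (hIs : G.IsIndepSet Is)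
    (hk : Is.ncard = k) (hk' : It.ncard = k) :
    ∃ (𝓓 : Set (Comp G X)) (U : Set V), U = ⋃ C ∈ 𝓓, C.verts ∧ Removable G Is It U ∧
      Nat.card (Comp (G.induce (Uᶜ)) (Subtype.val ⁻¹' X : Set ↥(Uᶜ))) ≤ compBound X.ncard k := by
  have h0 : unionVerts (Set.univ : Set (Comp G X))ᶜ = ∅ := by
    ext v
    simp [unionVerts]
  obtain ⟨R, hcard, hfree, hR⟩ := exists_few_remaining hIs hk hk' (Set.univ : Set (Comp G X))
    (by rw [h0]; exact Set.empty_disjoint _) (by rw [h0]; exact id)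
  refine ⟨Rᶜ, unionVerts Rᶜ, ?_, ?_, (card_comp_induce_le R).trans hcard⟩
  · ext v
    simp [unionVerts]
  · rw [removable_iff hfree]
    exact ⟨hR, fun h => h.mono (Set.empty_subset _)⟩

theorem compBound_le (x k : ℕ) (hx : 1 ≤ x) (hk : 1 ≤ k) :
    compBound x k ≤ 2 ^ (40 * (x ^ 2 * k)) := by
  have hkx : k ≤ x ^ 2 * k := Nat.le_mul_of_pos_left k (by positivity)
  have hxx : x * k ≤ x ^ 2 * k := Nat.mul_le_mul_right k (by nlinarith)
  have hx2 : x ≤ x ^ 2 * k := by nlinarith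
  have h1x : 1 ≤ x ^ 2 * k := hx.trans hx2
  unfold compBound
  have e1 : 5 * x * k ≤ 2 ^ (5 * (x ^ 2 * k)) :=
    (show 5 * x * k ≤ 5 * (x ^ 2 * k) by rw [mul_assoc]; omega).trans Nat.lt_two_pow_self.le
  -- The exponent `2x * 2(5xk + 2)` equals `20x²k + 8x`, which is at most `28x²k`.
  have e2 : (2 ^ x + 1) ^ (2 * (5 * x * k + 2)) ≤ 2 ^ (28 * (x ^ 2 * k)) := by
    have : 2 ^ x + 1 ≤ 2 ^ (2 * x) := by
      have h1 : 2 ^ 1 ≤ 2 ^ x := Nat.pow_le_pow_right (by norm_num) hx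
      rw [two_mul, pow_add]
      nlinarith
    calc (2 ^ x + 1) ^ (2 * (5 * x * k + 2)) ≤ (2 ^ (2 * x)) ^ (2 * (5 * x * k + 2)) :=
          Nat.pow_le_pow_left this _
      _ = 2 ^ (2 * x * (2 * (5 * x * k + 2))) := (pow_mul _ _ _).symm
      _ ≤ _ := Nat.pow_le_pow_right (by norm_num) (by nlinarith)
  have e3 : 4 * k + 2 ≤ 2 ^ (6 * (x ^ 2 * k)) :=
    (show 4 * k + 2 ≤ 6 * (x ^ 2 * k) by omega).trans Nat.lt_two_pow_self.le
  calc 5 * x * k * (2 ^ x + 1) ^ (2 * (5 * x * k + 2)) + 4 * k + 2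
      ≤ 2 ^ (5 * (x ^ 2 * k)) * 2 ^ (28 * (x ^ 2 * k)) + 2 ^ (6 * (x ^ 2 * k)) := by
        have := Nat.mul_le_mul e1 e2
        omega
    _ ≤ 2 ^ (33 * (x ^ 2 * k)) + 2 ^ (33 * (x ^ 2 * k)) := by
        rw [← pow_add, ← add_mul]
        exact Nat.add_le_add_left (Nat.pow_le_pow_right (by norm_num) (by omega)) _
    _ = 2 ^ (33 * (x ^ 2 * k) + 1) := by rw [pow_succ]; omega
    _ ≤ _ := Nat.pow_le_pow_right (by norm_num) (by omega)

end Kernel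

/-! ### Verification rules for random access programs -/

section Programs

theorem Store.write_self (σ : Store) (a i x : ℕ) : σ.write a i x a = Function.update (σ a) i x := by
  funext j
  simp [Store.write, Function.update_apply]

theorem Store.write_of_ne (σ : Store) {a b : ℕ} (i x : ℕ) (h : b ≠ a) : σ.write a i x b = σ b := by
  funext j
  simp [Store.write, h]

/-- Whether the program contains an assignment to the array `b`. -/
def Prog.writes : Prog → ℕ → Bool
  | .skip, _ => false
  | .assign a _ _, b => a == b
  | .seq p q, b => p.writes b || q.writes b
  | .ite _ p q, b => p.writes b || q.writes b
  | .loop _ p, b => p.writes b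

/-- Whether an array survives a program is settled by evaluating `Prog.writes`; the later proofs do
this with `rfl` or `decide`. -/
theorem Exec.frame {p : Prog} {σ τ : Store} {t : ℕ} (h : Exec p σ τ t) {b : ℕ}
    (hb : p.writes b = false) : τ b = σ b := by
  induction h with
  | skip => rfl
  | assign σ a i e =>
    simp only [Prog.writes, beq_eq_false_iff_ne, ne_eq] at hb
    exact Store.write_of_ne _ _ _ (Ne.symm hb)
  | seq _ _ ih1 ih2 =>
    simp only [Prog.writes, Bool.or_eq_false_iff] at hb
    rw [ih2 hb.2, ih1 hb.1]
  | ite_true _ _ ih =>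
    simp only [Prog.writes, Bool.or_eq_false_iff] at hb
    exact ih hb.1
  | ite_false _ _ ih =>
    simp only [Prog.writes, Bool.or_eq_false_iff] at hb
    exact ih hb.2
  | loop_done => rfl
  | loop_step _ _ _ ih1 ih2 => rw [ih2 hb, ih1 hb]

/-- Started in `σ`, the program `p` halts within `T` steps in a store that satisfies `Q`. -/
def Ends (p : Prog) (σ : Store) (T : ℕ) (Q : Store → Prop) : Prop :=
  ∃ τ t, Exec p σ τ t ∧ t ≤ T ∧ Q τ

theorem Ends.conseq {p : Prog} {σ : Store} {T T' : ℕ} {Q Q' : Store → Prop} (h : Ends p σ T Q)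
    (hT : T ≤ T') (hQ : ∀ τ, (∀ a, p.writes a = false → τ a = σ a) → Q τ → Q' τ) :
    Ends p σ T' Q' := by
  obtain ⟨τ, t, h1, h2, h3⟩ := h
  exact ⟨τ, t, h1, h2.trans hT, hQ τ (fun a ha => h1.frame ha) h3⟩

theorem Ends.skip {σ : Store} {T : ℕ} {Q : Store → Prop} (hT : 1 ≤ T) (h : Q σ) :
    Ends .skip σ T Q :=
  ⟨σ, 1, .skip σ, hT, h⟩

theorem Ends.assign {σ : Store} {T a : ℕ} {i e : Expr} {Q : Store → Prop}
    (hT : i.cost + e.cost + 1 ≤ T) (h : Q (σ.write a (i.eval σ) (e.eval σ))) :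
    Ends (.assign a i e) σ T Q :=
  ⟨_, _, .assign σ a i e, hT, h⟩

theorem Ends.seq {p q : Prog} {σ : Store} {T T₁ T₂ : ℕ} {Q R : Store → Prop}
    (hp : Ends p σ T₁ R)
    (hq : ∀ τ, (∀ a, p.writes a = false → τ a = σ a) → R τ → Ends q τ T₂ Q)
    (hT : T₁ + T₂ ≤ T) : Ends (.seq p q) σ T Q := by
  obtain ⟨τ, s, h1, h2, h3⟩ := hp
  obtain ⟨ρ, t, h4, h5, h6⟩ := hq τ (fun a ha => h1.frame ha) h3
  exact ⟨ρ, s + t, .seq h1 h4, by omega, h6⟩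

theorem Ends.ite {e : Expr} {p q : Prog} {σ : Store} {T T' : ℕ} {Q : Store → Prop}
    (hT : e.cost + T' + 1 ≤ T) (h1 : e.eval σ ≠ 0 → Ends p σ T' Q)
    (h2 : e.eval σ = 0 → Ends q σ T' Q) : Ends (.ite e p q) σ T Q := by
  by_cases h : e.eval σ = 0
  · obtain ⟨τ, t, h3, h4, h5⟩ := h2 h
    exact ⟨τ, _, .ite_false h h3, by omega, h5⟩
  · obtain ⟨τ, t, h3, h4, h5⟩ := h1 h
    exact ⟨τ, _, .ite_true h h3, by omega, h5⟩

/-- The scalar stored in array `a`. -/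
def scalar (a : ℕ) : Expr :=
  .get a (.lit 0)

/-- Execute `p` for all values of the counter `cnt` below the value of `e`. -/
def forLoop (cnt : ℕ) (e : Expr) (p : Prog) : Prog :=
  .seq (.assign cnt (.lit 0) (.lit 0))
    (.loop (.sub e (scalar cnt)) (.seq p (.assign cnt (.lit 0) (.add (scalar cnt) (.lit 1)))))

/-- The bound `e` is evaluated anew before every pass, so `he` asks for its value in all stores that
may occur. The counter is increased after the body, so `hI` asks that the invariant does not see it.
The extra `20` per pass pays for test and increment. -/
theorem Ends.for {cnt : ℕ} {e : Expr} {p : Prog} {σ : Store} {N T T' : ℕ} (I : ℕ → Store → Prop)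
    (hcnt : p.writes cnt = false)
    (hI : ∀ j τ τ', (∀ a, a ≠ cnt → τ' a = τ a) → I j τ → I j τ')
    (hec : e.cost ≤ 10)
    (he : ∀ τ, (∀ a, a ≠ cnt → p.writes a = false → τ a = σ a) → e.eval τ = N)
    (h0 : I 0 σ)
    (hstep : ∀ j < N, ∀ τ, (∀ a, a ≠ cnt → p.writes a = false → τ a = σ a) → τ cnt 0 = j →
      I j τ → Ends p τ T (I (j + 1)))
    (hT : N * (T + 20) + 20 ≤ T') :
    Ends (forLoop cnt e p) σ T' (I N) := by
  -- Here `d` is the number of passes still to come.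
  have main : ∀ d j τ, j + d = N → (∀ a, a ≠ cnt → p.writes a = false → τ a = σ a) →
      τ cnt 0 = j → I j τ →
      Ends (.loop (.sub e (scalar cnt))
        (.seq p (.assign cnt (.lit 0) (.add (scalar cnt) (.lit 1))))) τ (d * (T + 20) + 15)
        (I N) := by
    intro d
    induction d with
    | zero =>
      intro j τ hj hf hc hIj
      have : (Expr.sub e (scalar cnt)).eval τ = 0 := by
        simp only [Expr.eval, scalar, he τ hf, hc]; omega
      refine ⟨τ, _, .loop_done this, ?_, ?_⟩
      · simp only [Expr.cost, scalar]; omega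
      · obtain rfl : j = N := by omega
        exact hIj
    | succ d ih =>
      intro j τ hj hf hc hIj
      obtain ⟨τ₁, t₁, h1, h2, h3⟩ := hstep j (by omega) τ hf hc hIj
      have hc1 : τ₁ cnt 0 = j := by rw [h1.frame hcnt, hc]
      obtain ⟨τ₂, t₂, h4, h5, h6⟩ := ih (j + 1) (τ₁.write cnt 0 (j + 1)) (by omega)
        (fun a ha hpa => by rw [Store.write_of_ne _ _ _ ha, h1.frame hpa, hf a ha hpa])
        (by rw [Store.write_self]; simp)
        (hI _ _ _ (fun a ha => Store.write_of_ne _ _ _ ha) h3)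
      have hne : (Expr.sub e (scalar cnt)).eval τ ≠ 0 := by
        simp only [Expr.eval, scalar, he τ hf, hc]; omega
      have hass := Exec.assign τ₁ cnt (.lit 0) (.add (scalar cnt) (.lit 1))
      simp only [Expr.eval, scalar, hc1] at hass
      refine ⟨τ₂, _, .loop_step hne (.seq h1 hass) h4, ?_, h6⟩
      simp only [Expr.cost, scalar]
      rw [Nat.succ_mul]
      omega
  obtain ⟨τ, t, h1, h2, h3⟩ := main N 0 (σ.write cnt 0 0) (by omega)
    (fun a ha _ => Store.write_of_ne _ _ _ ha) (by rw [Store.write_self]; simp)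
    (hI _ _ _ (fun a ha => Store.write_of_ne _ _ _ ha) h0)
  refine ⟨τ, _, .seq (Exec.assign σ cnt (.lit 0) (.lit 0)) h1, ?_, h3⟩
  simp only [Expr.cost]
  omega

/-- The rule for loops whose invariant concerns a single array `A`. -/
theorem Ends.for_array {cnt A : ℕ} {e : Expr} {p : Prog} {σ : Store} {N T T' : ℕ}
    (I : ℕ → (ℕ → ℕ) → Prop) (hA : A ≠ cnt) (hcnt : p.writes cnt = false) (hec : e.cost ≤ 10)
    (he : ∀ τ, (∀ a, a ≠ cnt → p.writes a = false → τ a = σ a) → e.eval τ = N)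
    (h0 : I 0 (σ A))
    (hstep : ∀ j < N, ∀ τ, (∀ a, a ≠ cnt → p.writes a = false → τ a = σ a) → τ cnt 0 = j →
      I j (τ A) → Ends p τ T (fun ρ => I (j + 1) (ρ A)))
    (hT : N * (T + 20) + 20 ≤ T') :
    Ends (forLoop cnt e p) σ T' (fun τ => I N (τ A)) :=
  Ends.for (fun j τ => I j (τ A)) hcnt (fun j τ τ' h => by rw [h A hA]; exact id) hec he h0 hstep hT

/-- The rule for loops whose invariant concerns two arrays `A` and `B`. -/
theorem Ends.for_arrays {cnt A B : ℕ} {e : Expr} {p : Prog} {σ : Store} {N T T' : ℕ}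
    (I : ℕ → (ℕ → ℕ) → (ℕ → ℕ) → Prop) (hA : A ≠ cnt) (hB : B ≠ cnt) (hcnt : p.writes cnt = false)
    (hec : e.cost ≤ 10)
    (he : ∀ τ, (∀ a, a ≠ cnt → p.writes a = false → τ a = σ a) → e.eval τ = N)
    (h0 : I 0 (σ A) (σ B))
    (hstep : ∀ j < N, ∀ τ, (∀ a, a ≠ cnt → p.writes a = false → τ a = σ a) → τ cnt 0 = j →
      I j (τ A) (τ B) → Ends p τ T (fun ρ => I (j + 1) (ρ A) (ρ B)))
    (hT : N * (T + 20) + 20 ≤ T') :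
    Ends (forLoop cnt e p) σ T' (fun τ => I N (τ A) (τ B)) :=
  Ends.for (fun j τ => I j (τ A) (τ B)) hcnt (fun j τ τ' h => by rw [h A hA, h B hB]; exact id) hec
    he h0 hstep hT

end Programs

/-! ### Auxiliary tables and closure under adjacency -/

section Instances

/-- The facts about the input and the auxiliary tables on which the algorithm relies. -/
structure Setup {n : ℕ} (G : SimpleGraph (Fin n)) (X S : Set (Fin n)) (x q : ℕ) (xs : ℕ → Fin n)
    (σ : Store) : Prop where
  size : σ 0 0 = n
  adj : ∀ u v : Fin n, σ 1 (σ 6 u + v) ≠ 0 ↔ G.Adj u v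
  adj_le : ∀ i, σ 1 i ≤ 1
  mem : ∀ v : Fin n, σ 2 v ≠ 0 ↔ v ∈ X
  token : ∀ v : Fin n, σ 3 v + σ 4 v ≠ 0 ↔ v ∈ S
  card : σ 7 0 = x
  list : ∀ j < x, σ 8 j = xs j
  threshold : σ 9 0 = q
  bits : σ 10 0 = (q + 3) * x
  tests : σ 11 0 = 2 ^ ((q + 3) * x)
  half : ∀ i ≤ 2 ^ ((q + 3) * x), σ 12 i = i / 2
  parity : ∀ i ≤ 2 ^ ((q + 3) * x), σ 13 i = i % 2

variable {n : ℕ} {G : SimpleGraph (Fin n)} {X S : Set (Fin n)} {x q : ℕ} {xs : ℕ → Fin n}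

theorem Setup.congr {σ τ : Store} (h : Setup G X S x q xs σ) (hτ : ∀ a < 16, τ a = σ a) :
    Setup G X S x q xs τ := by
  constructor
  all_goals
    first
    | rw [hτ 0 (by norm_num)] | rw [hτ 1 (by norm_num)] | rw [hτ 2 (by norm_num)]
    | rw [hτ 3 (by norm_num)] | rw [hτ 7 (by norm_num)] | rw [hτ 8 (by norm_num)]
    | rw [hτ 9 (by norm_num)] | rw [hτ 10 (by norm_num)] | rw [hτ 11 (by norm_num)]
    | rw [hτ 12 (by norm_num)] | rw [hτ 13 (by norm_num)]
  · exact h.size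
  · rw [hτ 6 (by norm_num)]; exact h.adj
  · exact h.adj_le
  · exact h.mem
  · rw [hτ 4 (by norm_num)]; exact h.token
  · exact h.card
  · exact h.list
  · exact h.threshold
  · exact h.bits
  · exact h.tests
  · exact h.half
  · exact h.parity

/-- The set of vertices at which the array `A` is nonzero. -/
def supp (n : ℕ) (A : ℕ → ℕ) : Set (Fin n) :=
  {v | A v ≠ 0}

/-- The vertices reachable from `S` through vertices of `O`. -/
def closureIn (G : SimpleGraph (Fin n)) (S O : Set (Fin n)) : Set (Fin n) :=
  {v | ∃ u ∈ S, Relation.ReflTransGen (fun a b => G.Adj a b ∧ b ∈ O) u v}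

theorem supp_update {A : ℕ → ℕ} {i x : ℕ} (v : Fin n) :
    v ∈ supp n (Function.update A i x) ↔ if (v : ℕ) = i then x ≠ 0 else v ∈ supp n A := by
  unfold supp
  by_cases h : (v : ℕ) = i <;> simp [h]

/-- Close the set in array `16` under adjacency within the set in array `17`. -/
def closeProg : Prog :=
  forLoop 18 (scalar 0) (forLoop 19 (scalar 0) (forLoop 20 (scalar 0)
    (.ite (.get 16 (scalar 19))
      (.ite (.get 1 (.add (.get 6 (scalar 19)) (scalar 20)))
        (.ite (.get 17 (scalar 20)) (.assign 16 (scalar 20) (.lit 1)) .skip) .skip) .skip)))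

/-- The set grows during the pass and newly added vertices may be expanded too. So the result is
only bounded: it contains all neighbours in `O` of the old set and stays inside the closure. -/
theorem ends_close_pass {σ : Store} (hσ : Setup G X S x q xs σ) :
    Ends (forLoop 19 (scalar 0) (forLoop 20 (scalar 0)
      (.ite (.get 16 (scalar 19))
        (.ite (.get 1 (.add (.get 6 (scalar 19)) (scalar 20)))
          (.ite (.get 17 (scalar 20)) (.assign 16 (scalar 20) (.lit 1)) .skip) .skip) .skip)))
      σ (n * (n * 50 + 40) + 20)
      (fun τ => supp n (σ 16) ⊆ supp n (τ 16) ∧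
        supp n (τ 16) ⊆ closureIn G (supp n (σ 16)) (supp n (σ 17)) ∧
        ∀ u ∈ supp n (σ 16), ∀ v ∈ supp n (σ 17), G.Adj u v → v ∈ supp n (τ 16)) := by
  set S₀ := supp n (σ 16) with hS₀
  set O := supp n (σ 17) with hO
  have key := Ends.for_array (cnt := 19) (A := 16) (e := scalar 0) (N := n) (σ := σ)
    (T := n * 50 + 20) (T' := n * (n * 50 + 40) + 20)
    (p := forLoop 20 (scalar 0)
      (.ite (.get 16 (scalar 19))
        (.ite (.get 1 (.add (.get 6 (scalar 19)) (scalar 20)))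
          (.ite (.get 17 (scalar 20)) (.assign 16 (scalar 20) (.lit 1)) .skip) .skip) .skip))
    (fun j A => S₀ ⊆ supp n A ∧ supp n A ⊆ closureIn G S₀ O ∧
      ∀ u : Fin n, (u : ℕ) < j → u ∈ S₀ → ∀ v ∈ O, G.Adj u v → v ∈ supp n A)
    (by decide) rfl (by decide) (fun τ hτ => ?_)
    ⟨subset_rfl, fun v hv => ⟨v, hv, .refl⟩, fun u hu => absurd hu (Nat.not_lt_zero _)⟩ ?_ le_rfl
  · exact key.conseq le_rfl fun τ _ h => ⟨h.1, h.2.1, fun u hu => h.2.2 u u.2 hu⟩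
  · rw [scalar, Expr.eval, Expr.eval, hτ 0 (by decide) rfl, hσ.size]
  intro j hj τ hτ hcnt hinv
  have key2 := Ends.for_array (cnt := 20) (A := 16) (e := scalar 0) (N := n) (σ := τ)
    (T := 30) (T' := n * 50 + 20)
    (p := (.ite (.get 16 (scalar 19))
        (.ite (.get 1 (.add (.get 6 (scalar 19)) (scalar 20)))
          (.ite (.get 17 (scalar 20)) (.assign 16 (scalar 20) (.lit 1)) .skip) .skip) .skip))
    (fun i A => S₀ ⊆ supp n A ∧ supp n A ⊆ closureIn G S₀ O ∧
      (∀ u : Fin n, (u : ℕ) < j → u ∈ S₀ → ∀ v ∈ O, G.Adj u v → v ∈ supp n A) ∧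
      (⟨j, hj⟩ ∈ S₀ → ∀ v : Fin n, (v : ℕ) < i → v ∈ O → G.Adj ⟨j, hj⟩ v → v ∈ supp n A))
    (by decide) rfl (by decide) (fun ρ hρ => ?_)
    ⟨hinv.1, hinv.2.1, hinv.2.2, fun _ v hv => absurd hv (Nat.not_lt_zero _)⟩ ?_ le_rfl
  · refine key2.conseq le_rfl fun ρ _ h => ⟨h.1, h.2.1, fun u hu huS v hv huv => ?_⟩
    rcases Nat.lt_succ_iff_lt_or_eq.1 hu with h' | h'
    · exact h.2.2.1 u h' huS v hv huv
    · obtain rfl : u = ⟨j, hj⟩ := Fin.ext h'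
      exact h.2.2.2 huS v v.2 hv huv
  · rw [scalar, Expr.eval, Expr.eval, hρ 0 (by decide) rfl, hτ 0 (by decide) rfl, hσ.size]
  rintro i hi ρ hρ hcnt2 ⟨h1, h2, h3, h4⟩
  have e19 : ρ 19 0 = j := by rw [hρ 19 (by decide) rfl, hcnt]
  have e1 : ρ 1 = σ 1 := by rw [hρ 1 (by decide) rfl, hτ 1 (by decide) rfl]
  have e6 : ρ 6 = σ 6 := by rw [hρ 6 (by decide) rfl, hτ 6 (by decide) rfl]
  have e17 : ρ 17 = σ 17 := by rw [hρ 17 (by decide) rfl, hτ 17 (by decide) rfl]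
  have hadj := hσ.adj ⟨j, hj⟩ ⟨i, hi⟩
  have skipCase : ¬ (⟨j, hj⟩ ∈ S₀ ∧ ⟨i, hi⟩ ∈ O ∧ G.Adj ⟨j, hj⟩ ⟨i, hi⟩) →
      (S₀ ⊆ supp n (ρ 16) ∧ supp n (ρ 16) ⊆ closureIn G S₀ O ∧
      (∀ u : Fin n, (u : ℕ) < j → u ∈ S₀ → ∀ v ∈ O, G.Adj u v → v ∈ supp n (ρ 16)) ∧
      (⟨j, hj⟩ ∈ S₀ → ∀ v : Fin n, (v : ℕ) < i + 1 → v ∈ O → G.Adj ⟨j, hj⟩ v →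
        v ∈ supp n (ρ 16))) := by
    intro hno
    refine ⟨h1, h2, h3, fun hjS v hv hvO hjv => ?_⟩
    rcases Nat.lt_succ_iff_lt_or_eq.1 hv with h' | h'
    · exact h4 hjS v h' hvO hjv
    · obtain rfl : v = ⟨i, hi⟩ := Fin.ext h'
      exact absurd ⟨hjS, hvO, hjv⟩ hno
  refine Ends.ite (T' := 25) (by decide) (fun c1 => ?_) (fun c1 => Ends.skip (by norm_num) ?_)
  swap
  · refine skipCase fun h => ?_
    simp only [Expr.eval, scalar, e19] at c1
    exact absurd c1 (h1 h.1)
  refine Ends.ite (T' := 15) (by decide) (fun c2 => ?_) (fun c2 => Ends.skip (by norm_num) ?_)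
  swap
  · refine skipCase fun h => ?_
    simp only [Expr.eval, scalar, e19, e1, e6, hcnt2] at c2
    exact absurd c2 (hadj.2 h.2.2)
  refine Ends.ite (T' := 5) (by decide) (fun c3 => ?_) (fun c3 => Ends.skip (by norm_num) ?_)
  swap
  · refine skipCase fun h => ?_
    simp only [Expr.eval, scalar, e17, hcnt2] at c3
    exact absurd c3 h.2.1
  simp only [Expr.eval, scalar, e19, e1, e6, hcnt2, e17] at c1 c2 c3
  refine Ends.assign (by decide) ?_
  simp only [Expr.eval, scalar, hcnt2, Store.write_self]
  have hins : ∀ v : Fin n, v ∈ supp n (Function.update (ρ 16) i 1) ↔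
      (v = ⟨i, hi⟩ ∨ v ∈ supp n (ρ 16)) := by
    intro v
    rw [supp_update]
    by_cases h : (v : ℕ) = i
    · simp [h, Fin.ext_iff]
    · simp [h, Fin.ext_iff]
  refine ⟨fun v hv => (hins v).2 (Or.inr (h1 hv)), fun v hv => ?_,
    fun u hu huS v hv huv => (hins v).2 (Or.inr (h3 u hu huS v hv huv)), fun hjS v hv hvO hjv => ?_⟩
  · rcases (hins v).1 hv with rfl | hv
    · obtain ⟨u, hu, huj⟩ := h2 (show (⟨j, hj⟩ : Fin n) ∈ supp n (ρ 16) from c1)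
      exact ⟨u, hu, huj.tail ⟨hadj.1 c2, c3⟩⟩
    · exact h2 hv
  · rcases Nat.lt_succ_iff_lt_or_eq.1 hv with h' | h'
    · exact (hins v).2 (Or.inr (h4 hjS v h' hvO hjv))
    · exact (hins v).2 (Or.inl (Fin.ext h'))

theorem closureIn_closureIn {S S' O : Set (Fin n)} (h : S' ⊆ closureIn G S O) :
    closureIn G S' O ⊆ closureIn G S O := by
  rintro v ⟨u, hu, huv⟩
  obtain ⟨w, hw, hwu⟩ := h hu
  exact ⟨w, hw, hwu.trans huv⟩

theorem closureIn_subset {S S' O : Set (Fin n)} (h : S ⊆ S')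
    (hcl : ∀ u ∈ S', ∀ v ∈ O, G.Adj u v → v ∈ S') : closureIn G S O ⊆ S' := by
  rintro v ⟨u, hu, huv⟩
  induction huv with
  | refl => exact h hu
  | tail _ hs ih => exact hcl _ ih _ hs.2 hs.1

/-- A bound for the running time of `closeProg`. -/
def closeTime (n : ℕ) : ℕ :=
  n * (n * (n * 50 + 40) + 40) + 20

/-- A pass over a set that is not closed adds a vertex. After `n` passes the set is therefore closed
or contains all `n` vertices, and then it is closed as well. -/
theorem ends_close {σ : Store} (hσ : Setup G X S x q xs σ) :
    Ends closeProg σ (closeTime n)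
      (fun τ => supp n (τ 16) = closureIn G (supp n (σ 16)) (supp n (σ 17))) := by
  set S₀ := supp n (σ 16) with hS₀
  set O := supp n (σ 17) with hO
  have key := Ends.for_array (cnt := 18) (A := 16) (e := scalar 0) (N := n) (σ := σ)
    (T := n * (n * 50 + 40) + 20) (T' := closeTime n)
    (p := forLoop 19 (scalar 0) (forLoop 20 (scalar 0)
      (.ite (.get 16 (scalar 19))
        (.ite (.get 1 (.add (.get 6 (scalar 19)) (scalar 20)))
          (.ite (.get 17 (scalar 20)) (.assign 16 (scalar 20) (.lit 1)) .skip) .skip) .skip)))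
    (fun j A => S₀ ⊆ supp n A ∧ supp n A ⊆ closureIn G S₀ O ∧
      ((∀ u ∈ supp n A, ∀ v ∈ O, G.Adj u v → v ∈ supp n A) ∨ j ≤ (supp n A).ncard))
    (by decide) rfl (by decide) (fun τ hτ => ?_)
    ⟨subset_rfl, fun v hv => ⟨v, hv, .refl⟩, Or.inr (Nat.zero_le _)⟩ ?_ le_rfl
  · refine key.conseq le_rfl fun τ _ h => h.2.1.antisymm (closureIn_subset h.1 ?_)
    rcases h.2.2 with h' | h'
    · exact h'
    · have huniv : supp n (τ 16) = Set.univ := by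
        apply Set.eq_of_subset_of_ncard_le (Set.subset_univ _) _ (Set.toFinite _)
        rw [Set.ncard_univ, Nat.card_eq_fintype_card, Fintype.card_fin]
        exact h'
      intro u _ v _ _
      rw [huniv]; trivial
  · rw [scalar, Expr.eval, Expr.eval, hτ 0 (by decide) rfl, hσ.size]
  rintro j hj τ hτ hcnt ⟨h1, h2, h3⟩
  have hτσ : Setup G X S x q xs τ := hσ.congr fun a ha => hτ a (by omega) (by
    revert ha; revert a; decide)
  have e17 : supp n (τ 17) = O := by rw [hτ 17 (by decide) rfl]
  refine (ends_close_pass hτσ).conseq le_rfl fun ρ _ ⟨g1, g2, g3⟩ => ?_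
  rw [e17] at g2 g3
  refine ⟨h1.trans g1, g2.trans (closureIn_closureIn h2), ?_⟩
  by_cases hcl : ∀ u ∈ supp n (τ 16), ∀ v ∈ O, G.Adj u v → v ∈ supp n (τ 16)
  · have heq : supp n (ρ 16) = supp n (τ 16) :=
      (g2.trans (closureIn_subset subset_rfl hcl)).antisymm g1
    rw [heq]
    exact Or.inl hcl
  · have hle := h3.resolve_left hcl
    push Not at hcl
    obtain ⟨u, hu, v, hv, huv, hnot⟩ := hcl
    right
    have : supp n (τ 16) ⊂ supp n (ρ 16) := ⟨g1, fun h => hnot (h (g3 u hu v hv huv))⟩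
    have := Set.ncard_lt_ncard this (Set.toFinite _)
    omega

end Instances

/-! ### Deciding a test by alternating masks and closures -/

section TestEvaluation

variable {n : ℕ} {G : SimpleGraph (Fin n)} {X S : Set (Fin n)} {x q : ℕ} {xs : ℕ → Fin n}

/-- Set the flag `26` to `1` if `e` vanishes for all values of the counter `27` below `|X|`, and to
`0` otherwise. -/
def checkProg (e : Expr) : Prog :=
  .seq (.assign 26 (.lit 0) (.lit 1))
    (forLoop 27 (scalar 7) (.ite e (.assign 26 (.lit 0) (.lit 0)) .skip))

theorem ends_check {σ : Store} (hσ : Setup G X S x q xs σ) {e : Expr} (he : e.cost ≤ 30)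
    {P : ℕ → Prop} (hP : ∀ j < x, ∀ τ : Store, (∀ a, a ≠ 26 → a ≠ 27 → τ a = σ a) → τ 27 0 = j →
      (e.eval τ = 0 ↔ P j)) :
    Ends (checkProg e) σ (x * 60 + 30) (fun τ => τ 26 0 ≠ 0 ↔ ∀ j < x, P j) := by
  refine Ends.seq (T₁ := 3) (T₂ := x * 60 + 20) (R := fun τ => τ 26 0 ≠ 0)
    (Ends.assign (by decide) (by simp [Store.write_self, Expr.eval])) (fun τ hτ h26 => ?_) (by omega)
  refine Ends.for_array (A := 26) (N := x) (T := 40)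
    (fun j A => A 0 ≠ 0 ↔ ∀ i < j, P i) (by decide) rfl (by decide) (fun ρ hρ => ?_)
    (by simpa using h26) ?_ (by omega)
  · rw [scalar, Expr.eval, Expr.eval, hρ 7 (by decide) rfl, hτ 7 rfl, hσ.card]
  intro j hj ρ hρ hc hI
  have hPj := hP j hj ρ (fun a h1 h2 => by
    have : (26 == a) = false := by simpa using Ne.symm h1
    rw [hρ a h2 (by simp [Prog.writes, this]), hτ a (by simpa [Prog.writes] using this)]) hc
  refine Ends.ite (T' := 5) (by omega) (fun c => ?_) (fun c => Ends.skip (by norm_num) ?_)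
  · refine Ends.assign (by decide) ?_
    rw [Store.write_self]
    simp only [Expr.eval, Function.update_self, ne_eq, not_true_eq_false, false_iff]
    intro h
    exact c (hPj.2 (h j (by omega)))
  · rw [hI]
    refine ⟨fun h i hi => ?_, fun h i hi => h i (by omega)⟩
    rcases Nat.lt_succ_iff_lt_or_eq.1 hi with h' | rfl
    · exact h i h'
    · exact hPj.1 c

/-- The difference of the bit for the current element of `X` and the adjacency of the current
vertex to that element. -/
def bitMinusAdj : Expr :=
  .sub (.get 21 (.add (scalar 24) (scalar 27))) (.get 1 (.add (.get 6 (scalar 25)) (.get 8 (scalar 27))))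

/-- The difference with the roles of bit and adjacency exchanged. -/
def adjMinusBit : Expr :=
  .sub (.get 1 (.add (.get 6 (scalar 25)) (.get 8 (scalar 27)))) (.get 21 (.add (scalar 24) (scalar 27)))

/-- Array `21` holds the bits of the test number `T`, and array `24` the offset of block `b`. -/
structure BlockState (x q T b : ℕ) (σ : Store) : Prop where
  bits : ∀ i < (q + 3) * x, σ 21 i = T / 2 ^ i % 2
  offset : σ 24 0 = b * x
  lt : b < q + 3

theorem BlockState.congr {T b : ℕ} {σ τ : Store} (h : BlockState x q T b σ) (h1 : τ 21 = σ 21)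
    (h2 : τ 24 = σ 24) : BlockState x q T b τ :=
  ⟨by rw [h1]; exact h.bits, by rw [h2]; exact h.offset, h.lt⟩

theorem BlockState.bit {T b : ℕ} {σ : Store} (h : BlockState x q T b σ) {j : ℕ} (hj : j < x) :
    σ 21 (b * x + j) ≤ 1 ∧ (σ 21 (b * x + j) ≠ 0 ↔ T.testBit (b * x + j) = true) := by
  have hlt : b * x + j < (q + 3) * x := by
    have := Nat.mul_le_mul_right x (show b + 1 ≤ q + 3 from h.lt)
    rw [Nat.succ_mul] at this
    omega
  rw [h.bits _ hlt, Nat.testBit_eq_decide_div_mod_eq, decide_eq_true_eq]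
  omega

/-- For values at most `1` a truncated difference vanishes exactly when the first value implies the
second; this is the use of `adj_le`. -/
theorem ends_check_sup {σ : Store} (hσ : Setup G X S x q xs σ) {T b : ℕ}
    (hb : BlockState x q T b σ) {v : Fin n} (hv : σ 25 0 = v) :
    Ends (checkProg bitMinusAdj) σ (x * 60 + 30)
      (fun τ => τ 26 0 ≠ 0 ↔ ∀ y ∈ bitSet xs x T b, G.Adj v y) := by
  refine (ends_check hσ (by decide)
    (P := fun j => T.testBit (b * x + j) = true → G.Adj v (xs j)) ?_).conseq le_rfl
    fun τ _ h => h.trans ⟨?_, ?_⟩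
  · intro j hj τ hτ hc
    have h1 := (hb.bit hj)
    have h2 := hσ.adj v (xs j)
    have h3 := hσ.adj_le (σ 6 v + xs j)
    simp only [bitMinusAdj, Expr.eval, scalar, hc, hτ 24 (by decide) (by decide),
      hτ 25 (by decide) (by decide), hτ 21 (by decide) (by decide), hτ 1 (by decide) (by decide),
      hτ 6 (by decide) (by decide), hτ 8 (by decide) (by decide), hb.offset, hv, hσ.list j hj]
    rw [← h1.2, ← h2]
    omega
  · rintro h y ⟨j, hj, rfl, hbit⟩
    exact h j hj hbit
  · intro h j hj hbit
    exact h _ ⟨j, hj, rfl, hbit⟩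

theorem ends_check_sub (hxs : ∀ i < x, ∀ j < x, xs i = xs j → i = j)
    (hX : ∀ y, y ∈ X ↔ ∃ j < x, xs j = y) {σ : Store} (hσ : Setup G X S x q xs σ) {T b : ℕ}
    (hb : BlockState x q T b σ) {v : Fin n} (hv : σ 25 0 = v) :
    Ends (checkProg adjMinusBit) σ (x * 60 + 30)
      (fun τ => τ 26 0 ≠ 0 ↔ ∀ y ∈ X, G.Adj v y → y ∈ bitSet xs x T b) := by
  refine (ends_check hσ (by decide)
    (P := fun j => G.Adj v (xs j) → T.testBit (b * x + j) = true) ?_).conseq le_rfl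
    fun τ _ h => h.trans ⟨?_, ?_⟩
  · intro j hj τ hτ hc
    have h1 := (hb.bit hj)
    have h2 := hσ.adj v (xs j)
    have h3 := hσ.adj_le (σ 6 v + xs j)
    simp only [adjMinusBit, Expr.eval, scalar, hc, hτ 24 (by decide) (by decide),
      hτ 25 (by decide) (by decide), hτ 21 (by decide) (by decide), hτ 1 (by decide) (by decide),
      hτ 6 (by decide) (by decide), hτ 8 (by decide) (by decide), hb.offset, hv, hσ.list j hj]
    rw [← h1.2, ← h2]
    omega
  · rintro h y hy hvy
    obtain ⟨j, hj, rfl⟩ := (hX y).1 hy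
    exact ⟨j, hj, rfl, h j hj hvy⟩
  · intro h j hj hvj
    obtain ⟨i, hi, hij, hbit⟩ := h _ ((hX _).2 ⟨j, hj, rfl⟩) hvj
    rwa [hxs i hi j hj hij] at hbit

/-- Store in array `A` the vertices outside `X` that pass the check `e`. -/
def maskProg (e : Expr) (A : ℕ) : Prog :=
  forLoop 25 (scalar 0) (.seq (checkProg e)
    (.ite (.get 2 (scalar 25)) (.assign A (scalar 25) (.lit 0)) (.assign A (scalar 25) (scalar 26))))

def maskTime (n x : ℕ) : ℕ :=
  n * (x * 60 + 60) + 20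

theorem ends_mask {σ : Store} (hσ : Setup G X S x q xs σ) {e : Expr} {A : ℕ}
    (hA : A = 16 ∨ A = 17) {P : Fin n → Prop}
    (hP : ∀ v : Fin n, ∀ τ : Store, (∀ a < 25, a ≠ A → τ a = σ a) → τ 25 0 = v →
      Ends (checkProg e) τ (x * 60 + 30) (fun ρ => ρ 26 0 ≠ 0 ↔ P v)) :
    Ends (maskProg e A) σ (maskTime n x) (fun τ => supp n (τ A) = {v | v ∉ X ∧ P v}) := by
  have hA25 : A ≠ 25 ∧ 25 ≠ A ∧ A ≠ 26 ∧ A ≠ 27 ∧ A ≠ 2 ∧ A ≠ 0 := by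
    rcases hA with rfl | rfl <;> decide
  have hwr : ∀ a, (Prog.seq (checkProg e)
      (.ite (.get 2 (scalar 25)) (.assign A (scalar 25) (.lit 0))
        (.assign A (scalar 25) (scalar 26)))).writes a = (a == 26 || a == 27 || a == A) := by
    intro a
    rw [BEq.comm (a := a) (b := 26), BEq.comm (a := a) (b := 27), BEq.comm (a := a) (b := A)]
    simp only [checkProg, forLoop, Prog.writes]
    cases (26 == a) <;> cases (27 == a) <;> cases (A == a) <;> rfl
  refine (Ends.for_array (A := A) (N := n) (T := x * 60 + 40)
    (fun j B => ∀ v : Fin n, (v : ℕ) < j → (B v ≠ 0 ↔ v ∉ X ∧ P v)) hA25.1 ?_ (by decide)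
    (fun ρ hρ => ?_) (fun v hv => absurd hv (Nat.not_lt_zero _)) ?_ le_rfl).conseq le_rfl
    fun τ _ h => ?_
  · rw [hwr]; simp [hA25.2.1]
  · have := hρ 0 (by decide) (by rw [hwr]; simp [hA25.2.2.2.2.2.symm])
    rw [scalar, Expr.eval, Expr.eval, this, hσ.size]
  · intro j hj τ hτ hc hI
    have hτ' : ∀ a < 25, a ≠ A → τ a = σ a := fun a ha haA =>
      hτ a (by omega) (by rw [hwr]; simp [haA, show a ≠ 26 by omega, show a ≠ 27 by omega])
    refine Ends.seq (hP ⟨j, hj⟩ τ hτ' hc) (T₂ := 10) (fun ρ hρ hflag => ?_) (by omega)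
    have w25 : (checkProg e).writes 25 = false := rfl
    have w2 : (checkProg e).writes 2 = false := rfl
    have wA : (checkProg e).writes A = false := by
      rcases hA with rfl | rfl <;> rfl
    have e25 : ρ 25 0 = j := by rw [hρ 25 w25, hc]
    have e2 : ρ 2 = σ 2 := by rw [hρ 2 w2, hτ' 2 (by decide) hA25.2.2.2.2.1.symm]
    have eA : ρ A = τ A := hρ A wA
    have hmem := hσ.mem ⟨j, hj⟩
    have step : ∀ y, (y ≠ 0 ↔ (⟨j, hj⟩ : Fin n) ∉ X ∧ P ⟨j, hj⟩) → ∀ v : Fin n, (v : ℕ) < j + 1 →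
        (Function.update (ρ A) j y v ≠ 0 ↔ v ∉ X ∧ P v) := by
      intro y hy v hv
      rcases Nat.lt_succ_iff_lt_or_eq.1 hv with h' | h'
      · rw [Function.update_of_ne (by omega), eA]; exact hI v h'
      · obtain rfl : v = ⟨j, hj⟩ := Fin.ext h'
        simpa using hy
    refine Ends.ite (T' := 5) (by decide) (fun c => ?_) (fun c => ?_)
    · refine Ends.assign (by simp [Expr.cost, scalar]) ?_
      simp only [Expr.eval, scalar, e25, e2] at c ⊢
      rw [Store.write_self]
      exact step 0 (by simp [hmem.1 c])
    · refine Ends.assign (by simp [Expr.cost, scalar]) ?_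
      simp only [Expr.eval, scalar, e25, e2] at c ⊢
      rw [Store.write_self]
      refine step _ ?_
      rw [hflag]
      have : (⟨j, hj⟩ : Fin n) ∉ X := fun h => hmem.2 h c
      simp [this]
  · ext v
    exact h v v.2

/-- Remove from the set in array `16` all vertices that are not in array `17`. -/
def interProg : Prog :=
  forLoop 25 (scalar 0) (.ite (.get 17 (scalar 25)) .skip (.assign 16 (scalar 25) (.lit 0)))

theorem ends_inter {σ : Store} (hσ : Setup G X S x q xs σ) :
    Ends interProg σ (n * 40 + 20)
      (fun τ => supp n (τ 16) = supp n (σ 16) ∩ supp n (σ 17)) := by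
  refine (Ends.for_array (A := 16) (N := n) (T := 20)
    (fun j B => ∀ v : Fin n, (v ∈ supp n B ↔ v ∈ supp n (σ 16) ∧ ((v : ℕ) < j → v ∈ supp n (σ 17))))
    (by decide) rfl (by decide) (fun ρ hρ => ?_) (fun v => by simp) ?_ le_rfl).conseq le_rfl
    fun τ _ h => ?_
  · rw [scalar, Expr.eval, Expr.eval, hρ 0 (by decide) rfl, hσ.size]
  · intro j hj τ hτ hc hI
    have e17 : τ 17 = σ 17 := hτ 17 (by decide) rfl
    refine Ends.ite (T' := 5) (by decide) (fun c => Ends.skip (by norm_num) ?_) (fun c => ?_)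
    · simp only [Expr.eval, scalar, hc, e17] at c
      intro v
      rw [hI v]
      refine and_congr_right fun _ => ⟨fun h hv => ?_, fun h hv => h (by omega)⟩
      rcases Nat.lt_succ_iff_lt_or_eq.1 hv with h' | h'
      · exact h h'
      · unfold supp; simpa [h'] using c
    · refine Ends.assign (by decide) ?_
      simp only [Expr.eval, scalar, hc, e17] at c ⊢
      rw [Store.write_self]
      intro v
      rw [supp_update]
      by_cases h' : (v : ℕ) = j
      · have : v ∉ supp n (σ 17) := by unfold supp; simpa [h'] using c
        simp [h', this]
      · rw [if_neg h', hI v]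
        refine and_congr_right fun _ => ⟨fun h hv => h (by omega), fun h hv => h (by omega)⟩
  · ext v
    rw [h v]
    simp

/-- Pass to the next block of bits and extend the walks by a piece that obeys the restriction. -/
def phaseProg : Prog :=
  .seq (.assign 24 (.lit 0) (.add (scalar 24) (scalar 7)))
    (.seq (maskProg adjMinusBit 17) (.seq interProg closeProg))

def phaseTime (n x : ℕ) : ℕ :=
  10 + (maskTime n x + (n * 40 + 20 + closeTime n))

theorem ends_next_block {σ : Store} (hσ : Setup G X S x q xs σ) {T b : ℕ}
    (hb : BlockState x q T b σ) (hlt : b + 1 < q + 3) :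
    Ends (.assign 24 (.lit 0) (.add (scalar 24) (scalar 7))) σ 10 (BlockState x q T (b + 1)) := by
  refine Ends.assign (by decide) ⟨?_, ?_, hlt⟩
  · rw [Store.write_of_ne _ _ _ (by decide)]; exact hb.bits
  · rw [Store.write_self]
    simp [Expr.eval, scalar, hb.offset, hσ.card, Nat.succ_mul]

/-- A piece must obey its restriction already on its first vertex, so the current set is intersected
with the allowed vertices before it is closed within them. -/
theorem ends_phase (hxs : ∀ i < x, ∀ j < x, xs i = xs j → i = j)
    (hX : ∀ y, y ∈ X ↔ ∃ j < x, xs j = y) {σ : Store} (hσ : Setup G X S x q xs σ) {T b : ℕ}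
    (hb : BlockState x q T b σ) (hlt : b + 1 < q + 3) :
    Ends phaseProg σ (phaseTime n x) (fun τ => BlockState x q T (b + 1) τ ∧
      supp n (τ 16) = {v | ∃ u ∈ supp n (σ 16), Step G X (bitSet xs x T (b + 1)) u v}) := by
  have lift : ∀ {p : Prog} {σ τ : Store}, (∀ a < 16, p.writes a = false) →
      (∀ a, p.writes a = false → τ a = σ a) → Setup G X S x q xs σ → Setup G X S x q xs τ :=
    fun hp hf h => h.congr fun a ha => hf a (hp a ha)
  refine Ends.seq (ends_next_block hσ hb hlt) (T₂ := maskTime n x + (n * 40 + 20 + closeTime n))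
    (fun τ hτ hbτ => ?_) (by unfold phaseTime; omega)
  have sτ := lift (by decide) hτ hσ
  have e16 : τ 16 = σ 16 := hτ 16 rfl
  refine Ends.seq (ends_mask sτ (Or.inr rfl) fun v ρ hρ hv => ends_check_sub hxs hX
    (sτ.congr fun a ha => hρ a (by omega) (by omega))
    (hbτ.congr (hρ 21 (by decide) (by decide)) (hρ 24 (by decide) (by decide))) hv)
    (T₂ := n * 40 + 20 + closeTime n) (fun τ₁ h₁ hmask => ?_) le_rfl
  have s₁ := lift (by decide) h₁ sτ
  have b₁ := hbτ.congr (h₁ 21 rfl) (h₁ 24 rfl)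
  have e16' : τ₁ 16 = σ 16 := (h₁ 16 rfl).trans e16
  refine Ends.seq (ends_inter s₁) (T₂ := closeTime n) (fun τ₂ h₂ hinter => ?_) le_rfl
  have s₂ := lift (by decide) h₂ s₁
  have b₂ := b₁.congr (h₂ 21 rfl) (h₂ 24 rfl)
  refine (ends_close s₂).conseq le_rfl fun τ₃ h₃ hclose => ⟨b₂.congr (h₃ 21 rfl) (h₃ 24 rfl), ?_⟩
  have hO : supp n (τ₁ 17) = allowed G X (bitSet xs x T (b + 1)) := hmask
  rw [hclose, hinter, h₂ 17 rfl, hO, e16']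
  ext v
  exact ⟨fun ⟨u, hu, huv⟩ => ⟨u, hu.1, hu.2, huv⟩, fun ⟨u, hu, huv⟩ => ⟨u, ⟨hu, huv.1⟩, huv.2⟩⟩

/-- Write the bits of the number in `23` to array `21`. -/
def bitsProg : Prog :=
  .seq (.assign 22 (.lit 0) (scalar 23)) (forLoop 36 (scalar 10)
    (.seq (.assign 21 (scalar 36) (.get 13 (scalar 22)))
      (.assign 22 (.lit 0) (.get 12 (scalar 22)))))

/-- The machine cannot divide; binary digits are read off by repeated look-up in the tables of
halves and parities. -/
theorem ends_bits {σ : Store} (hσ : Setup G X S x q xs σ) {T : ℕ} (hT : T < 2 ^ ((q + 3) * x))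
    (h23 : σ 23 0 = T) :
    Ends bitsProg σ ((q + 3) * x * 40 + 30)
      (fun τ => ∀ i < (q + 3) * x, τ 21 i = T / 2 ^ i % 2) := by
  refine Ends.seq (T₁ := 5) (T₂ := (q + 3) * x * 40 + 20) (R := fun τ => τ 22 0 = T)
    (Ends.assign (by decide) (by simp [Store.write_self, Expr.eval, scalar, h23]))
    (fun τ hτ h22 => ?_) (by omega)
  refine (Ends.for_arrays (A := 21) (B := 22) (N := (q + 3) * x) (T := 20)
    (fun j A B => (∀ i < j, A i = T / 2 ^ i % 2) ∧ B 0 = T / 2 ^ j) (by decide) (by decide) rfl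
    (by decide) (fun ρ hρ => ?_) ⟨by simp, by simpa using h22⟩ ?_ (by omega)).conseq le_rfl
    fun τ _ h => h.1
  · rw [scalar, Expr.eval, Expr.eval, hρ 10 (by decide) rfl, hτ 10 rfl, hσ.bits]
  · rintro j hj ρ hρ hc ⟨hA, hB⟩
    have hle : T / 2 ^ j ≤ 2 ^ ((q + 3) * x) := (Nat.div_le_self _ _).trans hT.le
    have e12 : ρ 12 (T / 2 ^ j) = T / 2 ^ j / 2 := by
      rw [hρ 12 (by decide) rfl, hτ 12 rfl, hσ.half _ hle]
    have e13 : ρ 13 (T / 2 ^ j) = T / 2 ^ j % 2 := by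
      rw [hρ 13 (by decide) rfl, hτ 13 rfl, hσ.parity _ hle]
    refine Ends.seq (T₁ := 10) (T₂ := 10) (R := fun τ => (∀ i < j + 1, τ 21 i = T / 2 ^ i % 2))
      (Ends.assign (by decide) ?_) (fun ρ' hρ' hA' => Ends.assign (by decide) ⟨?_, ?_⟩) le_rfl
    · intro i hi
      simp only [Expr.eval, scalar, hc, hB, e13, Store.write_self]
      rcases Nat.lt_succ_iff_lt_or_eq.1 hi with h' | rfl
      · rw [Function.update_of_ne (by omega)]; exact hA i h'
      · simp
    · rw [Store.write_of_ne _ _ _ (by decide)]; exact hA'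
    · rw [Store.write_self]
      simp only [Expr.eval, scalar, Function.update_self, hρ' 22 rfl, hρ' 12 rfl, hB, e12]
      rw [pow_succ, Nat.div_div_eq_div_mul]

/-- Determine the end vertices of the walks that pass the test whose number is in `23`. -/
def reachProg : Prog :=
  .seq bitsProg (.seq (.assign 24 (.lit 0) (.lit 0)) (.seq (maskProg bitMinusAdj 16)
    (.seq (forLoop 28 (.add (scalar 9) (.lit 1)) phaseProg)
      (.seq (.assign 24 (.lit 0) (.add (scalar 24) (scalar 7)))
        (.seq (maskProg bitMinusAdj 17) interProg)))))

def reachTime (n x q : ℕ) : ℕ :=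
  (q + 3) * x * 40 + 30 + (10 + (maskTime n x + ((q + 1) * (phaseTime n x + 20) + 20 +
    (10 + (maskTime n x + (n * 40 + 20))))))

/-- All start vertices are propagated at once. Walks stay in their component, so an end vertex alone
later identifies a component that passes. -/
theorem ends_reach (hxs : ∀ i < x, ∀ j < x, xs i = xs j → i = j)
    (hX : ∀ y, y ∈ X ↔ ∃ j < x, xs j = y) {σ : Store} (hσ : Setup G X S x q xs σ) {T : ℕ}
    (hT : T < 2 ^ ((q + 3) * x)) (h23 : σ 23 0 = T) :
    Ends reachProg σ (reachTime n x q) (fun τ => supp n (τ 16) =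
      {v | ∃ u, u ∉ X ∧ (∀ y ∈ bitSet xs x T 0, G.Adj u y) ∧
        Run G X ((List.range (q + 1)).map fun i => bitSet xs x T (i + 1)) u v ∧
          v ∉ X ∧ ∀ y ∈ bitSet xs x T (q + 1 + 1), G.Adj v y}) := by
  have lift : ∀ {p : Prog} {σ τ : Store}, (∀ a < 16, p.writes a = false) →
      (∀ a, p.writes a = false → τ a = σ a) → Setup G X S x q xs σ → Setup G X S x q xs τ :=
    fun hp hf h => h.congr fun a ha => hf a (hp a ha)
  unfold reachTime
  refine Ends.seq (ends_bits hσ hT h23) (fun τ₁ h₁ hbits => ?_) le_rfl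
  have s₁ := lift (by decide) h₁ hσ
  refine Ends.seq (T₁ := 10) (R := BlockState x q T 0) (Ends.assign (by decide) ⟨?_, ?_, by omega⟩)
    (fun τ₂ h₂ b₂ => ?_) le_rfl
  · rw [Store.write_of_ne _ _ _ (by decide)]; exact hbits
  · rw [Store.write_self]; simp [Expr.eval]
  have s₂ := lift (by decide) h₂ s₁
  refine Ends.seq (ends_mask s₂ (Or.inl rfl) fun v ρ hρ hv => ends_check_sup
    (s₂.congr fun a ha => hρ a (by omega) (by omega))
    (b₂.congr (hρ 21 (by decide) (by decide)) (hρ 24 (by decide) (by decide))) hv)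
    (fun τ₃ h₃ hstart => ?_) le_rfl
  have s₃ := lift (by decide) h₃ s₂
  have b₃ := b₂.congr (h₃ 21 rfl) (h₃ 24 rfl)
  set S₀ : Set (Fin n) := {v | v ∉ X ∧ ∀ y ∈ bitSet xs x T 0, G.Adj v y} with hS₀
  -- After `j` phases array `16` holds the ends of all walks obeying the first `j` restrictions, and
  -- block `j` is current.
  refine Ends.seq (Ends.for (N := q + 1) (T := phaseTime n x)
    (fun j τ => BlockState x q T j τ ∧ supp n (τ 16) =
      {v | ∃ u ∈ S₀, Run G X ((List.range j).map fun i => bitSet xs x T (i + 1)) u v})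
    (by decide) (fun j τ τ' h => ?_) (by decide) (fun ρ hρ => ?_) ⟨b₃, ?_⟩ ?_ le_rfl)
    (fun τ₄ h₄ hR => ?_) le_rfl
  · rintro ⟨h1, h2⟩
    exact ⟨h1.congr (h 21 (by decide)) (h 24 (by decide)), by rw [h 16 (by decide)]; exact h2⟩
  · simp only [scalar, Expr.eval]
    rw [hρ 9 (by decide) (by decide), s₃.threshold]
  · rw [hstart]
    ext v
    simp [Run]
  · rintro j hj τ hτ - ⟨hb, hR⟩
    refine (ends_phase hxs hX (s₃.congr fun a ha => hτ a (by omega) (by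
      revert ha; revert a; decide)) hb (by omega)).conseq le_rfl fun ρ _ h => ⟨h.1, ?_⟩
    rw [h.2, hR]
    ext v
    rw [List.range_succ, List.map_append]
    constructor
    · rintro ⟨w, ⟨u, hu, huw⟩, hwv⟩
      exact ⟨u, hu, run_append_singleton.2 ⟨w, huw, hwv⟩⟩
    · rintro ⟨u, hu, huv⟩
      obtain ⟨w, huw, hwv⟩ := run_append_singleton.1 huv
      exact ⟨w, ⟨u, hu, huw⟩, hwv⟩
  have s₄ := lift (by decide) h₄ s₃
  obtain ⟨b₄, hR⟩ := hR
  refine Ends.seq (ends_next_block s₄ b₄ (by omega)) (fun τ₅ h₅ b₅ => ?_) le_rfl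
  have s₅ := lift (by decide) h₅ s₄
  refine Ends.seq (ends_mask s₅ (Or.inr rfl) fun v ρ hρ hv => ends_check_sup
    (s₅.congr fun a ha => hρ a (by omega) (by omega))
    (b₅.congr (hρ 21 (by decide) (by decide)) (hρ 24 (by decide) (by decide))) hv)
    (fun τ₆ h₆ hend => ?_) le_rfl
  have s₆ := lift (by decide) h₆ s₅
  refine (ends_inter s₆).conseq le_rfl fun τ₇ _ h => ?_
  rw [h, hend, h₆ 16 rfl, h₅ 16 rfl, hR]
  ext v
  constructor
  · rintro ⟨⟨u, hu, hrun⟩, hv, hv'⟩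
    exact ⟨u, hu.1, hu.2, hrun, hv, hv'⟩
  · rintro ⟨u, hu, hu', hrun, hv, hv'⟩
    exact ⟨⟨u, ⟨hu, hu'⟩, hrun⟩, hv, hv'⟩

end TestEvaluation

/-! ### Eliminating components that pass a rare test -/

section Elimination

variable {n : ℕ} {G : SimpleGraph (Fin n)} {X S : Set (Fin n)} {x q : ℕ} {xs : ℕ → Fin n}

theorem Setup.lift {p : Prog} {σ τ : Store} (hσ : Setup G X S x q xs σ)
    (hp : ∀ a < 16, p.writes a = false) (hf : ∀ a, p.writes a = false → τ a = σ a) :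
    Setup G X S x q xs τ :=
  hσ.congr fun a ha => hf a (hp a ha)

theorem Comp.mem_of_run {C : Comp G X} {Bs : List (Set (Fin n))} {u v : Fin n} (hu : u ∈ C.verts)
    (h : Run G X Bs u v) : v ∈ C.verts := by
  induction Bs generalizing u with
  | nil => exact h ▸ hu
  | cons B Bs ih =>
    obtain ⟨w, hw, hr⟩ := h
    exact ih (Comp.mem_of_step hu hw) hr

theorem Comp.exists_mem {v : Fin n} (hv : v ∉ X) : ∃ C : Comp G X, v ∈ C.verts :=
  ⟨_, (Comp.mem_verts_iff hv).2 rfl⟩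

/-- Array `34` assigns to every vertex outside `X` the number of its component. -/
def Labels (lam : Comp G X → ℕ) (σ : Store) : Prop :=
  ∀ D : Comp G X, ∀ v ∈ D.verts, σ 34 v = lam D

/-- The components that are not marked as deleted in array `32`. -/
def alive (lam : Comp G X → ℕ) (σ : Store) : Set (Comp G X) :=
  {D | σ 32 (lam D) = 0}

/-- Mark in array `29` the labels of the vertices in array `16`. -/
def hitProg : Prog :=
  .seq (forLoop 25 (scalar 0) (.assign 29 (scalar 25) (.lit 0)))
    (forLoop 25 (scalar 0)
      (.ite (.get 16 (scalar 25)) (.assign 29 (.get 34 (scalar 25)) (.lit 1)) .skip))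

theorem ends_hit {σ : Store} (hσ : Setup G X S x q xs σ) :
    Ends hitProg σ (n * 60 + 40)
      (fun τ => ∀ c < n, (τ 29 c ≠ 0 ↔ ∃ v ∈ supp n (σ 16), σ 34 v = c)) := by
  refine Ends.seq (T₁ := n * 30 + 20) (T₂ := n * 30 + 20)
    (Ends.for_array (A := 29) (N := n) (T := 10) (fun j A => ∀ c < j, A c = 0) (by decide) rfl
      (by decide) (fun ρ hρ => ?_) (by simp) ?_ le_rfl) (fun τ hτ h29 => ?_) (by omega)
  · rw [scalar, Expr.eval, Expr.eval, hρ 0 (by decide) rfl, hσ.size]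
  · intro j hj τ hτ hc hI
    refine Ends.assign (by decide) ?_
    simp only [Expr.eval, scalar, hc, Store.write_self]
    intro c hcj
    rcases Nat.lt_succ_iff_lt_or_eq.1 hcj with h | rfl
    · rw [Function.update_of_ne (by omega)]; exact hI c h
    · simp
  have e16 : τ 16 = σ 16 := hτ 16 rfl
  have e34 : τ 34 = σ 34 := hτ 34 rfl
  refine (Ends.for_array (A := 29) (N := n) (T := 10)
    (fun j A => ∀ c < n, (A c ≠ 0 ↔ ∃ v : Fin n, (v : ℕ) < j ∧ v ∈ supp n (σ 16) ∧ σ 34 v = c))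
    (by decide) rfl (by decide) (fun ρ hρ => ?_) (fun c hc => by simp [h29 c hc]) ?_
    le_rfl).conseq le_rfl fun ρ _ h c hc => (h c hc).trans ⟨?_, ?_⟩
  · rw [scalar, Expr.eval, Expr.eval, hρ 0 (by decide) rfl, hτ 0 rfl, hσ.size]
  · intro j hj ρ hρ hc hI
    have e16' : ρ 16 = σ 16 := (hρ 16 (by decide) rfl).trans e16
    have e34' : ρ 34 = σ 34 := (hρ 34 (by decide) rfl).trans e34
    refine Ends.ite (T' := 6) (by decide) (fun c1 => ?_) (fun c1 => Ends.skip (by norm_num) ?_)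
    · refine Ends.assign (by decide) ?_
      simp only [Expr.eval, scalar, hc, e16', e34', Store.write_self] at c1 ⊢
      intro c hcn
      by_cases hcj : c = σ 34 j
      · subst hcj
        simp only [Function.update_self]
        exact ⟨fun _ => ⟨⟨j, hj⟩, by simp, c1, rfl⟩, fun _ => one_ne_zero⟩
      · rw [Function.update_of_ne hcj, hI c hcn]
        constructor
        · rintro ⟨v, h1, h2⟩
          exact ⟨v, by omega, h2⟩
        · rintro ⟨v, h1, h2, h3⟩
          refine ⟨v, ?_, h2, h3⟩
          rcases Nat.lt_succ_iff_lt_or_eq.1 h1 with h | h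
          · exact h
          · exact absurd (h ▸ h3.symm) hcj
    · simp only [Expr.eval, scalar, hc, e16'] at c1
      intro c hcn
      rw [hI c hcn]
      constructor
      · rintro ⟨v, h1, h2⟩
        exact ⟨v, by omega, h2⟩
      · rintro ⟨v, h1, h2, h3⟩
        refine ⟨v, ?_, h2, h3⟩
        rcases Nat.lt_succ_iff_lt_or_eq.1 h1 with h | h
        · exact h
        · exact absurd (h ▸ c1) h2
  · rintro ⟨v, -, h2⟩
    exact ⟨v, h2⟩
  · rintro ⟨v, h2⟩
    exact ⟨v, v.2, h2⟩

/-- Delete all marked components if at most `q` of them are alive. -/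
def killProg : Prog :=
  .seq (.assign 30 (.lit 0) (.lit 0))
    (.seq (forLoop 25 (scalar 0) (.ite (.get 29 (scalar 25))
        (.ite (.get 32 (scalar 25)) .skip (.assign 30 (.lit 0) (.add (scalar 30) (.lit 1)))) .skip))
      (.ite (.sub (scalar 30) (scalar 9)) .skip
        (forLoop 25 (scalar 0) (.ite (.get 29 (scalar 25)) (.assign 32 (scalar 25) (.lit 1)) .skip))))

/-- The truncated difference of the count and the threshold vanishes exactly when at most `q` live
labels are marked. -/
theorem ends_kill {σ : Store} (hσ : Setup G X S x q xs σ) :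
    Ends killProg σ (n * 80 + 70)
      (fun τ => ({c | c < n ∧ σ 29 c ≠ 0 ∧ σ 32 c = 0}.ncard ≤ q ∧
          ∀ c < n, (τ 32 c = 0 ↔ σ 32 c = 0 ∧ σ 29 c = 0)) ∨
        (q < {c | c < n ∧ σ 29 c ≠ 0 ∧ σ 32 c = 0}.ncard ∧ τ 32 = σ 32)) := by
  classical
  have hcard : {c | c < n ∧ σ 29 c ≠ 0 ∧ σ 32 c = 0}.ncard
      = ((Finset.range n).filter fun c => σ 29 c ≠ 0 ∧ σ 32 c = 0).card := by
    rw [← Set.ncard_coe_finset]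
    congr 1
    ext c
    simp
  rw [hcard]
  refine Ends.seq (T₁ := 10) (T₂ := n * 80 + 60) (R := fun τ => τ 30 0 = 0)
    (Ends.assign (by decide) (by simp [Store.write_self, Expr.eval])) (fun τ₁ h₁ h30 => ?_) (by omega)
  have s₁ := hσ.lift (by decide) h₁
  have e29 : τ₁ 29 = σ 29 := h₁ 29 rfl
  have e32 : τ₁ 32 = σ 32 := h₁ 32 rfl
  refine Ends.seq (T₁ := n * 40 + 20) (T₂ := n * 40 + 40)
    (Ends.for_array (A := 30) (N := n) (T := 20)
      (fun j A => A 0 = ((Finset.range j).filter fun c => σ 29 c ≠ 0 ∧ σ 32 c = 0).card)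
      (by decide) rfl (by decide) (fun ρ hρ => ?_) (by simpa using h30) ?_ le_rfl)
    (fun τ₂ h₂ hcnt => ?_) (by omega)
  · rw [scalar, Expr.eval, Expr.eval, hρ 0 (by decide) rfl, s₁.size]
  · intro j hj τ hτ hc hI
    have f29 : τ 29 = σ 29 := (hτ 29 (by decide) rfl).trans e29
    have f32 : τ 32 = σ 32 := (hτ 32 (by decide) rfl).trans e32
    rw [Finset.range_add_one, Finset.filter_insert]
    refine Ends.ite (T' := 15) (by decide) (fun c1 => ?_) (fun c1 => Ends.skip (by norm_num) ?_)
    · refine Ends.ite (T' := 8) (by decide) (fun c2 => Ends.skip (by norm_num) ?_) (fun c2 => ?_)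
      · simp only [Expr.eval, scalar, hc, f29, f32] at c1 c2
        rw [if_neg (fun h => c2 h.2)]; exact hI
      · refine Ends.assign (by decide) ?_
        simp only [Expr.eval, scalar, hc, f29, f32] at c1 c2 ⊢
        rw [if_pos ⟨c1, c2⟩, Finset.card_insert_of_notMem (by simp), Store.write_self]
        simp [hI]
    · simp only [Expr.eval, scalar, hc, f29] at c1
      rw [if_neg (fun h => h.1 c1)]; exact hI
  have s₂ := s₁.lift (by decide) h₂
  have e29' : τ₂ 29 = σ 29 := (h₂ 29 rfl).trans e29
  have e32' : τ₂ 32 = σ 32 := (h₂ 32 rfl).trans e32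
  have hth := s₂.threshold
  refine Ends.ite (T' := n * 40 + 20) (by simp [Expr.cost, scalar]; omega)
    (fun c => Ends.skip (by omega) ?_) (fun c => ?_)
  · simp only [Expr.eval, scalar, hcnt, hth] at c
    exact Or.inr ⟨by omega, e32'⟩
  · simp only [Expr.eval, scalar, hcnt, hth] at c
    refine (Ends.for_array (A := 32) (N := n) (T := 20)
      (fun j A => ∀ c < n, (A c = 0 ↔ σ 32 c = 0 ∧ (c < j → σ 29 c = 0)))
      (by decide) rfl (by decide) (fun ρ hρ => ?_) (fun c _ => by simp [e32']) ?_
      le_rfl).conseq le_rfl fun ρ _ h => Or.inl ⟨by omega, fun c hc => by simpa [hc] using h c hc⟩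
    · rw [scalar, Expr.eval, Expr.eval, hρ 0 (by decide) rfl, s₂.size]
    · intro j hj τ hτ hc hI
      have f29 : τ 29 = σ 29 := (hτ 29 (by decide) rfl).trans e29'
      refine Ends.ite (T' := 8) (by decide) (fun c1 => ?_) (fun c1 => Ends.skip (by norm_num) ?_)
      · refine Ends.assign (by decide) ?_
        simp only [Expr.eval, scalar, hc, f29, Store.write_self] at c1 ⊢
        intro c hcn
        by_cases hcj : c = j
        · subst hcj
          simp [c1]
        · rw [Function.update_of_ne hcj, hI c hcn]
          exact and_congr_right fun _ => ⟨fun h h' => h (by omega), fun h h' => h (by omega)⟩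
      · simp only [Expr.eval, scalar, hc, f29] at c1
        intro c hcn
        rw [hI c hcn]
        refine and_congr_right fun _ => ⟨fun h h' => ?_, fun h h' => h (by omega)⟩
        rcases Nat.lt_succ_iff_lt_or_eq.1 h' with h'' | rfl
        · exact h h''
        · exact c1

/-- Process the test whose number is in `23`. -/
def testProg : Prog :=
  .seq reachProg (.seq hitProg killProg)

def testTime (n x q : ℕ) : ℕ :=
  reachTime n x q + (n * 60 + 40 + (n * 80 + 70))

/-- `𝓐'` arises from `𝓐` by deleting the elements of `P` if there are at most `q` of them. -/
def Pruned {α : Type*} (q : ℕ) (P 𝓐 𝓐' : Set α) : Prop :=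
  ({D ∈ 𝓐 | D ∈ P}.ncard ≤ q ∧ 𝓐' = 𝓐 \ P) ∨ (q < {D ∈ 𝓐 | D ∈ P}.ncard ∧ 𝓐' = 𝓐)

/-- The machine counts labels; injectivity of `lam` turns this into a count of components. -/
theorem ends_test (hxs : ∀ i < x, ∀ j < x, xs i = xs j → i = j)
    (hX : ∀ y, y ∈ X ↔ ∃ j < x, xs j = y) {σ : Store} (hσ : Setup G X S x q xs σ)
    {lam : Comp G X → ℕ} (hlam : Function.Injective lam) (hlt : ∀ D, lam D < n)
    (hL : Labels lam σ) {T : ℕ} (hT : T < 2 ^ ((q + 3) * x)) (h23 : σ 23 0 = T) :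
    Ends testProg σ (testTime n x q) (fun τ =>
      Pruned q {D | PassesBits G X xs x (q + 1) T D} (alive lam σ) (alive lam τ)) := by
  refine Ends.seq (ends_reach hxs hX hσ hT h23) (fun τ₁ h₁ hR => ?_) le_rfl
  have s₁ := hσ.lift (by decide) h₁
  refine Ends.seq (ends_hit s₁) (fun τ₂ h₂ hhit => ?_) le_rfl
  have s₂ := s₁.lift (by decide) h₂
  have e32 : τ₂ 32 = σ 32 := (h₂ 32 rfl).trans (h₁ 32 rfl)
  have hpass : ∀ c < n, (τ₂ 29 c ≠ 0 ↔ ∃ D, PassesBits G X xs x (q + 1) T D ∧ lam D = c) := by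
    intro c hc
    rw [hhit c hc, hR, h₁ 34 rfl]
    constructor
    · rintro ⟨v, ⟨u, hu, h1, h2, h3, h4⟩, hvc⟩
      obtain ⟨D, hD⟩ := Comp.exists_mem (G := G) hu
      exact ⟨D, ⟨u, hD, v, h1, h2, h4⟩, by rw [← hvc, hL D v (Comp.mem_of_run hD h2)]⟩
    · rintro ⟨D, ⟨u, hD, v, h1, h2, h4⟩, hDc⟩
      have hv := Comp.mem_of_run hD h2
      exact ⟨v, ⟨u, Comp.notMem_of_mem_verts hD, h1, h2, Comp.notMem_of_mem_verts hv, h4⟩,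
        by rw [hL D v hv, hDc]⟩
  have hpass' : ∀ D, τ₂ 29 (lam D) ≠ 0 ↔ PassesBits G X xs x (q + 1) T D := by
    intro D
    rw [hpass _ (hlt D)]
    exact ⟨fun ⟨D', h, he⟩ => hlam he ▸ h, fun h => ⟨D, h, rfl⟩⟩
  have hcard : {c | c < n ∧ τ₂ 29 c ≠ 0 ∧ τ₂ 32 c = 0}.ncard
      = {D ∈ alive lam σ | D ∈ {D | PassesBits G X xs x (q + 1) T D}}.ncard := by
    rw [← Set.ncard_image_of_injective _ hlam]
    congr 1
    ext c
    constructor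
    · rintro ⟨h1, h2, h3⟩
      obtain ⟨D, hD, rfl⟩ := (hpass c h1).1 h2
      exact ⟨D, ⟨by rw [e32] at h3; exact h3, hD⟩, rfl⟩
    · rintro ⟨D, ⟨h1, h2⟩, rfl⟩
      exact ⟨hlt D, (hpass' D).2 h2, by rw [e32]; exact h1⟩
  refine (ends_kill s₂).conseq le_rfl fun τ₃ _ h => ?_
  rw [hcard] at h
  rcases h with ⟨h1, h2⟩ | ⟨h1, h2⟩
  · refine Or.inl ⟨h1, ?_⟩
    ext D
    have h3 := h2 (lam D) (hlt D)
    have h4 := hpass' D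
    rw [e32] at h3
    change τ₃ 32 (lam D) = 0 ↔ (σ 32 (lam D) = 0 ∧ ¬ PassesBits G X xs x (q + 1) T D)
    rw [h3, ← h4]
    tauto
  · refine Or.inr ⟨h1, ?_⟩
    ext D
    change τ₃ 32 (lam D) = 0 ↔ σ 32 (lam D) = 0
    rw [h2, e32]

/-- The deleted elements are accounted for by tests that no remaining element passes. -/
def Accounted {α : Type*} (q N : ℕ) (P : ℕ → Set α) (𝓐 : Set α) : Prop :=
  ∃ F ⊆ Finset.range N, (∀ T ∈ F, ∀ D ∈ 𝓐, D ∉ P T) ∧ Nat.card α ≤ 𝓐.ncard + q * F.card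

/-- Every test with number below `N` passed by some element is passed by more than `q` elements. -/
def Stable {α : Type*} (q N : ℕ) (P : ℕ → Set α) (𝓐 : Set α) : Prop :=
  ∀ T < N, ∀ D ∈ 𝓐, D ∈ P T → q < {D ∈ 𝓐 | D ∈ P T}.ncard

theorem Pruned.subset {α : Type*} {q : ℕ} {P 𝓐 𝓐' : Set α} (h : Pruned q P 𝓐 𝓐') : 𝓐' ⊆ 𝓐 := by
  rcases h with ⟨-, rfl⟩ | ⟨-, rfl⟩
  · exact Set.sdiff_subset
  · exact subset_rfl

/-- A test deletes something at most once, since afterwards no survivor passes it; so `q` deletions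
may be charged to each test in `F`. -/
theorem Accounted.pruned {α : Type*} [Finite α] {q N T : ℕ} {P : ℕ → Set α} {𝓐 𝓐' : Set α}
    (h : Accounted q N P 𝓐) (hT : T < N) (hp : Pruned q (P T) 𝓐 𝓐') : Accounted q N P 𝓐' := by
  classical
  have hsub := hp.subset
  obtain ⟨F, hF, h1, h2⟩ := h
  rcases hp with ⟨hle, rfl⟩ | ⟨-, rfl⟩
  · by_cases hTF : T ∈ F
    · refine ⟨F, hF, fun T' hT' D hD => h1 T' hT' D (hsub hD), ?_⟩
      have : 𝓐 \ P T = 𝓐 := sdiff_eq_left.2 (Set.disjoint_left.2 (h1 T hTF))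
      rwa [this]
    · refine ⟨insert T F, Finset.insert_subset (Finset.mem_range.2 hT) hF, fun T' hT' D hD => ?_, ?_⟩
      · rcases Finset.mem_insert.1 hT' with rfl | hT'
        · exact hD.2
        · exact h1 T' hT' D hD.1
      · rw [Finset.card_insert_of_notMem hTF, Nat.mul_add, Nat.mul_one]
        have h3 : 𝓐 ⊆ (𝓐 \ P T) ∪ {D ∈ 𝓐 | D ∈ P T} := fun D hD => by
          by_cases h : D ∈ P T
          · exact Or.inr ⟨hD, h⟩
          · exact Or.inl ⟨hD, h⟩
        have h4 := (Set.ncard_le_ncard h3 (Set.toFinite _)).trans (Set.ncard_union_le _ _)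
        omega
  · exact ⟨F, hF, h1, h2⟩

/-- Process all tests repeatedly. -/
def roundsProg : Prog :=
  forLoop 35 (scalar 0) (forLoop 23 (scalar 11) testProg)

def roundsTime (n x q : ℕ) : ℕ :=
  n * (2 ^ ((q + 3) * x) * (testTime n x q + 20) + 20 + 20) + 20

/-- A round that deletes nothing has checked all tests against one and the same collection, which is
then stable. Every other round loses a component, and there are at most `n` of them. -/
theorem ends_rounds (hxs : ∀ i < x, ∀ j < x, xs i = xs j → i = j)
    (hX : ∀ y, y ∈ X ↔ ∃ j < x, xs j = y) {σ : Store} (hσ : Setup G X S x q xs σ)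
    {lam : Comp G X → ℕ} (hlam : Function.Injective lam) (hlt : ∀ D, lam D < n)
    (hL : Labels lam σ) (h32 : ∀ i, σ 32 i = 0) :
    Ends roundsProg σ (roundsTime n x q) (fun τ =>
      Stable q (2 ^ ((q + 3) * x)) (fun T => {D | PassesBits G X xs x (q + 1) T D}) (alive lam τ) ∧
      Nat.card (Comp G X) ≤ (alive lam τ).ncard + q * 2 ^ ((q + 3) * x)) := by
  set N := 2 ^ ((q + 3) * x) with hN
  set P : ℕ → Set (Comp G X) := fun T => {D | PassesBits G X xs x (q + 1) T D} with hP
  have hcard : Nat.card (Comp G X) ≤ n := by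
    have := Nat.card_le_card_of_injective (fun D => (⟨lam D, hlt D⟩ : Fin n)) fun D E h =>
      hlam (Fin.mk.inj_iff.1 h)
    rwa [Nat.card_fin] at this
  let al : (ℕ → ℕ) → Set (Comp G X) := fun A => {D | A (lam D) = 0}
  have h0 : al (σ 32) = Set.univ := by
    ext D; simp [al, h32]
  refine (Ends.for_array (A := 32) (N := n)
    (fun j A => Accounted q N P (al A) ∧ (Stable q N P (al A) ∨ j + (al A).ncard ≤ n))
    (by decide) (by decide) (by decide) (fun τ hτ => ?_) ⟨?_, Or.inr ?_⟩ ?_ le_rfl).conseq le_rfl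
    fun τ _ h => ⟨?_, ?_⟩
  · rw [scalar, Expr.eval, Expr.eval, hτ 0 (by decide) (by decide), hσ.size]
  · exact ⟨∅, by simp, by simp, by rw [h0, Set.ncard_univ]; omega⟩
  · rw [h0, Set.ncard_univ]; omega
  · rintro j hj τ hτ - ⟨hacc, hst⟩
    have sτ : Setup G X S x q xs τ := hσ.congr fun a ha => hτ a (by omega) (by
      revert ha; revert a; decide)
    have eL : τ 34 = σ 34 := hτ 34 (by decide) (by decide)
    -- Within a round: as long as nothing has been deleted, the tests seen so far are good for the
    -- initial collection; and a stable initial collection is never changed.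
    refine (Ends.for_array (A := 32) (N := N) (T := testTime n x q)
      (fun i A => Accounted q N P (al A) ∧ al A ⊆ al (τ 32) ∧
        (al A = al (τ 32) → ∀ T < i, ∀ D ∈ al (τ 32), D ∈ P T →
          q < {D ∈ al (τ 32) | D ∈ P T}.ncard) ∧
        (Stable q N P (al (τ 32)) → al A = al (τ 32)))
      (by decide) (by decide) (by decide) (fun ρ hρ => ?_)
      ⟨hacc, subset_rfl, fun _ T hT => absurd hT (Nat.not_lt_zero _), fun _ => rfl⟩ ?_ le_rfl).conseq
      le_rfl fun ρ _ h => ⟨h.1, ?_⟩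
    · rw [scalar, Expr.eval, Expr.eval, hρ 11 (by decide) (by decide), sτ.tests]
    · rintro T hT ρ hρ h23 ⟨k1, k2, k3, k4⟩
      have sρ : Setup G X S x q xs ρ := sτ.congr fun a ha => hρ a (by omega) (by
        revert ha; revert a; decide)
      have hLρ : Labels lam ρ := by
        unfold Labels
        rw [hρ 34 (by decide) (by decide), eL]
        exact hL
      refine (ends_test hxs hX sρ hlam hlt hLρ hT h23).conseq le_rfl fun ρ' _ hp => ?_
      change Pruned q (P T) (al (ρ 32)) (al (ρ' 32)) at hp
      have hsub := hp.subset
      refine ⟨k1.pruned hT hp, hsub.trans k2, fun heq => ?_, fun hS => ?_⟩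
      · have heq' : al (ρ 32) = al (τ 32) := k2.antisymm (heq ▸ hsub)
        intro T' hT' D hD hDP
        rcases Nat.lt_succ_iff_lt_or_eq.1 hT' with h' | rfl
        · exact k3 heq' T' h' D hD hDP
        · rcases hp with ⟨-, hp⟩ | ⟨hp, -⟩
          · rw [← heq, hp] at hD
            exact absurd hDP hD.2
          · rwa [heq'] at hp
      · have heq' := k4 hS
        rcases hp with ⟨hp, hp'⟩ | ⟨-, hp⟩
        · rw [hp', heq']
          refine sdiff_eq_left.2 (Set.disjoint_left.2 fun D hD hDP => ?_)
          rw [heq'] at hp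
          exact absurd (hS T hT D hD hDP) (by omega)
        · rw [hp, heq']
    · rcases eq_or_ne (al (ρ 32)) (al (τ 32)) with he | he
      · left
        rw [he]
        exact h.2.2.1 he
      · have hns : ¬ Stable q N P (al (τ 32)) := fun hs => he (h.2.2.2 hs)
        have hle := hst.resolve_left hns
        have := Set.ncard_lt_ncard (h.2.1.ssubset_of_ne he) (Set.toFinite _)
        right
        omega
  · rcases h.2 with h' | h'
    · exact h'
    -- After `n` rounds the alternative to stability leaves no component, and the empty collection
    -- is stable.
    · have h3 : (al (τ 32)).ncard = 0 := by omega
      rw [Set.ncard_eq_zero (Set.toFinite _)] at h3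
      intro T _ D hD
      change D ∈ al (τ 32) at hD
      rw [h3] at hD
      exact absurd hD (Set.notMem_empty _)
  · obtain ⟨F, hF, -, hle⟩ := h.1
    have h3 := Finset.card_le_card hF
    rw [Finset.card_range] at h3
    have h4 := Nat.mul_le_mul_left q h3
    exact hle.trans (Nat.add_le_add_left h4 _)

end Elimination

/-! ### Numbering the components and writing the output -/

section LabelsAndOutput

variable {n : ℕ} {G : SimpleGraph (Fin n)} {X S : Set (Fin n)} {x q : ℕ} {xs : ℕ → Fin n}

theorem mem_closureIn_compl {s v : Fin n} {D : Comp G X} (hs : s ∈ D.verts) :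
    v ∈ closureIn G {s} Xᶜ ↔ v ∈ D.verts := by
  constructor
  · rintro ⟨_, rfl, h⟩
    induction h with
    | refl => exact hs
    | tail _ h ih => exact Comp.mem_of_adj ih h.1 h.2
  · intro hv
    have hsX := Comp.notMem_of_mem_verts hs
    have hvX := Comp.notMem_of_mem_verts hv
    rw [Comp.mem_verts_iff hsX] at hs
    rw [Comp.mem_verts_iff hvX] at hv
    have hr : (G.induce Xᶜ).Reachable ⟨s, hsX⟩ ⟨v, hvX⟩ :=
      SimpleGraph.ConnectedComponent.exact (hs.trans hv.symm)
    rw [SimpleGraph.reachable_iff_reflTransGen] at hr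
    refine ⟨s, rfl, ?_⟩
    exact Relation.ReflTransGen.lift (p := fun a b => G.Adj a b ∧ b ∈ Xᶜ) Subtype.val
      (fun a b hab => ⟨hab, b.2⟩) _ _ hr

/-- Number the components of `G - X`. -/
def labelProg : Prog :=
  forLoop 31 (scalar 0)
    (.seq (forLoop 25 (scalar 0) (.seq (.assign 16 (scalar 25) (.lit 0))
        (.assign 17 (scalar 25) (.sub (.lit 1) (.get 2 (scalar 25))))))
      (.seq (.ite (.get 2 (scalar 31)) .skip (.assign 16 (scalar 31) (.lit 1)))
        (.seq closeProg (forLoop 25 (scalar 0)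
          (.ite (.get 16 (scalar 25)) (.assign 34 (scalar 25) (scalar 31)) .skip)))))

def labelTime (n : ℕ) : ℕ :=
  n * (n * 40 + 20 + (20 + (closeTime n + (n * 40 + 20))) + 20) + 20

/-- Every vertex outside `X` floods its component with its own number, overwriting earlier ones. The
final label is the number of a vertex of the component, which makes labels injective and below `n`.
-/
theorem ends_label {σ : Store} (hσ : Setup G X S x q xs σ) :
    Ends labelProg σ (labelTime n) (fun τ => ∃ lam : Comp G X → ℕ, Function.Injective lam ∧
      (∀ D, lam D < n) ∧ Labels lam τ) := by
  refine (Ends.for_array (A := 34) (N := n)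
    (fun j A => ∀ D : Comp G X, (∃ s ∈ D.verts, (s : ℕ) < j) →
      ∃ s ∈ D.verts, ∀ v ∈ D.verts, A v = s)
    (by decide) (by decide) (by decide) (fun τ hτ => ?_)
    (fun D ⟨s, _, hs⟩ => absurd hs (Nat.not_lt_zero _)) ?_ le_rfl).conseq le_rfl fun τ _ h => ?_
  · rw [scalar, Expr.eval, Expr.eval, hτ 0 (by decide) (by decide), hσ.size]
  · intro j hj τ hτ hc hI
    have sτ : Setup G X S x q xs τ := hσ.congr fun a ha => hτ a (by omega) (by
      revert ha; revert a; decide)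
    refine Ends.seq (T₁ := n * 40 + 20)
      (Ends.for_arrays (A := 16) (B := 17) (N := n) (T := 20)
        (fun i A B => ∀ v : Fin n, (v : ℕ) < i → A v = 0 ∧ (B v ≠ 0 ↔ v ∉ X))
        (by decide) (by decide) rfl (by decide) (fun ρ hρ => ?_)
        (fun v hv => absurd hv (Nat.not_lt_zero _)) ?_ le_rfl) (fun τ₁ h₁ hinit => ?_) le_rfl
    · rw [scalar, Expr.eval, Expr.eval, hρ 0 (by decide) rfl, sτ.size]
    · intro i hi ρ hρ hci hIi
      have hm := sτ.mem ⟨i, hi⟩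
      refine Ends.seq (T₁ := 10) (T₂ := 10) (R := fun ρ' => ρ' 16 = Function.update (ρ 16) i 0)
        (Ends.assign (by decide) ?_) (fun ρ' hρ' h16 => Ends.assign (by decide) ?_) le_rfl
      · simp only [Expr.eval, scalar, hci, Store.write_self]
      · rw [Store.write_of_ne _ _ _ (by decide), Store.write_self, h16]
        simp only [Expr.eval, scalar, hρ' 25 rfl, hρ' 2 rfl, hci, hρ' 17 rfl, hρ 2 (by decide) rfl]
        intro v hv
        rcases Nat.lt_succ_iff_lt_or_eq.1 hv with h' | h'
        · rw [Function.update_of_ne (by omega), Function.update_of_ne (by omega)]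
          exact hIi v h'
        · obtain rfl : v = ⟨i, hi⟩ := Fin.ext h'
          refine ⟨by simp, ?_⟩
          rw [Function.update_self, ← hm]
          change 1 - τ 2 i ≠ 0 ↔ ¬ τ 2 i ≠ 0
          omega
    have s₁ := sτ.lift (by decide) h₁
    have e31 : τ₁ 31 0 = j := by rw [h₁ 31 rfl, hc]
    have h17 : supp n (τ₁ 17) = Xᶜ := by
      ext v
      exact (hinit v v.2).2
    have h16 : supp n (τ₁ 16) = ∅ := by
      ext v
      simp [supp, (hinit v v.2).1]
    have hm := s₁.mem ⟨j, hj⟩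
    -- The flood starts from `j` alone if `j` is outside `X`, and from nothing otherwise.
    refine Ends.seq (T₁ := 20)
      (R := fun τ₂ => supp n (τ₂ 16) = {v | v = ⟨j, hj⟩ ∧ (⟨j, hj⟩ : Fin n) ∉ X})
      (Ends.ite (T' := 10) (by decide) (fun c => Ends.skip (by norm_num) ?_)
        (fun c => Ends.assign (by decide) ?_)) (fun τ₂ h₂ hset => ?_) le_rfl
    · simp only [Expr.eval, scalar, e31] at c
      rw [h16]
      ext v
      simp [hm.1 c]
    · simp only [Expr.eval, scalar, e31, Store.write_self] at c ⊢
      have hjX : (⟨j, hj⟩ : Fin n) ∉ X := fun h => hm.2 h c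
      ext v
      rw [supp_update, h16]
      simp [hjX, Fin.ext_iff]
    have s₂ := s₁.lift (by decide) h₂
    have e34₂ : τ₂ 34 = τ 34 := (h₂ 34 rfl).trans (h₁ 34 rfl)
    refine Ends.seq (ends_close s₂) (fun τ₃ h₃ hcl => ?_) le_rfl
    rw [h₂ 17 rfl, h17, hset] at hcl
    have e34₃ : τ₃ 34 = τ 34 := (h₃ 34 rfl).trans e34₂
    have e31₃ : τ₃ 31 0 = j := by rw [h₃ 31 rfl, h₂ 31 rfl, e31]
    refine (Ends.for_array (A := 34) (N := n) (T := 20)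
      (fun i A => ∀ v : Fin n, A v = if (v : ℕ) < i ∧ τ₃ 16 v ≠ 0 then j else τ 34 v)
      (by decide) rfl (by decide) (fun ρ hρ => ?_) (fun v => by simp [e34₃]) ?_ le_rfl).conseq
      le_rfl fun ρ _ hρ D hD => ?_
    · rw [scalar, Expr.eval, Expr.eval, hρ 0 (by decide) rfl, (s₂.lift (by decide) h₃).size]
    · intro i hi ρ hρ hci hIi
      have e16 : ρ 16 = τ₃ 16 := hρ 16 (by decide) rfl
      have e31 : ρ 31 0 = j := by rw [hρ 31 (by decide) rfl, e31₃]
      refine Ends.ite (T' := 10) (by decide) (fun c => ?_) (fun c => Ends.skip (by norm_num) ?_)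
      · refine Ends.assign (by decide) ?_
        simp only [Expr.eval, scalar, hci, e16, e31, Store.write_self] at c ⊢
        intro v
        by_cases hv : (v : ℕ) = i
        · simp [hv, c]
        · rw [Function.update_of_ne hv, hIi v]
          simp [show (v : ℕ) < i + 1 ↔ (v : ℕ) < i by omega]
      · simp only [Expr.eval, scalar, hci, e16] at c
        intro v
        rw [hIi v]
        by_cases hv : (v : ℕ) = i
        · simp [hv, c]
        · simp [show (v : ℕ) < i + 1 ↔ (v : ℕ) < i by omega]
    -- The component of `j` is relabelled as a whole; the flood does not reach any other component.
    · by_cases hjD : (⟨j, hj⟩ : Fin n) ∈ D.verts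
      · refine ⟨⟨j, hj⟩, hjD, fun v hv => ?_⟩
        have hjX := Comp.notMem_of_mem_verts hjD
        have : v ∈ supp n (τ₃ 16) := by
          rw [hcl]
          have : {v : Fin n | v = ⟨j, hj⟩ ∧ (⟨j, hj⟩ : Fin n) ∉ X} = {⟨j, hj⟩} := by
            ext w; simp [hjX]
          rw [this]
          exact (mem_closureIn_compl hjD).2 hv
        rw [hρ v, if_pos ⟨v.2, this⟩]
      · obtain ⟨s, hs, hsj⟩ := hD
        obtain ⟨s', hs', hlab⟩ := hI D ⟨s, hs, by
          rcases Nat.lt_succ_iff_lt_or_eq.1 hsj with h' | h'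
          · exact h'
          · exact absurd ((Fin.ext h' : s = ⟨j, hj⟩) ▸ hs) hjD⟩
        refine ⟨s', hs', fun v hv => ?_⟩
        have : v ∉ supp n (τ₃ 16) := by
          rw [hcl]
          rintro ⟨u, ⟨rfl, hjX⟩, hr⟩
          obtain ⟨E, hE⟩ := Comp.exists_mem (G := G) hjX
          have hvE := (mem_closureIn_compl hE).1 ⟨_, rfl, hr⟩
          exact hjD (Comp.eq_of_mem hvE hv ▸ hE)
        have h0 : τ₃ 16 v = 0 := by simpa [supp] using this
        rw [hρ v, if_neg (fun h => h.2 h0)]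
        exact hlab v hv
  · have hall : ∀ D : Comp G X, ∃ s ∈ D.verts, ∀ v ∈ D.verts, τ 34 v = s := fun D => by
      obtain ⟨s, hs⟩ := D.verts_nonempty
      exact h D ⟨s, hs, s.2⟩
    choose s hs hlab using hall
    exact ⟨fun D => s D, fun D E hDE => Comp.eq_of_mem (hs D) ((Fin.ext hDE : s D = s E) ▸ hs E),
      fun D => (s D).2, fun D v hv => hlab D v hv⟩

/-- Delete the components with tokens, and output a remaining component. -/
def outputProg : Prog :=
  .seq (forLoop 25 (scalar 0) (.ite (.add (.get 3 (scalar 25)) (.get 4 (scalar 25)))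
      (.ite (.get 2 (scalar 25)) .skip (.assign 32 (.get 34 (scalar 25)) (.lit 1))) .skip))
    (.seq (forLoop 25 (scalar 0) (.ite (.get 2 (scalar 25)) .skip
        (.ite (.get 32 (.get 34 (scalar 25))) .skip (.assign 33 (.lit 0) (.get 34 (scalar 25))))))
      (forLoop 25 (scalar 0) (.ite (.get 2 (scalar 25)) (.assign 5 (scalar 25) (.lit 0))
        (.ite (.add (.sub (.get 34 (scalar 25)) (scalar 33)) (.sub (scalar 33) (.get 34 (scalar 25))))
          (.assign 5 (scalar 25) (.lit 0)) (.assign 5 (scalar 25) (.lit 1))))))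

/-- Any component that is alive and free of tokens will do, so array `33` may keep whichever label
is found last. -/
theorem ends_output {σ : Store} (hσ : Setup G X S x q xs σ) {lam : Comp G X → ℕ}
    (hlam : Function.Injective lam) (hL : Labels lam σ)
    (hex : ∃ D ∈ alive lam σ, Disjoint D.verts S) :
    Ends outputProg σ (n * 190 + 60) (fun τ => ∃ D ∈ alive lam σ, Disjoint D.verts S ∧
      Outputs τ D.verts) := by
  refine Ends.seq (T₁ := n * 60 + 20) (T₂ := n * 130 + 40)
    (Ends.for_array (A := 32) (N := n) (T := 40)
      (fun j A => ∀ D : Comp G X, (A (lam D) = 0 ↔ D ∈ alive lam σ ∧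
        ∀ v ∈ D.verts, (v : ℕ) < j → v ∉ S))
      (by decide) rfl (by decide) (fun ρ hρ => ?_) (fun D => by simp [alive]) ?_ le_rfl)
    (fun τ₁ h₁ hfree => ?_) (by omega)
  · rw [scalar, Expr.eval, Expr.eval, hρ 0 (by decide) rfl, hσ.size]
  · intro j hj τ hτ hc hI
    have e2 : τ 2 = σ 2 := hτ 2 (by decide) rfl
    have e3 : τ 3 = σ 3 := hτ 3 (by decide) rfl
    have e4 : τ 4 = σ 4 := hτ 4 (by decide) rfl
    have e34 : τ 34 = σ 34 := hτ 34 (by decide) rfl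
    have htok := hσ.token ⟨j, hj⟩
    have hmem := hσ.mem ⟨j, hj⟩
    have skipCase : ((⟨j, hj⟩ : Fin n) ∈ S → (⟨j, hj⟩ : Fin n) ∈ X) → ∀ D : Comp G X,
        (τ 32 (lam D) = 0 ↔ D ∈ alive lam σ ∧ ∀ v ∈ D.verts, (v : ℕ) < j + 1 → v ∉ S) := by
      intro himp D
      rw [hI D]
      refine and_congr_right fun _ => ⟨fun h v hv hvj => ?_, fun h v hv hvj => h v hv (by omega)⟩
      rcases Nat.lt_succ_iff_lt_or_eq.1 hvj with h' | h'
      · exact h v hv h'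
      · obtain rfl : v = ⟨j, hj⟩ := Fin.ext h'
        exact fun hS => Comp.notMem_of_mem_verts hv (himp hS)
    refine Ends.ite (T' := 20) (by decide) (fun c => ?_) (fun c => Ends.skip (by norm_num) ?_)
    · simp only [Expr.eval, scalar, hc, e3, e4] at c
      refine Ends.ite (T' := 10) (by decide) (fun c1 => Ends.skip (by norm_num) ?_) (fun c1 => ?_)
      · simp only [Expr.eval, scalar, hc, e2] at c1
        exact skipCase fun _ => hmem.1 c1
      · refine Ends.assign (by decide) ?_
        simp only [Expr.eval, scalar, hc, e2, e34, Store.write_self] at c1 ⊢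
        have hjX : (⟨j, hj⟩ : Fin n) ∉ X := fun h => hmem.2 h c1
        obtain ⟨E, hE⟩ := Comp.exists_mem (G := G) hjX
        have hlabE : σ 34 j = lam E := hL E ⟨j, hj⟩ hE
        intro D
        by_cases hDE : D = E
        · subst hDE
          rw [hlabE, Function.update_self]
          refine ⟨fun h => absurd h one_ne_zero, fun h => ?_⟩
          exact absurd (htok.1 c) (h.2 ⟨j, hj⟩ hE (by simp))
        · rw [Function.update_of_ne (fun h => hDE (hlam (h.trans hlabE))), hI D]
          refine and_congr_right fun _ => ⟨fun h v hv hvj => ?_, fun h v hv hvj => h v hv (by omega)⟩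
          rcases Nat.lt_succ_iff_lt_or_eq.1 hvj with h' | h'
          · exact h v hv h'
          · obtain rfl : v = ⟨j, hj⟩ := Fin.ext h'
            exact absurd (Comp.eq_of_mem hv hE) hDE
    · simp only [Expr.eval, scalar, hc, e3, e4] at c
      exact skipCase fun h => absurd c (htok.2 h)
  have s₁ := hσ.lift (by decide) h₁
  have e34 : τ₁ 34 = σ 34 := h₁ 34 rfl
  have hfree' : ∀ D : Comp G X, (τ₁ 32 (lam D) = 0 ↔ D ∈ alive lam σ ∧ Disjoint D.verts S) := by
    intro D
    rw [hfree D, Set.disjoint_left]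
    exact and_congr_right fun _ => ⟨fun h v hv => h v hv v.2, fun h v hv _ => h hv⟩
  refine Ends.seq (T₁ := n * 60 + 20) (T₂ := n * 70 + 20)
    (Ends.for_array (A := 33) (N := n) (T := 40)
      (fun j A => ∀ D : Comp G X, τ₁ 32 (lam D) = 0 → (∃ v ∈ D.verts, (v : ℕ) < j) →
        ∃ E : Comp G X, τ₁ 32 (lam E) = 0 ∧ A 0 = lam E)
      (by decide) rfl (by decide) (fun ρ hρ => ?_)
      (fun D _ ⟨v, _, hv⟩ => absurd hv (Nat.not_lt_zero _)) ?_ le_rfl)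
    (fun τ₂ h₂ hans => ?_) (by omega)
  · rw [scalar, Expr.eval, Expr.eval, hρ 0 (by decide) rfl, s₁.size]
  · intro j hj τ hτ hc hI
    have e2 : τ 2 = τ₁ 2 := hτ 2 (by decide) rfl
    have e32 : τ 32 = τ₁ 32 := hτ 32 (by decide) rfl
    have e34 : τ 34 = σ 34 := (hτ 34 (by decide) rfl).trans e34
    have hmem := s₁.mem ⟨j, hj⟩
    have skipCase : (∀ D : Comp G X, τ₁ 32 (lam D) = 0 → (⟨j, hj⟩ : Fin n) ∉ D.verts) →
        ∀ D : Comp G X, τ₁ 32 (lam D) = 0 → (∃ v ∈ D.verts, (v : ℕ) < j + 1) →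
          ∃ E : Comp G X, τ₁ 32 (lam E) = 0 ∧ τ 33 0 = lam E := by
      rintro hno D hD ⟨v, hv, hvj⟩
      refine hI D hD ⟨v, hv, ?_⟩
      rcases Nat.lt_succ_iff_lt_or_eq.1 hvj with h' | h'
      · exact h'
      · exact absurd ((Fin.ext h' : v = ⟨j, hj⟩) ▸ hv) (hno D hD)
    refine Ends.ite (T' := 30) (by decide) (fun c => Ends.skip (by norm_num) ?_) (fun c => ?_)
    · simp only [Expr.eval, scalar, hc, e2] at c
      exact skipCase fun D _ hv => Comp.notMem_of_mem_verts hv (hmem.1 c)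
    · simp only [Expr.eval, scalar, hc, e2] at c
      have hjX : (⟨j, hj⟩ : Fin n) ∉ X := fun h => hmem.2 h c
      obtain ⟨E, hE⟩ := Comp.exists_mem (G := G) hjX
      have hlabE : σ 34 j = lam E := hL E ⟨j, hj⟩ hE
      refine Ends.ite (T' := 10) (by decide) (fun c1 => Ends.skip (by norm_num) ?_) (fun c1 => ?_)
      · simp only [Expr.eval, scalar, hc, e32, e34, hlabE] at c1
        refine skipCase fun D hD hv => c1 ?_
        rwa [Comp.eq_of_mem hE hv]
      · refine Ends.assign (by decide) ?_
        simp only [Expr.eval, scalar, hc, e32, e34, hlabE, Store.write_self] at c1 ⊢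
        exact fun _ _ _ => ⟨E, c1, by simp⟩
  obtain ⟨D₀, hD₀, hD₀'⟩ := hex
  obtain ⟨v₀, hv₀⟩ := D₀.verts_nonempty
  obtain ⟨D, hD, hansD⟩ := hans D₀ ((hfree' D₀).2 ⟨hD₀, hD₀'⟩) ⟨v₀, hv₀, v₀.2⟩
  have hD' := (hfree' D).1 hD
  have s₂ := s₁.lift (by decide) h₂
  have e34₂ : τ₂ 34 = σ 34 := (h₂ 34 rfl).trans e34
  -- Equality of labels is tested by the sum of the two truncated differences, which vanishes only
  -- for equal numbers.
  refine (Ends.for_array (A := 5) (N := n) (T := 50)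
    (fun j A => ∀ v : Fin n, (v : ℕ) < j → (v ∈ D.verts → A v = 1) ∧ (v ∉ D.verts → A v = 0))
    (by decide) rfl (by decide) (fun ρ hρ => ?_)
    (fun v hv => absurd hv (Nat.not_lt_zero _)) ?_ le_rfl).conseq le_rfl
    fun ρ _ h => ⟨D, hD'.1, hD'.2, fun v => h v v.2⟩
  · rw [scalar, Expr.eval, Expr.eval, hρ 0 (by decide) rfl, s₂.size]
  · intro j hj τ hτ hc hI
    have e2 : τ 2 = τ₂ 2 := hτ 2 (by decide) rfl
    have e33 : τ 33 0 = lam D := by rw [hτ 33 (by decide) rfl, hansD]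
    have e34 : τ 34 = σ 34 := (hτ 34 (by decide) rfl).trans e34₂
    have hmem := s₂.mem ⟨j, hj⟩
    have step : ∀ y, ((⟨j, hj⟩ : Fin n) ∈ D.verts → y = 1) → ((⟨j, hj⟩ : Fin n) ∉ D.verts → y = 0) →
        ∀ v : Fin n, (v : ℕ) < j + 1 → (v ∈ D.verts → Function.update (τ 5) j y v = 1) ∧
          (v ∉ D.verts → Function.update (τ 5) j y v = 0) := by
      intro y h1 h2 v hv
      rcases Nat.lt_succ_iff_lt_or_eq.1 hv with h' | h'
      · rw [Function.update_of_ne (by omega)]; exact hI v h'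
      · obtain rfl : v = ⟨j, hj⟩ := Fin.ext h'
        simpa using ⟨h1, h2⟩
    refine Ends.ite (T' := 40) (by decide) (fun c => ?_) (fun c => ?_)
    · refine Ends.assign (by decide) ?_
      simp only [Expr.eval, scalar, hc, e2, Store.write_self] at c ⊢
      exact step 0 (fun h => absurd (hmem.1 c) (Comp.notMem_of_mem_verts h)) fun _ => rfl
    · simp only [Expr.eval, scalar, hc, e2] at c
      have hjX : (⟨j, hj⟩ : Fin n) ∉ X := fun h => hmem.2 h c
      obtain ⟨E, hE⟩ := Comp.exists_mem (G := G) hjX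
      have hlabE : σ 34 j = lam E := hL E ⟨j, hj⟩ hE
      refine Ends.ite (T' := 10) (by decide) (fun c1 => ?_) (fun c1 => ?_)
      · refine Ends.assign (by decide) ?_
        simp only [Expr.eval, scalar, hc, e33, e34, hlabE, Store.write_self] at c1 ⊢
        refine step 0 (fun h => ?_) fun _ => rfl
        rw [Comp.eq_of_mem hE h] at c1
        omega
      · refine Ends.assign (by decide) ?_
        simp only [Expr.eval, scalar, hc, e33, e34, hlabE, Store.write_self] at c1 ⊢
        refine step 1 (fun _ => rfl) fun h => absurd ?_ h
        have : E = D := hlam (by omega)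
        exact this ▸ hE

end LabelsAndOutput

/-! ### Computing the auxiliary tables by addition and subtraction -/

section Tables

/-- Tabulate the multiples of `n`. -/
def offsetProg : Prog :=
  forLoop 36 (scalar 0)
    (.assign 6 (.add (scalar 36) (.lit 1)) (.add (.get 6 (scalar 36)) (scalar 0)))

theorem ends_offset {σ : Store} {n : ℕ} (h0 : σ 0 0 = n) (h6 : σ 6 0 = 0) :
    Ends offsetProg σ (n * 40 + 20) (fun τ => ∀ i ≤ n, τ 6 i = i * n) := by
  refine Ends.for_array (A := 6) (N := n) (T := 20) (fun j A => ∀ i ≤ j, A i = i * n) (by decide) rfl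
    (by decide) (fun ρ hρ => ?_) (fun i hi => ?_) (fun j hj τ hτ hc hI => ?_) le_rfl
  · rw [scalar, Expr.eval, Expr.eval, hρ 0 (by decide) rfl, h0]
  · obtain rfl : i = 0 := by omega
    simp [h6]
  · refine Ends.assign (by decide) ?_
    simp only [Expr.eval, scalar, hc, Store.write_self, hτ 0 (by decide) rfl, h0]
    intro i hi
    rcases hi.lt_or_eq with h | rfl
    · rw [Function.update_of_ne (by omega)]
      exact hI i (by omega)
    · rw [Function.update_self, hI j le_rfl, Nat.succ_mul]

/-- List the elements of the set in array `2`. -/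
def listProg : Prog :=
  forLoop 36 (scalar 0) (.ite (.get 2 (scalar 36))
    (.seq (.assign 8 (scalar 7) (scalar 36)) (.assign 7 (.lit 0) (.add (scalar 7) (.lit 1)))) .skip)

theorem ends_list {σ : Store} {n : ℕ} {X : Set (Fin n)} (hn : 0 < n) (h0 : σ 0 0 = n)
    (h2 : ∀ v : Fin n, σ 2 v ≠ 0 ↔ v ∈ X) (h7 : σ 7 0 = 0) :
    Ends listProg σ (n * 50 + 20) (fun τ => τ 7 0 = X.ncard ∧ ∃ xs : ℕ → Fin n,
      (∀ i < X.ncard, ∀ j < X.ncard, xs i = xs j → i = j) ∧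
      (∀ y, y ∈ X ↔ ∃ j < X.ncard, xs j = y) ∧ ∀ j < X.ncard, τ 8 j = xs j) := by
  refine (Ends.for_arrays (A := 7) (B := 8) (N := n) (T := 30)
    (fun j A B => (∀ a < A 0, B a < j) ∧ (∀ a < A 0, ∀ b < A 0, B a = B b → a = b) ∧
      ∀ y : Fin n, (y : ℕ) < j → (y ∈ X ↔ ∃ a < A 0, B a = y))
    (by decide) (by decide) rfl (by decide) (fun ρ hρ => ?_) (by simp [h7])
    (fun j hj τ hτ hc hI => ?_) le_rfl).conseq le_rfl fun τ _ ⟨i1, i2, i3⟩ => ?_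
  · rw [scalar, Expr.eval, Expr.eval, hρ 0 (by decide) rfl, h0]
  · obtain ⟨i1, i2, i3⟩ := hI
    have hm := h2 ⟨j, hj⟩
    refine Ends.ite (T' := 25) (by decide) (fun c => ?_) (fun c => Ends.skip (by norm_num) ?_)
    · simp only [Expr.eval, scalar, hc, hτ 2 (by decide) rfl] at c
      refine Ends.seq (T₁ := 10) (T₂ := 10)
        (R := fun ρ => ρ 8 = Function.update (τ 8) (τ 7 0) j)
        (Ends.assign (by decide) ?_) (fun ρ hρ h8 => Ends.assign (by decide) ?_) (by norm_num)
      · simp only [Expr.eval, scalar, hc, Store.write_self]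
      · rw [Store.write_of_ne _ _ _ (by decide : (8 : ℕ) ≠ 7), Store.write_self, h8]
        simp only [Expr.eval, scalar, hρ 7 rfl, Function.update_self]
        set m := τ 7 0 with hmdef
        have hB : ∀ a < m, Function.update (τ 8) m j a = τ 8 a := fun a ha =>
          Function.update_of_ne ha.ne _ _
        have hBm : Function.update (τ 8) m j m = j := Function.update_self ..
        refine ⟨fun a ha => ?_, fun a ha b hb hab => ?_, fun y hy => ⟨fun hyX => ?_, ?_⟩⟩
        · rcases Nat.lt_succ_iff_lt_or_eq.1 ha with h | rfl
          · rw [hB a h]; exact (i1 a h).trans (Nat.lt_succ_self _)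
          · rw [hBm]; exact Nat.lt_succ_self _
        · rcases Nat.lt_succ_iff_lt_or_eq.1 ha with h | h <;>
            rcases Nat.lt_succ_iff_lt_or_eq.1 hb with h' | h'
          · rw [hB a h, hB b h'] at hab
            exact i2 a h b h' hab
          · rw [hB a h, h', hBm] at hab
            exact absurd hab (i1 a h).ne
          · rw [hB b h', h, hBm] at hab
            exact absurd hab.symm (i1 b h').ne
          · rw [h, h']
        · rcases Nat.lt_succ_iff_lt_or_eq.1 hy with h | h
          · obtain ⟨a, ha, hay⟩ := (i3 y h).1 hyX
            exact ⟨a, ha.trans (Nat.lt_succ_self _), by rw [hB a ha, hay]⟩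
          · exact ⟨m, Nat.lt_succ_self _, by rw [hBm, h]⟩
        · rintro ⟨a, ha, hay⟩
          rcases Nat.lt_succ_iff_lt_or_eq.1 ha with h | rfl
          · rw [hB a h] at hay
            exact (i3 y (hay ▸ i1 a h)).2 ⟨a, h, hay⟩
          · rw [hBm] at hay
            obtain rfl : y = ⟨j, hj⟩ := Fin.ext hay.symm
            exact hm.1 c
    · simp only [Expr.eval, scalar, hc, hτ 2 (by decide) rfl] at c
      refine ⟨fun a ha => (i1 a ha).trans (Nat.lt_succ_self _), i2, fun y hy => ?_⟩
      rcases Nat.lt_succ_iff_lt_or_eq.1 hy with h | h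
      · exact i3 y h
      · obtain rfl : y = ⟨j, hj⟩ := Fin.ext h
        refine ⟨fun hyX => absurd c (hm.2 hyX), fun ⟨a, ha, hay⟩ => ?_⟩
        exact absurd hay (i1 a ha).ne
  -- The reduction modulo `n` only serves to land in `Fin n`; listed values are below `n` already.
  · set xs : ℕ → Fin n := fun i => ⟨τ 8 i % n, Nat.mod_lt _ hn⟩ with hxs
    have hval : ∀ a < τ 7 0, (xs a : ℕ) = τ 8 a := fun a ha => Nat.mod_eq_of_lt (i1 a ha)
    have hinj : ∀ i < τ 7 0, ∀ j < τ 7 0, xs i = xs j → i = j := fun i hi j hj hij =>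
      i2 i hi j hj (by rw [← hval i hi, ← hval j hj, hij])
    have hX : ∀ y, y ∈ X ↔ ∃ j < τ 7 0, xs j = y := fun y => by
      rw [i3 y y.2]
      refine exists_congr fun a => and_congr_right fun ha => ?_
      rw [Fin.ext_iff, hval a ha]
    have hcard : τ 7 0 = X.ncard := by
      have : X = xs '' (Set.Iio (τ 7 0)) := by
        ext y; simp [hX]
      have hon : Set.InjOn xs (Set.Iio (τ 7 0)) := fun i hi j hj => hinj i hi j hj
      rw [this, hon.ncard_image]
      simp
    rw [← hcard]
    exact ⟨rfl, xs, hinj, hX, fun j hj => (hval j hj).symm⟩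

/-- Compute the threshold `5xk`. -/
def thresholdProg : Prog :=
  forLoop 36 (scalar 7) (.assign 9 (.lit 0) (.add (scalar 9) (.add (.get 0 (.lit 1))
    (.add (.get 0 (.lit 1)) (.add (.get 0 (.lit 1)) (.add (.get 0 (.lit 1)) (.get 0 (.lit 1))))))))

theorem ends_threshold {σ : Store} {x k : ℕ} (h0 : σ 0 1 = k) (h7 : σ 7 0 = x) (h9 : σ 9 0 = 0) :
    Ends thresholdProg σ (x * 40 + 20) (fun τ => τ 9 0 = 5 * x * k) := by
  refine (Ends.for_array (A := 9) (N := x) (T := 20) (fun j A => A 0 = 5 * j * k) (by decide) rfl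
    (by decide) (fun ρ hρ => ?_) (by simpa using h9) (fun j hj τ hτ hc hI => ?_) le_rfl)
  · rw [scalar, Expr.eval, Expr.eval, hρ 7 (by decide) rfl, h7]
  · refine Ends.assign (by decide) ?_
    simp only [Expr.eval, scalar, Store.write_self, hτ 0 (by decide) rfl, h0, hI,
      Function.update_self]
    ring

/-- Compute the number of bits of a test. -/
def widthProg : Prog :=
  forLoop 36 (scalar 7) (.assign 10 (.lit 0) (.add (scalar 10) (.add (scalar 9) (.lit 3))))

theorem ends_width {σ : Store} {x q : ℕ} (h7 : σ 7 0 = x) (h9 : σ 9 0 = q) (h10 : σ 10 0 = 0) :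
    Ends widthProg σ (x * 40 + 20) (fun τ => τ 10 0 = (q + 3) * x) := by
  refine (Ends.for_array (A := 10) (N := x) (T := 20) (fun j A => A 0 = (q + 3) * j) (by decide) rfl
    (by decide) (fun ρ hρ => ?_) (by simpa using h10) (fun j hj τ hτ hc hI => ?_) le_rfl)
  · rw [scalar, Expr.eval, Expr.eval, hρ 7 (by decide) rfl, h7]
  · refine Ends.assign (by decide) ?_
    simp only [Expr.eval, scalar, Store.write_self, hτ 9 (by decide) rfl, h9, hI,
      Function.update_self]
    ring

/-- Compute the number of tests. -/
def testsProg : Prog :=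
  .seq (.assign 11 (.lit 0) (.lit 1))
    (forLoop 36 (scalar 10) (.assign 11 (.lit 0) (.add (scalar 11) (scalar 11))))

theorem ends_tests {σ : Store} {b : ℕ} (h10 : σ 10 0 = b) :
    Ends testsProg σ (b * 40 + 30) (fun τ => τ 11 0 = 2 ^ b) := by
  refine Ends.seq (T₁ := 10) (R := fun τ => τ 11 0 = 1) (Ends.assign (by decide) (by
    simp only [Expr.eval, Store.write_self, Function.update_self])) (fun τ₁ h₁ h11 =>
    Ends.for_array (A := 11) (N := b) (T := 20) (fun j A => A 0 = 2 ^ j) (by decide) rfl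
    (by decide) (fun ρ hρ => ?_) (by simpa using h11) (fun j hj τ hτ hc hI => ?_) le_rfl)
    (by omega)
  · rw [scalar, Expr.eval, Expr.eval, hρ 10 (by decide) rfl, h₁ 10 rfl, h10]
  · refine Ends.assign (by decide) ?_
    simp only [Expr.eval, scalar, Store.write_self, hI, Function.update_self]
    ring

/-- Tabulate the halves and the parities of the numbers of the tests. -/
def halfProg : Prog :=
  forLoop 36 (scalar 11)
    (.seq (.assign 12 (.add (scalar 36) (.lit 1)) (.add (.get 12 (scalar 36)) (.get 13 (scalar 36))))
      (.assign 13 (.add (scalar 36) (.lit 1)) (.sub (.lit 1) (.get 13 (scalar 36)))))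

theorem ends_half {σ : Store} {N : ℕ} (h11 : σ 11 0 = N) (h12 : σ 12 0 = 0) (h13 : σ 13 0 = 0) :
    Ends halfProg σ (N * 60 + 20)
      (fun τ => (∀ i ≤ N, τ 12 i = i / 2) ∧ ∀ i ≤ N, τ 13 i = i % 2) := by
  refine (Ends.for_arrays (A := 12) (B := 13) (N := N) (T := 40)
    (fun j A B => (∀ i ≤ j, A i = i / 2) ∧ ∀ i ≤ j, B i = i % 2)
    (by decide) (by decide) rfl (by decide) (fun ρ hρ => ?_) ⟨fun i hi => ?_, fun i hi => ?_⟩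
    (fun j hj τ hτ hc ⟨i1, i2⟩ => ?_) le_rfl)
  · rw [scalar, Expr.eval, Expr.eval, hρ 11 (by decide) rfl, h11]
  · obtain rfl : i = 0 := by omega
    simpa using h12
  · obtain rfl : i = 0 := by omega
    simpa using h13
  · refine Ends.seq (T₁ := 20) (T₂ := 20)
      (R := fun ρ => ρ 12 = Function.update (τ 12) (j + 1) (j / 2 + j % 2))
      (Ends.assign (by decide) ?_) (fun ρ hρ h8 => Ends.assign (by decide) ?_) (by norm_num)
    · simp only [Expr.eval, scalar, hc, Store.write_self, i1 j le_rfl, i2 j le_rfl]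
    · rw [Store.write_of_ne _ _ _ (by decide : (12 : ℕ) ≠ 13), Store.write_self, h8]
      simp only [Expr.eval, scalar, hρ 36 rfl, hc, hρ 13 rfl, i2 j le_rfl]
      constructor
      · intro i hi
        rcases hi.lt_or_eq with h | rfl
        · rw [Function.update_of_ne (by omega)]
          exact i1 i (by omega)
        · rw [Function.update_self]
          omega
      · intro i hi
        rcases hi.lt_or_eq with h | rfl
        · rw [Function.update_of_ne (by omega)]
          exact i2 i (by omega)
        · rw [Function.update_self]
          omega

def setupProg : Prog :=
  .seq offsetProg (.seq listProg (.seq thresholdProg (.seq widthProg (.seq testsProg halfProg))))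

def setupTime (n x q : ℕ) : ℕ :=
  n * 40 + 20 + (n * 50 + 20 + (x * 40 + 20 + (x * 40 + 20 + ((q + 3) * x * 40 + 30 +
    (2 ^ ((q + 3) * x) * 60 + 20)))))

theorem ends_setup {n : ℕ} (hn : 0 < n) (G : SimpleGraph (Fin n)) (X Is It : Set (Fin n)) (k : ℕ) :
    Ends setupProg (inputStore G X Is It k) (setupTime n X.ncard (5 * X.ncard * k))
      (fun τ => ∃ xs : ℕ → Fin n, (∀ i < X.ncard, ∀ j < X.ncard, xs i = xs j → i = j) ∧
        (∀ y, y ∈ X ↔ ∃ j < X.ncard, xs j = y) ∧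
        Setup G X (Is ∪ It) X.ncard (5 * X.ncard * k) xs τ) := by
  set σ := inputStore G X Is It k with hσ
  set x := X.ncard with hx
  set q := 5 * x * k with hq
  have i0 : σ 0 0 = n := by simp [hσ, inputStore]
  -- Division with remainder by `n` recovers row and column from a cell number.
  have i1 : ∀ u v : Fin n, σ 1 (u * n + v) ≠ 0 ↔ G.Adj u v := fun u v => by
    have : (∃ u' v' : Fin n, (u : ℕ) * n + v = u' * n + v' ∧ G.Adj u' v') ↔ G.Adj u v := by
      refine ⟨fun ⟨u', v', h, ha⟩ => ?_, fun h => ⟨u, v, rfl, h⟩⟩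
      have h1 := congrArg (· % n) h
      have h2 := congrArg (· / n) h
      simp only [Nat.mul_add_mod_of_lt, v.2, v'.2] at h1
      simp only [mul_comm _ n, Nat.mul_add_div hn, Nat.div_eq_of_lt v.2, Nat.div_eq_of_lt v'.2,
        add_zero] at h2
      rwa [Fin.ext h1, Fin.ext h2]
    simp [hσ, inputStore, this]
  have i2 : ∀ v : Fin n, σ 2 v ≠ 0 ↔ v ∈ X := fun v => by simp [hσ, inputStore, Fin.val_inj]
  have i3 : ∀ v : Fin n, σ 3 v ≠ 0 ↔ v ∈ Is := fun v => by simp [hσ, inputStore, Fin.val_inj]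
  have i4 : ∀ v : Fin n, σ 4 v ≠ 0 ↔ v ∈ It := fun v => by simp [hσ, inputStore, Fin.val_inj]
  refine Ends.seq (ends_offset i0 rfl) (fun τ₁ f₁ h6 => ?_) le_rfl
  refine Ends.seq (ends_list (X := X) hn (by rw [f₁ 0 rfl, i0]) (by rw [f₁ 2 rfl]; exact i2)
    (by rw [f₁ 7 rfl]; rfl)) (fun τ₂ f₂ ⟨h7, xs, hinj, hX, h8⟩ => ?_) le_rfl
  refine Ends.seq (ends_threshold (k := k) (by rw [f₂ 0 rfl, f₁ 0 rfl]; rfl) h7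
    (by rw [f₂ 9 rfl, f₁ 9 rfl]; rfl)) (fun τ₃ f₃ h9 => ?_) le_rfl
  refine Ends.seq (ends_width (by rw [f₃ 7 rfl, h7]) h9 (by rw [f₃ 10 rfl, f₂ 10 rfl, f₁ 10 rfl]; rfl))
    (fun τ₄ f₄ h10 => ?_) le_rfl
  refine Ends.seq (ends_tests h10) (fun τ₅ f₅ h11 => ?_) le_rfl
  refine (ends_half h11 (by rw [f₅ 12 rfl, f₄ 12 rfl, f₃ 12 rfl, f₂ 12 rfl, f₁ 12 rfl]; rfl)
    (by rw [f₅ 13 rfl, f₄ 13 rfl, f₃ 13 rfl, f₂ 13 rfl, f₁ 13 rfl]; rfl)).conseq le_rfl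
    fun τ f₆ h => ⟨xs, hinj, hX, ?_⟩
  have hin : ∀ a < 5, τ a = σ a := fun a ha => by
    have e : ∀ a < 5, setupProg.writes a = false := by decide
    have h := e a ha
    simp only [setupProg, Prog.writes, Bool.or_eq_false_iff] at h
    rw [f₆ a h.2.2.2.2.2, f₅ a h.2.2.2.2.1, f₄ a h.2.2.2.1, f₃ a h.2.2.1, f₂ a h.2.1, f₁ a h.1]
  have t6 : τ 6 = τ₁ 6 := by rw [f₆ 6 rfl, f₅ 6 rfl, f₄ 6 rfl, f₃ 6 rfl, f₂ 6 rfl]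
  have t7 : τ 7 = τ₂ 7 := by rw [f₆ 7 rfl, f₅ 7 rfl, f₄ 7 rfl, f₃ 7 rfl]
  have t8 : τ 8 = τ₂ 8 := by rw [f₆ 8 rfl, f₅ 8 rfl, f₄ 8 rfl, f₃ 8 rfl]
  have t9 : τ 9 = τ₃ 9 := by rw [f₆ 9 rfl, f₅ 9 rfl, f₄ 9 rfl]
  have t10 : τ 10 = τ₄ 10 := by rw [f₆ 10 rfl, f₅ 10 rfl]
  constructor
  · rw [hin 0 (by norm_num), i0]
  · intro u v
    rw [hin 1 (by norm_num), t6, h6 u u.2.le]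
    exact i1 u v
  · intro i
    rw [hin 1 (by norm_num)]
    simp only [hσ, inputStore]
    split_ifs <;> simp
  · rw [hin 2 (by norm_num)]
    exact i2
  · intro v
    rw [hin 3 (by norm_num), hin 4 (by norm_num)]
    rw [Set.mem_union, ← i3, ← i4]
    omega
  · rw [t7, h7]
  · rw [t8]
    exact h8
  · rw [t9, h9]
  · rw [t10, h10]
  · rw [f₆ 11 rfl, h11]
  · exact h.1
  · exact h.2

end Tables

/-! ### The complete algorithm and its running time -/

section Algorithm

/-- Find a removable component. -/
def findProg : Prog :=
  .seq setupProg (.seq labelProg (.seq roundsProg outputProg))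

def findTime (n x q : ℕ) : ℕ :=
  setupTime n x q + (labelTime n + (roundsTime n x q + (n * 190 + 60)))

theorem ends_find {n : ℕ} {G : SimpleGraph (Fin n)} {X Is It : Set (Fin n)} {k : ℕ}
    (hIs : G.IsIndepSet Is) (hk : Is.ncard = k) (hk' : It.ncard = k)
    (h : compBound X.ncard k < Nat.card (Comp G X)) :
    0 < n ∧ Ends findProg (inputStore G X Is It k) (findTime n X.ncard (5 * X.ncard * k))
      (fun τ => ∃ C : Comp G X, Outputs τ C.verts ∧ Removable G Is It C.verts) := by
  -- There are more than `compBound` components, hence at least one, and it has a vertex.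
  have hn : 0 < n := by
    have : Nonempty (Comp G X) := (Nat.card_pos_iff.1 (by omega)).1
    obtain ⟨v, -⟩ := (Classical.arbitrary (Comp G X)).verts_nonempty
    exact v.pos
  refine ⟨hn, ?_⟩
  refine Ends.seq (ends_setup hn G X Is It k) (fun τ₁ f₁ ⟨xs, hinj, hX, s₁⟩ => ?_) le_rfl
  refine Ends.seq (ends_label s₁) (fun τ₂ f₂ ⟨lam, hlam, hlt, hL⟩ => ?_) le_rfl
  have s₂ := s₁.lift (by decide) f₂
  refine Ends.seq (ends_rounds hinj hX s₂ hlam hlt hL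
    (fun i => by rw [f₂ 32 rfl, f₁ 32 rfl]; rfl)) (fun τ₃ f₃ ⟨hst, hcard⟩ => ?_) le_rfl
  have s₃ := s₂.lift (by decide) f₃
  have hrich : Rich (5 * X.ncard * k + 1) (5 * X.ncard * k) (alive lam τ₃) :=
    rich_of_bits hinj hX hst
  have hbound := tests_le_compBound X.ncard k
  -- The elimination loses at most `q` components per test, so more than `4k + 2` stay alive, while
  -- tokens meet at most `2k`.
  obtain ⟨D, hD, hfree⟩ := exists_free hk hk' (𝓗 := alive lam τ₃) (by
    have : 5 * X.ncard * k + 1 + 2 = 5 * X.ncard * k + 3 := rfl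
    rw [this] at hbound
    omega)
  refine (ends_output s₃ hlam (by unfold Labels; rw [f₃ 34 rfl]; exact hL)
    ⟨D, hD, hfree⟩).conseq le_rfl fun τ _ ⟨C, hC, hCf, hout⟩ =>
    ⟨C, hout, hrich.removable hIs hk hk' hC hCf⟩

/-- The function `f` grows at most like `n ^ d`, with the constant `f 1`. -/
def PolyGrowth (d : ℕ) (f : ℕ → ℕ) : Prop :=
  ∀ n, 0 < n → f n ≤ f 1 * n ^ d

theorem PolyGrowth.const (d c : ℕ) : PolyGrowth d fun _ => c := fun _ hn =>
  Nat.le_mul_of_pos_right _ (Nat.pow_pos hn)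

theorem PolyGrowth.add {d : ℕ} {f g : ℕ → ℕ} (hf : PolyGrowth d f) (hg : PolyGrowth d g) :
    PolyGrowth d fun n => f n + g n := fun n hn => by
  simpa only [Nat.add_mul] using Nat.add_le_add (hf n hn) (hg n hn)

theorem PolyGrowth.mul {d : ℕ} {f : ℕ → ℕ} (hf : PolyGrowth d f) :
    PolyGrowth (d + 1) fun n => n * f n := fun n hn => by
  simpa only [Nat.one_mul, pow_succ, mul_comm, mul_left_comm, mul_assoc] using
    Nat.mul_le_mul_left n (hf n hn)

theorem PolyGrowth.const_mul {d : ℕ} {f : ℕ → ℕ} (c : ℕ) (hf : PolyGrowth d f) :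
    PolyGrowth d fun n => c * f n := fun n hn => by
  simpa only [mul_assoc] using Nat.mul_le_mul_left c (hf n hn)

theorem PolyGrowth.mono {d e : ℕ} {f : ℕ → ℕ} (hf : PolyGrowth d f) (h : d ≤ e) :
    PolyGrowth e f := fun n hn =>
  (hf n hn).trans (Nat.mul_le_mul_left _ (Nat.pow_le_pow_right hn h))

theorem PolyGrowth.linear {d : ℕ} (hd : 1 ≤ d) (c : ℕ) : PolyGrowth d fun n => n * c :=
  (PolyGrowth.mul (.const 0 c)).mono hd

theorem polyGrowth_closeTime : PolyGrowth 3 closeTime :=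
  .add (.mul (.add (.mul (.add (.linear le_rfl _) (.const _ _))) (.const _ _))) (.const _ _)

theorem polyGrowth_maskTime (x : ℕ) : PolyGrowth 3 fun n => maskTime n x :=
  .add (.linear (by norm_num) _) (.const _ _)

theorem polyGrowth_phaseTime (x : ℕ) : PolyGrowth 3 fun n => phaseTime n x :=
  .add (.const _ _) (.add (polyGrowth_maskTime x)
    (.add (.add (.linear (by norm_num) _) (.const _ _)) polyGrowth_closeTime))

theorem polyGrowth_reachTime (x q : ℕ) : PolyGrowth 3 fun n => reachTime n x q :=
  .add (.const _ _) (.add (.const _ _) (.add (polyGrowth_maskTime x)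
    (.add (.add (.const_mul _ (.add (polyGrowth_phaseTime x) (.const _ _))) (.const _ _))
      (.add (.const _ _) (.add (polyGrowth_maskTime x)
        (.add (.linear (by norm_num) _) (.const _ _)))))))

theorem polyGrowth_testTime (x q : ℕ) : PolyGrowth 3 fun n => testTime n x q :=
  .add (polyGrowth_reachTime x q) (.add (.add (.linear (by norm_num) _) (.const _ _))
    (.add (.linear (by norm_num) _) (.const _ _)))

/-- Closures take cubic time; labelling and the rounds repeat cubic work `n` times up to factors
depending on `x` and `q` only. -/
theorem polyGrowth_findTime (x q : ℕ) : PolyGrowth 4 fun n => findTime n x q :=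
  .add (.add (.add (.linear (by norm_num) _) (.const _ _))
      (.add (.add (.linear (by norm_num) _) (.const _ _)) (.const _ _)))
    (.add (.add (.mul (.add (.add (.add (.linear (by norm_num) _) (.const _ _))
        (.add (.const _ _) (.add polyGrowth_closeTime
          (.add (.linear (by norm_num) _) (.const _ _))))) (.const _ _))) (.const _ _))
      (.add (.add (.mul (.add (.add (.const_mul _ (.add (polyGrowth_testTime x q) (.const _ _)))
        (.const _ _)) (.const _ _))) (.const _ _)) (.add (.linear (by norm_num) _) (.const _ _))))

/-- The bound at `n = 1` is built from constants, sums, products and one power of two, so it is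
primitive recursive. -/
theorem computable₂_findTime : Computable₂ fun k x : ℕ => findTime 1 x (5 * x * k) := by
  have hpow : Primrec₂ ((· ^ ·) : ℕ → ℕ → ℕ) := Primrec₂.unpaired'.1 Nat.Primrec.pow
  have hx : Primrec fun p : ℕ × ℕ => p.2 := .snd
  have hq : Primrec fun p : ℕ × ℕ => 5 * p.2 * p.1 :=
    Primrec.nat_mul.comp (Primrec.nat_mul.comp (.const 5) hx) .fst
  have add {f g : ℕ × ℕ → ℕ} (hf : Primrec f) (hg : Primrec g) : Primrec fun p => f p + g p :=
    Primrec.nat_add.comp hf hg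
  have mul {f g : ℕ × ℕ → ℕ} (hf : Primrec f) (hg : Primrec g) : Primrec fun p => f p * g p :=
    Primrec.nat_mul.comp hf hg
  have hb : Primrec fun p : ℕ × ℕ => (5 * p.2 * p.1 + 3) * p.2 := mul (add hq (.const _)) hx
  have hN : Primrec fun p : ℕ × ℕ => 2 ^ ((5 * p.2 * p.1 + 3) * p.2) := hpow.comp (.const 2) hb
  have hmask : Primrec fun p : ℕ × ℕ => maskTime 1 p.2 :=
    add (mul (.const _) (add (mul hx (.const _)) (.const _))) (.const _)
  have hphase : Primrec fun p : ℕ × ℕ => phaseTime 1 p.2 :=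
    add (.const _) (add hmask (.const _))
  have hreach : Primrec fun p : ℕ × ℕ => reachTime 1 p.2 (5 * p.2 * p.1) :=
    add (add (mul hb (.const _)) (.const _)) (add (.const _) (add hmask
      (add (add (mul (add hq (.const _)) (add hphase (.const _))) (.const _))
        (add (.const _) (add hmask (.const _))))))
  have hrounds : Primrec fun p : ℕ × ℕ => roundsTime 1 p.2 (5 * p.2 * p.1) :=
    add (mul (.const _) (add (add (mul hN (add (add hreach (.const _)) (.const _))) (.const _))
      (.const _))) (.const _)
  have hsetup : Primrec fun p : ℕ × ℕ => setupTime 1 p.2 (5 * p.2 * p.1) :=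
    add (.const _) (add (.const _) (add (add (mul hx (.const _)) (.const _))
      (add (add (mul hx (.const _)) (.const _)) (add (add (mul hb (.const _)) (.const _))
        (add (mul hN (.const _)) (.const _))))))
  exact Primrec.to_comp (add hsetup (add (.const _) (add hrounds (.const _))))

end Algorithm

end TokenSliding

theorem mainTheorem5 :
    -- a safe collection of at least `4k + 2` components contains a removable one
    (∀ (V : Type*) [Finite V] (G : SimpleGraph V) (X Is It : Set V) (k : ℕ),
      G.IsIndepSet Is → G.IsIndepSet It → Is.ncard = k → It.ncard = k →
      ∀ 𝓗 : Set (TokenSliding.Comp G X),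
        TokenSliding.Safe (5 * X.ncard * k) 𝓗 → 4 * k + 2 ≤ 𝓗.ncard →
        ∃ C ∈ 𝓗, TokenSliding.Removable G Is It C.verts) ∧
    -- components can be deleted until at most `compBound |X| k` of them are left
    (∀ (V : Type*) [Finite V] (G : SimpleGraph V) (X Is It : Set V) (k : ℕ),
      G.IsIndepSet Is → G.IsIndepSet It → Is.ncard = k → It.ncard = k →
      ∃ (𝓓 : Set (TokenSliding.Comp G X)) (U : Set V), U = ⋃ C ∈ 𝓓, C.verts ∧
        TokenSliding.Removable G Is It U ∧
        Nat.card (TokenSliding.Comp (G.induce (Uᶜ)) (Subtype.val ⁻¹' X : Set ↥(Uᶜ))) ≤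
          TokenSliding.compBound X.ncard k) ∧
    -- the bound is `2 ^ O(|X|² k)`
    (∃ c : ℕ, ∀ x k : ℕ, 1 ≤ x → 1 ≤ k →
      TokenSliding.compBound x k ≤ 2 ^ (c * (x ^ 2 * k))) ∧
    -- a removable component is found in time `f(k, |X|) * n ^ O(1)` with `f` computable
    (∃ (p : TokenSliding.Prog) (f : ℕ → ℕ → ℕ) (c : ℕ), Computable₂ f ∧
      ∀ (n : ℕ) (G : SimpleGraph (Fin n)) (X Is It : Set (Fin n)) (k : ℕ),
        G.IsIndepSet Is → G.IsIndepSet It → Is.ncard = k → It.ncard = k →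
        TokenSliding.compBound X.ncard k < Nat.card (TokenSliding.Comp G X) →
        ∃ (σ : TokenSliding.Store) (t : ℕ),
          TokenSliding.Exec p (TokenSliding.inputStore G X Is It k) σ t ∧
          t ≤ f k X.ncard * n ^ c ∧
          ∃ C : TokenSliding.Comp G X,
            TokenSliding.Outputs σ C.verts ∧ TokenSliding.Removable G Is It C.verts) := by
  refine ⟨fun V _ G X Is It k hIs _ hk hk' 𝓗 hsafe hcard =>
      TokenSliding.exists_removable_of_safe hIs hk hk' hsafe hcard,
    fun V _ G X Is It k hIs _ hk hk' => TokenSliding.exists_kernel hIs hk hk',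
    ⟨40, TokenSliding.compBound_le⟩,
    ⟨TokenSliding.findProg, fun k x => TokenSliding.findTime 1 x (5 * x * k), 4,
      TokenSliding.computable₂_findTime, fun n G X Is It k hIs _ hk hk' h => ?_⟩⟩
  -- `PolyGrowth` uses the value at `1` as its constant, so the running time at `n = 1` serves as
  -- the parameter function; it needs `n` positive.
  obtain ⟨hn, σ, t, he, ht, hC⟩ := TokenSliding.ends_find hIs hk hk' h
  exact ⟨σ, t, he, ht.trans (TokenSliding.polyGrowth_findTime _ _ n hn), hC⟩
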